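/- Let $\Bbbk$ be an algebraically closed field of characteristic zero, let $\mathfrak g=\mathfrak{sl}_2$ over $\Bbbk$ with standard basis $e,h,f$, let $\mathcal A=\Bbbk[t,t^{-1}]$, let $\hat{\mathfrak g}=\mathfrak g\otimes\mathcal A$ be the loop algebra (and similarly $\hat{\mathfrak h}=\Bbbk h\otimes\mathcal A$, $\hat{\mathfrak g}_+=\Bbbk e\otimes\mathcal A$), and let $\tilde{\mathfrak g}=\hat{\mathfrak g}\oplus\Bbbk d$ with $[d,x\otimes t^n]=n\,x\otimes t^n$. Put $\tilde{\mathfrak h}=\Bbbk h\oplus\Bbbk d$, and let $\alpha,\delta\in\tilde{\mathfrak h}^*$ be given by $\alpha(h)=2$, $\alpha(d)=0$, $\delta(h)=0$, $\delta(d)=1$; write $\alpha$ also for the restriction of $\alpha$ to $\mathfrak h=\Bbbk h$. Let $\varphi:\mathbb Z\to\Bbbk$ be a non-zero exponential-polynomial function, that is, a linear combination of functions $m\mapsto m^k\lambda^m$ with $k\geq 0$ and $\lambda\in\Bbbk^\times$. Its degree is the unique positive integer $r$ such that the additive monoid generated by the support of $\varphi$ is $r\mathbb Z$ (such an $r$ exists).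 Let $\mathcal A$ be the module over $\mathfrak t=\hat{\mathfrak h}\oplus\Bbbk d$ with $(h\otimes t^m)\cdot t^n=\varphi(m)t^{m+n}$ and $d\cdot t^n=nt^n$, let $H(\varphi)$ be its submodule generated by $1$, extended to $\mathfrak t+\hat{\mathfrak g}_+$ by $\hat{\mathfrak g}_+\cdot H(\varphi)=0$, and let $\tilde L(\varphi)$ be the unique irreducible quotient of $\mathrm{Ind}_{\mathfrak t+\hat{\mathfrak g}_+}^{\tilde{\mathfrak g}}H(\varphi)$. Let $L(\varphi)$ be the unique irreducible quotient of the $\hat{\mathfrak g}$-module induced from the one-dimensional $(\hat{\mathfrak h}+\hat{\mathfrak g}_+)$-module $\Bbbk v_\varphi$ on which $\hat{\mathfrak g}_+$ acts by zero and $(h\otimes t^m)v_\varphi=\varphi(m)v_\varphi$. Let $\zeta\in\Bbbk$ be a primitive $r$-th root of unity, and let $\eta$ be the linear automorphism of $L(\varphi)$ with $\eta(v_\varphi)=v_\varphi$ and $\eta((x\otimes a(t))w)=(x\otimes a(\zeta^{-1}t))\,\eta(w)$ for $x\in\mathfrak g$, $a\in\mathcal A$, $w\in L(\varphi)$. Then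 $\tilde L(\varphi)$ is the direct sum of its weight spaces $\tilde L(\varphi)_\chi$, $\chi\in\tilde{\mathfrak h}^*$, these and the $\mathfrak h$-weight spaces $L(\varphi)_{\frac{\varphi(0)}2\alpha-k\alpha}$, $k\geq0$, are finite-dimensional, and the formal character of $\tilde L(\varphi)$ is $$\sum_{\chi\in\tilde{\mathfrak h}^*}\dim\tilde L(\varphi)_\chi\,Z^\chi \;=\; Z^{\frac{\varphi(0)}2\alpha}\sum_{k\geq0}\sum_{n\in\mathbb Z}\dim\Bigl\{v\in L(\varphi)_{\frac{\varphi(0)}2\alpha-k\alpha}\;:\;\eta(v)=\zeta^n v\Bigr\}\,Z^{-k\alpha+n\delta}.$$ -/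

import Mathlib

open scoped TensorProduct

noncomputable section

namespace ExpPolyModules

universe u v w

attribute [local instance 100] LieRing.ofAssociativeRing

/-! ### Modules over a Lie algebra

A module over a Lie algebra `L` is regarded as a module over its universal enveloping algebra. -/

section General

variable (K : Type u) [Field K] {L : Type v} [LieRing L] [LieAlgebra K L]

/-- The defining relations `(u x) ⊗ n = u ⊗ (x n)`, for `x ∈ p`, of `U(L) ⊗_{U(p)} N`. -/
def indRelations (p : LieSubalgebra K L) (N : Type w) [AddCommGroup N] [Module K N]
    [LieRingModule p N] :
    Submodule (UniversalEnvelopingAlgebra K L) (UniversalEnvelopingAlgebra K L ⊗[K] N) :=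
  Submodule.span (UniversalEnvelopingAlgebra K L)
    {z | ∃ (a : UniversalEnvelopingAlgebra K L) (x : p) (n : N),
      z = (a * UniversalEnvelopingAlgebra.ι K (x : L)) ⊗ₜ[K] n - a ⊗ₜ[K] ⁅x, n⁆}

/-- The induced module `Ind_p^L N = U(L) ⊗_{U(p)} N` of a `p`-module `N`. -/
abbrev Ind (p : LieSubalgebra K L) (N : Type w) [AddCommGroup N] [Module K N]
    [LieRingModule p N] : Type (max u v w) :=
  (UniversalEnvelopingAlgebra K L ⊗[K] N) ⧸ indRelations K p N

/-- The sum of all proper submodules; it is the unique maximal proper submodule whenever there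
is one that contains every proper submodule. -/
def maxSub (R : Type v) [Ring R] (M : Type w) [AddCommGroup M] [Module R M] : Submodule R M :=
  sSup {W : Submodule R M | W ≠ ⊤}

/-- The weight space `M_χ = {v | h v = χ(h) v for all h ∈ H}` of an `L`-module `M`, for
a linear form `χ` on a subspace `H` of `L`. -/
def weightSpace {H : Submodule K L} (M : Type w) [AddCommGroup M] [Module K M]
    [Module (UniversalEnvelopingAlgebra K L) M]
    [IsScalarTower K (UniversalEnvelopingAlgebra K L) M]
    (χ : Module.Dual K H) : Submodule K M where
  carrier := {v | ∀ h : H, UniversalEnvelopingAlgebra.ι K (h : L) • v = χ h • v}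
  add_mem' {a b} ha hb h := by rw [smul_add, smul_add, ha h, hb h]
  zero_mem' h := by rw [smul_zero, smul_zero]
  smul_mem' c x hx h := by
    rw [← algebraMap_smul (UniversalEnvelopingAlgebra K L) c x, smul_smul,
      ← Algebra.commutes, mul_smul, hx h, algebraMap_smul, algebraMap_smul, smul_comm]

/-- `M` is a weight module: it is the direct sum of its weight spaces. -/
def IsWeightModule (H : Submodule K L) (M : Type w) [AddCommGroup M] [Module K M]
    [Module (UniversalEnvelopingAlgebra K L) M]
    [IsScalarTower K (UniversalEnvelopingAlgebra K L) M] : Prop :=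
  open scoped Classical in
  DirectSum.IsInternal (fun χ : Module.Dual K H => weightSpace K M χ)

/-- The formal character `∑_χ dim M_χ Z^χ`, a formal sum being given by its coefficients
(meaningful when all weight spaces are finite-dimensional). -/
def character (H : Submodule K L) (M : Type w) [AddCommGroup M] [Module K M]
    [Module (UniversalEnvelopingAlgebra K L) M]
    [IsScalarTower K (UniversalEnvelopingAlgebra K L) M] : Module.Dual K H → ℕ :=
  fun χ => Module.finrank K (weightSpace K M χ)

/-- The linear endomorphism of `M ⧸ P` induced by a `K`-linear endomorphism of `M` preserving the
`R`-submodule `P`. -/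
def quotMap {R : Type v} [Ring R] [Algebra K R] {M : Type w} [AddCommGroup M] [Module K M]
    [Module R M] [IsScalarTower K R M] (P : Submodule R M) (f : M →ₗ[K] M)
    (hf : ∀ x ∈ P, f x ∈ P) : (M ⧸ P) →ₗ[K] (M ⧸ P) :=
  ((P.restrictScalars K).liftQ ((P.mkQ.restrictScalars K) ∘ₗ f) fun x hx =>
    (Submodule.Quotient.mk_eq_zero P).mpr (hf x hx)) ∘ₗ
    (Submodule.Quotient.restrictScalarsEquiv K P).symm.toLinearMap

theorem quotMap_mk {R : Type v} [Ring R] [Algebra K R] {M : Type w} [AddCommGroup M] [Module K M]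
    [Module R M] [IsScalarTower K R M] (P : Submodule R M) (f : M →ₗ[K] M)
    (hf : ∀ x ∈ P, f x ∈ P) (x : M) :
    quotMap K P f hf (Submodule.Quotient.mk x) = Submodule.Quotient.mk (f x) := rfl

theorem quotMap_smul {R : Type v} [Ring R] [Algebra K R] {M : Type w} [AddCommGroup M]
    [Module K M] [Module R M] [IsScalarTower K R M] (P : Submodule R M) (f : M →ₗ[K] M)
    (hf : ∀ x ∈ P, f x ∈ P) (s : R → R) (hs : ∀ a x, f (a • x) = s a • f x) (a : R) (x : M ⧸ P) :
    quotMap K P f hf (a • x) = s a • quotMap K P f hf x := by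
  obtain ⟨x, rfl⟩ := Submodule.Quotient.mk_surjective P x
  rw [← Submodule.Quotient.mk_smul, quotMap_mk, quotMap_mk, hs, Submodule.Quotient.mk_smul]

/-- An invertible semilinear endomorphism preserves the sum of all proper submodules. -/
theorem map_mem_maxSub {R : Type v} [Ring R] {M : Type w} [AddCommGroup M] [Module R M]
    (f g : M →+ M) (s t : R → R) (hf : ∀ a x, f (a • x) = s a • f x)
    (hg : ∀ a x, g (a • x) = t a • g x) (hgf : ∀ x, g (f x) = x) (x : M)
    (hx : x ∈ maxSub R M) : f x ∈ maxSub R M := by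
  let X : Submodule R M :=
    { carrier := {x | f x ∈ maxSub R M}
      add_mem' := fun {a b} ha hb => by
        change f (a + b) ∈ maxSub R M
        rw [map_add]; exact add_mem ha hb
      zero_mem' := by
        change f 0 ∈ maxSub R M
        rw [map_zero]; exact zero_mem _
      smul_mem' := fun c x h => by
        change f (c • x) ∈ maxSub R M
        rw [hf]; exact Submodule.smul_mem _ _ h }
  suffices h : maxSub R M ≤ X from h hx
  refine sSup_le fun W hW w hw => ?_
  let W' : Submodule R M :=
    { carrier := {x | g x ∈ W}
      add_mem' := fun {a b} ha hb => by
        change g (a + b) ∈ W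
        rw [map_add]; exact add_mem ha hb
      zero_mem' := by
        change g 0 ∈ W
        rw [map_zero]; exact zero_mem _
      smul_mem' := fun c x h => by
        change g (c • x) ∈ W
        rw [hg]; exact Submodule.smul_mem _ _ h }
  have hW' : W' ≠ ⊤ := fun h => hW <| (Submodule.eq_top_iff').mpr fun y => by
    have hy : f y ∈ W' := h ▸ Submodule.mem_top
    have hy' : g (f y) ∈ W := hy
    rwa [hgf] at hy'
  have hmem : f w ∈ W' := by
    change g (f w) ∈ W
    rwa [hgf]
  exact (le_sSup (show W' ∈ {W : Submodule R M | W ≠ ⊤} from hW')) hmem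

variable {K}

/-- The endomorphism of `U(L)` induced by an endomorphism of `L`. -/
def envMap (σ : L →ₗ⁅K⁆ L) : UniversalEnvelopingAlgebra K L →ₐ[K] UniversalEnvelopingAlgebra K L :=
  UniversalEnvelopingAlgebra.lift K ((UniversalEnvelopingAlgebra.ι K).comp σ)

theorem envMap_ι (σ : L →ₗ⁅K⁆ L) (x : L) :
    envMap σ (UniversalEnvelopingAlgebra.ι K x) = UniversalEnvelopingAlgebra.ι K (σ x) :=
  UniversalEnvelopingAlgebra.lift_ι_apply K _ x

theorem envMap_envMap (σ τ : L →ₗ⁅K⁆ L) (h : ∀ x, τ (σ x) = x)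
    (a : UniversalEnvelopingAlgebra K L) : envMap τ (envMap σ a) = a := by
  have : (envMap τ).comp (envMap σ) = AlgHom.id K _ := by
    apply UniversalEnvelopingAlgebra.hom_ext
    ext x
    change envMap τ (envMap σ (UniversalEnvelopingAlgebra.ι K x)) = _
    rw [envMap_ι, envMap_ι, h]
    rfl
  exact DFunLike.congr_fun this a

variable (p : LieSubalgebra K L) (N : Type w) [AddCommGroup N] [Module K N] [LieRingModule p N]

/-- The map `a ⊗ n ↦ σ(a) ⊗ n`. -/
def tensorTwist (σ : L →ₗ⁅K⁆ L) :
    (UniversalEnvelopingAlgebra K L ⊗[K] N) →ₗ[K] (UniversalEnvelopingAlgebra K L ⊗[K] N) :=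
  LinearMap.rTensor N (envMap σ).toLinearMap

theorem tensorTwist_smul (σ : L →ₗ⁅K⁆ L) (a : UniversalEnvelopingAlgebra K L)
    (z : UniversalEnvelopingAlgebra K L ⊗[K] N) :
    tensorTwist N σ (a • z) = envMap σ a • tensorTwist N σ z := by
  induction z using TensorProduct.induction_on with
  | zero => simp
  | add z w hz hw => rw [smul_add, map_add, hz, hw, map_add, smul_add]
  | tmul b n =>
    rw [TensorProduct.smul_tmul', smul_eq_mul]
    change envMap σ (a * b) ⊗ₜ[K] n = envMap σ a • (envMap σ b ⊗ₜ[K] n)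
    rw [map_mul, TensorProduct.smul_tmul', smul_eq_mul]

/-- `σ` preserves `p` and acts trivially on the `p`-module `N`. -/
def Compatible (σ : L →ₗ⁅K⁆ L) : Prop :=
  ∀ x : p, ∃ y : p, (y : L) = σ x ∧ ∀ n : N, ⁅y, n⁆ = ⁅x, n⁆

variable {p N}

theorem tensorTwist_mem {σ : L →ₗ⁅K⁆ L} (hσ : Compatible p N σ)
    (z : UniversalEnvelopingAlgebra K L ⊗[K] N) (hz : z ∈ indRelations K p N) :
    tensorTwist N σ z ∈ indRelations K p N := by
  refine Submodule.span_induction (p := fun z _ => tensorTwist N σ z ∈ indRelations K p N)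
    ?_ ?_ ?_ ?_ hz
  · rintro _ ⟨a, x, n, rfl⟩
    obtain ⟨y, hy, hn⟩ := hσ x
    refine Submodule.subset_span ⟨envMap σ a, y, n, ?_⟩
    rw [map_sub]
    change envMap σ (a * _) ⊗ₜ[K] n - envMap σ a ⊗ₜ[K] ⁅x, n⁆ = _
    rw [map_mul, envMap_ι, hy, hn]
  · rw [map_zero]; exact zero_mem _
  · intro x y _ _ hx hy
    rw [map_add]; exact add_mem hx hy
  · intro a x _ hx
    rw [tensorTwist_smul]; exact Submodule.smul_mem _ _ hx

/-- The endomorphism `a ⊗ n ↦ σ(a) ⊗ n` of the induced module. -/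
def indTwist {σ : L →ₗ⁅K⁆ L} (hσ : Compatible p N σ) : Ind K p N →ₗ[K] Ind K p N :=
  quotMap K (indRelations K p N) (tensorTwist N σ) (tensorTwist_mem hσ)

theorem indTwist_smul {σ : L →ₗ⁅K⁆ L} (hσ : Compatible p N σ)
    (a : UniversalEnvelopingAlgebra K L) (z : Ind K p N) :
    indTwist hσ (a • z) = envMap σ a • indTwist hσ z :=
  quotMap_smul K _ _ _ (envMap σ) (tensorTwist_smul N σ) a z

theorem indTwist_indTwist {σ τ : L →ₗ⁅K⁆ L} (hσ : Compatible p N σ) (hτ : Compatible p N τ)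
    (h : ∀ x, τ (σ x) = x) (z : Ind K p N) : indTwist hτ (indTwist hσ z) = z := by
  obtain ⟨z, rfl⟩ := Submodule.Quotient.mk_surjective _ z
  rw [indTwist, indTwist, quotMap_mk, quotMap_mk]
  congr 1
  induction z using TensorProduct.induction_on with
  | zero => simp
  | add z w hz hw => rw [map_add, map_add, hz, hw]
  | tmul b n =>
    change envMap τ (envMap σ b) ⊗ₜ[K] n = _
    rw [envMap_envMap σ τ h]

/-- The endomorphism `[a ⊗ n] ↦ [σ(a) ⊗ n]` of the quotient of the induced module by the sum of
its proper submodules, for an automorphism `σ` of `L` with inverse `τ`. -/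
def irredTwist {σ τ : L →ₗ⁅K⁆ L} (hσ : Compatible p N σ) (hτ : Compatible p N τ)
    (h : ∀ x, τ (σ x) = x) :
    (Ind K p N ⧸ maxSub (UniversalEnvelopingAlgebra K L) (Ind K p N)) →ₗ[K]
      (Ind K p N ⧸ maxSub (UniversalEnvelopingAlgebra K L) (Ind K p N)) :=
  quotMap K _ (indTwist hσ) fun x hx =>
    map_mem_maxSub (indTwist hσ).toAddMonoidHom (indTwist hτ).toAddMonoidHom
      (envMap σ) (envMap τ) (indTwist_smul hσ) (indTwist_smul hτ) (indTwist_indTwist hσ hτ h) x hx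

theorem irredTwist_smul {σ τ : L →ₗ⁅K⁆ L} (hσ : Compatible p N σ) (hτ : Compatible p N τ)
    (h : ∀ x, τ (σ x) = x) (a : UniversalEnvelopingAlgebra K L)
    (z : Ind K p N ⧸ maxSub (UniversalEnvelopingAlgebra K L) (Ind K p N)) :
    irredTwist hσ hτ h (a • z) = envMap σ a • irredTwist hσ hτ h z :=
  quotMap_smul K _ _ _ (envMap σ) (indTwist_smul hσ) a z

/-- The formal exponential `Z^χ`, a formal sum being given by its coefficients. -/
def expZ {V : Type w} (χ : V) : V → ℕ :=
  open scoped Classical in fun ψ => if ψ = χ then 1 else 0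

end General

section Laurent

variable {K : Type u} [Field K]

/-! ### Functions on the integers -/

/-- Exponential-polynomial functions: the span of the functions `m ↦ m ^ k * lam ^ m`. -/
def IsExpPoly (φ : ℤ → K) : Prop :=
  φ ∈ Submodule.span K {ψ : ℤ → K | ∃ (lam : Kˣ) (k : ℕ),
    ψ = fun m : ℤ => (m : K) ^ k * ((lam ^ m : Kˣ) : K)}

/-- `φ` has degree `r`: `r` is positive and `rℤ` is the monoid generated by the support of `φ`. -/
def HasDegree (φ : ℤ → K) (r : ℕ) : Prop :=
  0 < r ∧ AddSubmonoid.closure (Function.support φ) =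
    (AddSubgroup.zmultiples (r : ℤ)).toAddSubmonoid

/-- The linear endomorphism `T ^ m ↦ φ m • T ^ m` of the Laurent polynomials. -/
def hadamard (φ : ℤ → K) : LaurentPolynomial K →ₗ[K] LaurentPolynomial K :=
  (AddMonoidAlgebra.basis ℤ K).constr K fun m => AddMonoidAlgebra.single m (φ m)

@[simp] theorem hadamard_single (φ : ℤ → K) (m : ℤ) (c : K) :
    hadamard φ (AddMonoidAlgebra.single m c) = AddMonoidAlgebra.single m (φ m * c) := by
  have h : (AddMonoidAlgebra.single m c : LaurentPolynomial K)
      = c • AddMonoidAlgebra.basis ℤ K m := by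
    rw [AddMonoidAlgebra.basis_apply, AddMonoidAlgebra.smul_single, smul_eq_mul, mul_one]
  rw [h, map_smul, hadamard, Module.Basis.constr_basis, AddMonoidAlgebra.smul_single,
    smul_eq_mul, mul_comm]

theorem hadamard_comm (φ ψ : ℤ → K) (a : LaurentPolynomial K) :
    hadamard φ (hadamard ψ a) = hadamard ψ (hadamard φ a) := by
  induction a using AddMonoidAlgebra.induction_linear with
  | zero => simp
  | add a b ha hb => simp [ha, hb]
  | single m c => simp only [hadamard_single, mul_left_comm]

theorem hadamard_mul_of_add {φ : ℤ → K} (h : ∀ m n, φ (m + n) = φ m + φ n)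
    (a b : LaurentPolynomial K) :
    hadamard φ (a * b) = hadamard φ a * b + a * hadamard φ b := by
  induction a using AddMonoidAlgebra.induction_linear with
  | zero => simp
  | add a a' ha ha' => simp only [add_mul, map_add, ha, ha']; abel
  | single m c =>
    induction b using AddMonoidAlgebra.induction_linear with
    | zero => simp
    | add b b' hb hb' => simp only [mul_add, map_add, hb, hb']; abel
    | single n d =>
      simp only [AddMonoidAlgebra.single_mul_single, hadamard_single, h,
        ← AddMonoidAlgebra.single_add]
      congr 1; ring

theorem hadamard_mul_of_mul {φ : ℤ → K} (h : ∀ m n, φ (m + n) = φ m * φ n)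
    (a b : LaurentPolynomial K) :
    hadamard φ (a * b) = hadamard φ a * hadamard φ b := by
  induction a using AddMonoidAlgebra.induction_linear with
  | zero => simp
  | add a a' ha ha' => simp only [add_mul, map_add, ha, ha']
  | single m c =>
    induction b using AddMonoidAlgebra.induction_linear with
    | zero => simp
    | add b b' hb hb' => simp only [mul_add, map_add, hb, hb']
    | single n d =>
      simp only [AddMonoidAlgebra.single_mul_single, hadamard_single, h]
      congr 1; ring

theorem hadamard_cast_mul (a b : LaurentPolynomial K) :
    hadamard (fun m => (m : K)) (a * b) =
      hadamard (fun m => (m : K)) a * b + a * hadamard (fun m => (m : K)) b :=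
  hadamard_mul_of_add (fun m n => Int.cast_add m n) a b

/-- `(a · φ)(0) = ∑ m, a_m φ(m)`, the Laurent polynomials acting on functions by shifts. -/
def pairing (φ : ℤ → K) : LaurentPolynomial K →ₗ[K] K :=
  (AddMonoidAlgebra.basis ℤ K).constr K φ

@[simp] theorem pairing_single (φ : ℤ → K) (m : ℤ) (c : K) :
    pairing φ (AddMonoidAlgebra.single m c) = c * φ m := by
  have h : (AddMonoidAlgebra.single m c : LaurentPolynomial K)
      = c • AddMonoidAlgebra.basis ℤ K m := by
    rw [AddMonoidAlgebra.basis_apply, AddMonoidAlgebra.smul_single, smul_eq_mul, mul_one]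
  rw [h, map_smul, pairing, Module.Basis.constr_basis, smul_eq_mul]

theorem pairing_hadamard {φ ψ : ℤ → K} (h : ∀ m, φ m ≠ 0 → ψ m = 1)
    (a : LaurentPolynomial K) : pairing φ (hadamard ψ a) = pairing φ a := by
  induction a using AddMonoidAlgebra.induction_linear with
  | zero => simp
  | add a b ha hb => simp [ha, hb]
  | single m c =>
    by_cases hm : φ m = 0
    · simp only [hadamard_single, pairing_single, hm, mul_zero]
    · simp only [hadamard_single, pairing_single, h m hm, one_mul]

end Laurent

/-! ### The loop algebra and the affine Lie algebra of `sl₂` -/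

section Algebras

variable (K : Type u) [Field K]

/-- `𝔤 = sl₂`. -/
abbrev G : Type u := LieAlgebra.SpecialLinear.sl (Fin 2) K

/-- `h = diag(1, -1)`. -/
def sh : G K := ⟨!![1, 0; 0, -1], by
  change Matrix.trace (!![1, 0; 0, -1] : Matrix (Fin 2) (Fin 2) K) = 0
  simp [Matrix.trace, Fin.sum_univ_two]⟩

/-- The loop algebra `𝔤 ⊗ K[T;T⁻¹]`. -/
def LoopAlg : Type u := LieAlgebra.loopAlgebra K ℤ (G K)

instance : LieRing (LoopAlg K) := inferInstanceAs (LieRing (LieAlgebra.loopAlgebra K ℤ (G K)))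

instance : LieAlgebra K (LoopAlg K) :=
  inferInstanceAs (LieAlgebra K (LieAlgebra.loopAlgebra K ℤ (G K)))

variable {K}

/-- The element `x ⊗ a` of the loop algebra. -/
def loop (x : G K) (a : LaurentPolynomial K) : LoopAlg K :=
  TensorProduct.tmul K a x

theorem loop_add (x : G K) (a b : LaurentPolynomial K) : loop x (a + b) = loop x a + loop x b :=
  TensorProduct.add_tmul a b x

theorem lie_loop (x y : G K) (a b : LaurentPolynomial K) :
    ⁅loop x a, loop y b⁆ = loop ⁅x, y⁆ (a * b) :=
  LieAlgebra.ExtendScalars.bracket_tmul K (LaurentPolynomial K) (G K) (G K) a b x y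

theorem loop_induction {P : LoopAlg K → Prop} (zero : P 0)
    (loop : ∀ x a, P (loop x a)) (add : ∀ z w, P z → P w → P (z + w)) (z : LoopAlg K) : P z :=
  TensorProduct.induction_on (motive := P) z zero (fun a x => loop x a) add

/-- The component `x ⊗ a ↦ x i j • a` of a loop in the matrix entry `(i, j)`: with respect to
`e, h, f`, entry `(0, 1)` is the `e`-component, `(0, 0)` the `h`-component and `(1, 0)` the
`f`-component. -/
def entry (i j : Fin 2) : LoopAlg K →ₗ[K] LaurentPolynomial K :=
  (TensorProduct.rid K (LaurentPolynomial K)).toLinearMap ∘ₗ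
    LinearMap.lTensor (LaurentPolynomial K)
      ((Matrix.entryLinearMap K K i j).comp
        (LieAlgebra.SpecialLinear.sl (Fin 2) K).toSubmodule.subtype)

@[simp] theorem entry_loop (i j : Fin 2) (x : G K) (a : LaurentPolynomial K) :
    entry i j (loop x a) = x.val i j • a := rfl

theorem entry_one_one (x : G K) : x.val 1 1 = - x.val 0 0 := by
  have h : Matrix.trace x.val = 0 := x.property
  rw [Matrix.trace, Fin.sum_univ_two] at h
  exact eq_neg_of_add_eq_zero_right h

theorem entry_lie_zero_zero (z w : LoopAlg K) :
    entry 0 0 ⁅z, w⁆ = entry 0 1 z * entry 1 0 w - entry 1 0 z * entry 0 1 w := by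
  induction z using loop_induction with
  | zero => simp
  | add z z' hz hz' => simp only [add_lie, map_add, hz, hz', add_mul]; abel
  | loop x a =>
    induction w using loop_induction with
    | zero => simp
    | add w w' hw hw' => simp only [lie_add, map_add, hw, hw', mul_add]; abel
    | loop y b =>
      simp only [lie_loop, entry_loop, LieAlgebra.SpecialLinear.sl_bracket, Matrix.sub_apply,
        Matrix.mul_apply, Fin.sum_univ_two, smul_mul_smul_comm]
      rw [← sub_smul]
      congr 1; ring

theorem entry_lie_one_zero (z w : LoopAlg K) :
    entry 1 0 ⁅z, w⁆ =
      (2 : K) • (entry 1 0 z * entry 0 0 w - entry 0 0 z * entry 1 0 w) := by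
  induction z using loop_induction with
  | zero => simp
  | add z z' hz hz' =>
    simp only [add_lie, map_add, hz, hz', add_mul, ← smul_add]; congr 1; abel
  | loop x a =>
    induction w using loop_induction with
    | zero => simp
    | add w w' hw hw' =>
      simp only [lie_add, map_add, hw, hw', mul_add, ← smul_add]; congr 1; abel
    | loop y b =>
      simp only [lie_loop, entry_loop, LieAlgebra.SpecialLinear.sl_bracket, Matrix.sub_apply,
        Matrix.mul_apply, Fin.sum_univ_two, smul_mul_smul_comm, entry_one_one]
      rw [← sub_smul, smul_smul]
      congr 1; ring

/-- The linear map `x ⊗ T ^ m ↦ φ m • (x ⊗ T ^ m)`. -/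
def loopHadamard (φ : ℤ → K) : LoopAlg K →ₗ[K] LoopAlg K :=
  LinearMap.rTensor (G K) (hadamard φ)

@[simp] theorem loopHadamard_loop (φ : ℤ → K) (x : G K) (a : LaurentPolynomial K) :
    loopHadamard φ (loop x a) = loop x (hadamard φ a) := rfl

theorem entry_loopHadamard (φ : ℤ → K) (i j : Fin 2) (z : LoopAlg K) :
    entry i j (loopHadamard φ z) = hadamard φ (entry i j z) := by
  induction z using loop_induction with
  | zero => simp
  | add z z' hz hz' => simp only [map_add, hz, hz']
  | loop x a => simp

variable (K) in
/-- The degree derivation `x ⊗ T ^ n ↦ n (x ⊗ T ^ n)` of the loop algebra. -/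
def degDer : LieDerivation K (LoopAlg K) (LoopAlg K) where
  toLinearMap := loopHadamard fun m => (m : K)
  leibniz' z w := by
    induction z using loop_induction with
    | zero => simp
    | add z z' hz hz' => simp only [add_lie, lie_add, map_add, hz, hz']; abel
    | loop x a =>
      induction w using loop_induction with
      | zero => simp
      | add w w' hw hw' => simp only [add_lie, lie_add, map_add, hw, hw']; abel
      | loop y b =>
        rw [lie_loop, loopHadamard_loop, loopHadamard_loop, loopHadamard_loop, lie_loop,
          ← lie_skew (loop y b), lie_loop, sub_neg_eq_add, ← loop_add, hadamard_cast_mul,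
          add_comm]

variable (K) in
/-- The linear map `c ↦ c • degDer`, from the abelian Lie algebra `K`. -/
def degHom : K →ₗ⁅K⁆ LieDerivation K (LoopAlg K) (LoopAlg K) where
  toFun c := c • degDer K
  map_add' _ _ := add_smul _ _ _
  map_smul' _ _ := mul_smul _ _ _
  map_lie' {c c'} := by
    have h : ⁅c • degDer K, c' • degDer K⁆ = 0 := by
      ext z
      rw [LieDerivation.lie_apply]
      simp only [LieDerivation.smul_apply, map_smul, LieDerivation.zero_apply]
      rw [smul_comm, sub_self]
    rw [h, LieRing.of_associative_ring_bracket, mul_comm, sub_self, zero_smul]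

variable (K) in
/-- The centreless affine Lie algebra `𝔤 ⊗ K[T;T⁻¹] ⊕ K d` with `[d, x ⊗ T ^ n] = n (x ⊗ T ^ n)`;
an element is a pair `⟨left, right⟩` standing for `left + right d`. -/
abbrev AffAlg : Type u := LieAlgebra.SemiDirectSum (LoopAlg K) K (degHom K)

theorem aff_left_lie (z w : AffAlg K) : (⁅z, w⁆ : AffAlg K).left =
    ⁅z.left, w.left⁆ + z.right • loopHadamard (fun m => (m : K)) w.left
      - w.right • loopHadamard (fun m => (m : K)) z.left := rfl

theorem aff_right_lie (z w : AffAlg K) : (⁅z, w⁆ : AffAlg K).right = 0 := by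
  rw [LieAlgebra.SemiDirectSum.lie_eq_mk]
  simp only [LieRing.of_associative_ring_bracket, mul_comm, sub_self]

variable (K) in
/-- The subalgebra `ĥ + ĝ₊` of the loop algebra: the elements without `f`-component. -/
def loopBorel : LieSubalgebra K (LoopAlg K) where
  toSubmodule := LinearMap.ker (entry 1 0)
  lie_mem' {z w} hz hw := by
    have hz' : entry 1 0 z = 0 := hz
    have hw' : entry 1 0 w = 0 := hw
    change entry 1 0 ⁅z, w⁆ = 0
    rw [entry_lie_one_zero, hz', hw', zero_mul, mul_zero, sub_zero, smul_zero]

variable (K) in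
/-- The subalgebra `t + ĝ₊ = ĥ + K d + ĝ₊` of the affine Lie algebra: the elements without
`f`-component. -/
def affBorel : LieSubalgebra K (AffAlg K) where
  toSubmodule := LinearMap.ker (entry 1 0 ∘ₗ LieAlgebra.SemiDirectSum.projl (degHom K))
  lie_mem' {z w} hz hw := by
    have hz' : entry 1 0 z.left = 0 := hz
    have hw' : entry 1 0 w.left = 0 := hw
    change entry 1 0 (⁅z, w⁆ : AffAlg K).left = 0
    rw [aff_left_lie, map_sub, map_add, map_smul, map_smul, entry_lie_one_zero,
      entry_loopHadamard, entry_loopHadamard, hz', hw']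
    simp

theorem entry_loopBorel (z : loopBorel K) : entry 1 0 (z : LoopAlg K) = 0 := z.2

theorem entry_affBorel (z : affBorel K) : entry 1 0 (z : AffAlg K).left = 0 := z.2

/-! ### The modules `L(φ)` over the loop algebra -/

/-- The space of the one-dimensional `(ĥ + ĝ₊)`-module spanned by `v_φ`. -/
def OneDim (_ : ℤ → K) : Type u := K

instance (φ : ℤ → K) : AddCommGroup (OneDim φ) := inferInstanceAs (AddCommGroup K)

instance (φ : ℤ → K) : Module K (OneDim φ) := inferInstanceAs (Module K K)

/-- The vector `v_φ` spanning the one-dimensional module. -/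
def oneDimVec (φ : ℤ → K) : OneDim φ := (1 : K)

/-- The linear form on `ĥ + ĝ₊` with `h ⊗ a ↦ (a · φ)(0)` and `e ⊗ a ↦ 0`, as a representation. -/
def oneDimRep (φ : ℤ → K) : loopBorel K →ₗ⁅K⁆ Module.End K (OneDim φ) where
  toFun z := pairing φ (entry 0 0 (z : LoopAlg K)) • LinearMap.id
  map_add' z w := by
    change pairing φ (entry 0 0 ((z : LoopAlg K) + (w : LoopAlg K))) • LinearMap.id = _
    rw [map_add, map_add, add_smul]
  map_smul' c z := by
    change pairing φ (entry 0 0 (c • (z : LoopAlg K))) • LinearMap.id = _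
    rw [map_smul, map_smul, smul_assoc, RingHom.id_apply]
  map_lie' {z w} := by
    rw [LieSubalgebra.coe_bracket, entry_lie_zero_zero, entry_loopBorel, entry_loopBorel,
      mul_zero, zero_mul, sub_zero, map_zero, zero_smul, smul_lie, lie_smul, lie_self,
      smul_zero, smul_zero]

instance (φ : ℤ → K) : LieRingModule (loopBorel K) (OneDim φ) :=
  LieRingModule.compLieHom (OneDim φ) (oneDimRep φ)

instance (φ : ℤ → K) : LieModule K (loopBorel K) (OneDim φ) :=
  LieModule.compLieHom (OneDim φ) (oneDimRep φ)

theorem oneDim_lie (φ : ℤ → K) (z : loopBorel K) (n : OneDim φ) :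
    ⁅z, n⁆ = pairing φ (entry 0 0 (z : LoopAlg K)) • n := rfl

/-- The universal module `I(φ)`, induced from `ĥ + ĝ₊`. -/
abbrev LoopInd (φ : ℤ → K) : Type u := Ind K (loopBorel K) (OneDim φ)

/-- `L(φ)`: the irreducible quotient of `I(φ)`, by its maximal proper submodule. -/
abbrev LoopIrred (φ : ℤ → K) : Type u :=
  LoopInd φ ⧸ maxSub (UniversalEnvelopingAlgebra K (LoopAlg K)) (LoopInd φ)

/-- The highest-weight vector of `L(φ)`. -/
def loopVec (φ : ℤ → K) : LoopIrred φ :=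
  Submodule.Quotient.mk (Submodule.Quotient.mk
    ((1 : UniversalEnvelopingAlgebra K (LoopAlg K)) ⊗ₜ[K] oneDimVec φ))

/-- For a unit `ζ`, the automorphism `x ⊗ a(T) ↦ x ⊗ a(ζ T)` of the loop algebra. -/
def rotate (ζ : Kˣ) : LoopAlg K →ₗ⁅K⁆ LoopAlg K where
  toLinearMap := loopHadamard fun m => ((ζ ^ m : Kˣ) : K)
  map_lie' {z w} := by
    change loopHadamard _ _ = ⁅loopHadamard _ _, loopHadamard _ _⁆
    induction z using loop_induction with
    | zero => simp
    | add z z' hz hz' => simp only [add_lie, map_add, hz, hz']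
    | loop x a =>
      induction w using loop_induction with
      | zero => simp
      | add w w' hw hw' => simp only [lie_add, map_add, hw, hw']
      | loop y b =>
        rw [lie_loop, loopHadamard_loop, loopHadamard_loop, loopHadamard_loop, lie_loop,
          hadamard_mul_of_mul fun m n => by rw [zpow_add, Units.val_mul]]

theorem rotate_loop (ζ : Kˣ) (x : G K) (m : ℤ) (c : K) :
    rotate ζ (loop x (AddMonoidAlgebra.single m c)) =
      loop x (AddMonoidAlgebra.single m (((ζ ^ m : Kˣ) : K) * c)) := by
  change loopHadamard _ _ = _
  rw [loopHadamard_loop, hadamard_single]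

theorem rotate_inv (ζ : Kˣ) (z : LoopAlg K) : rotate ζ (rotate ζ⁻¹ z) = z := by
  change loopHadamard _ (loopHadamard _ z) = z
  induction z using loop_induction with
  | zero => simp
  | add z z' hz hz' => simp only [map_add, hz, hz']
  | loop x a =>
    rw [loopHadamard_loop, loopHadamard_loop]
    congr 1
    induction a using AddMonoidAlgebra.induction_linear with
    | zero => simp
    | add a b ha hb => simp only [map_add, ha, hb]
    | single m c =>
      rw [hadamard_single, hadamard_single, ← mul_assoc, ← Units.val_mul, ← mul_zpow,
        mul_inv_cancel, one_zpow, Units.val_one, one_mul]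

theorem rotate_compatible {φ : ℤ → K} {ζ : Kˣ} (h : ∀ m, φ m ≠ 0 → ζ ^ m = 1) :
    Compatible (loopBorel K) (OneDim φ) (rotate ζ) := by
  intro z
  have hz : rotate ζ z ∈ loopBorel K := by
    change entry 1 0 (loopHadamard _ _) = 0
    rw [entry_loopHadamard, entry_loopBorel, map_zero]
  refine ⟨⟨rotate ζ z, hz⟩, rfl, fun n => ?_⟩
  rw [oneDim_lie, oneDim_lie]
  change pairing φ (entry 0 0 (loopHadamard _ _)) • n = _
  rw [entry_loopHadamard, pairing_hadamard fun m hm => by rw [h m hm, Units.val_one]]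

theorem HasDegree.zpow_eq_one {φ : ℤ → K} {r : ℕ} (hr : HasDegree φ r) {ζ : Kˣ}
    (hζ : ζ ^ r = 1) (m : ℤ) (hm : φ m ≠ 0) : ζ ^ m = 1 := by
  have h : m ∈ AddSubmonoid.closure (Function.support φ) := AddSubmonoid.subset_closure hm
  rw [hr.2] at h
  obtain ⟨k, rfl⟩ := AddSubgroup.mem_zmultiples_iff.mp h
  rw [smul_eq_mul, mul_comm, zpow_mul, zpow_natCast, hζ, one_zpow]

/-- The linear endomorphism `η = η_φ` of `L(φ)`, where `r` is the degree of `φ` and `ζ ^ r = 1`,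
with `η(v_φ) = v_φ` and `η((x ⊗ a) w) = (x ⊗ a(ζ⁻¹ T)) η(w)`. -/
def eta {φ : ℤ → K} {r : ℕ} (hr : HasDegree φ r) (ζ : Kˣ) (hζ : ζ ^ r = 1) :
    LoopIrred φ →ₗ[K] LoopIrred φ :=
  irredTwist (σ := rotate ζ⁻¹) (τ := rotate ζ)
    (rotate_compatible (hr.zpow_eq_one (by rw [inv_pow, hζ, inv_one])))
    (rotate_compatible (hr.zpow_eq_one hζ)) (rotate_inv ζ)

theorem eta_vec {φ : ℤ → K} {r : ℕ} (hr : HasDegree φ r) (ζ : Kˣ) (hζ : ζ ^ r = 1) :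
    eta hr ζ hζ (loopVec φ) = loopVec φ := by
  change Submodule.Quotient.mk (Submodule.Quotient.mk (envMap _ 1 ⊗ₜ[K] oneDimVec φ)) = _
  rw [map_one]
  rfl

theorem eta_lie {φ : ℤ → K} {r : ℕ} (hr : HasDegree φ r) (ζ : Kˣ) (hζ : ζ ^ r = 1)
    (z : LoopAlg K) (w : LoopIrred φ) :
    eta hr ζ hζ (UniversalEnvelopingAlgebra.ι K z • w) =
      UniversalEnvelopingAlgebra.ι K (rotate ζ⁻¹ z) • eta hr ζ hζ w := by
  rw [eta, irredTwist_smul, envMap_ι]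

/-! ### The modules `L̃(φ)` over the affine Lie algebra -/

/-- The Laurent polynomials, as a `(t + ĝ₊)`-module depending on `φ`. -/
def TMod (_ : ℤ → K) : Type u := LaurentPolynomial K

instance (φ : ℤ → K) : AddCommGroup (TMod φ) := inferInstanceAs (AddCommGroup (LaurentPolynomial K))

instance (φ : ℤ → K) : Module K (TMod φ) := inferInstanceAs (Module K (LaurentPolynomial K))

/-- The representation of `t + ĝ₊` on Laurent polynomials with
`h ⊗ T ^ m · T ^ n = φ m • T ^ (m + n)`, `d · T ^ n = n T ^ n` and `ĝ₊ · T ^ n = 0`. -/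
def tRep (φ : ℤ → K) : affBorel K →ₗ⁅K⁆ Module.End K (TMod φ) where
  toFun z := (LinearMap.mulLeft K (hadamard φ (entry 0 0 (z : AffAlg K).left)) +
    (z : AffAlg K).right • hadamard (fun m => (m : K)) :
      Module.End K (LaurentPolynomial K))
  map_add' z w := by
    refine LinearMap.ext fun a : LaurentPolynomial K => ?_
    change hadamard φ (entry 0 0 ((z : AffAlg K).left + (w : AffAlg K).left)) * a +
      ((z : AffAlg K).right + (w : AffAlg K).right) • hadamard _ a =
      (hadamard φ (entry 0 0 (z : AffAlg K).left) * a + (z : AffAlg K).right • hadamard _ a) +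
      (hadamard φ (entry 0 0 (w : AffAlg K).left) * a + (w : AffAlg K).right • hadamard _ a)
    simp only [map_add, add_mul, add_smul]; abel
  map_smul' c z := by
    refine LinearMap.ext fun a : LaurentPolynomial K => ?_
    change hadamard φ (entry 0 0 (c • (z : AffAlg K).left)) * a +
      (c • (z : AffAlg K).right) • hadamard _ a =
      c • (hadamard φ (entry 0 0 (z : AffAlg K).left) * a + (z : AffAlg K).right • hadamard _ a)
    simp only [map_smul, smul_add, smul_mul_assoc, smul_assoc]
  map_lie' {z w} := by
    refine LinearMap.ext fun a : LaurentPolynomial K => ?_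
    change hadamard φ (entry 0 0 (⁅(z : AffAlg K), (w : AffAlg K)⁆ : AffAlg K).left) * a +
      (⁅(z : AffAlg K), (w : AffAlg K)⁆ : AffAlg K).right • hadamard _ a =
      (hadamard φ (entry 0 0 (z : AffAlg K).left) *
          (hadamard φ (entry 0 0 (w : AffAlg K).left) * a
            + (w : AffAlg K).right • hadamard (fun m => (m : K)) a)
        + (z : AffAlg K).right • hadamard (fun m => (m : K))
          (hadamard φ (entry 0 0 (w : AffAlg K).left) * a
            + (w : AffAlg K).right • hadamard (fun m => (m : K)) a)) -
      (hadamard φ (entry 0 0 (w : AffAlg K).left) *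
          (hadamard φ (entry 0 0 (z : AffAlg K).left) * a
            + (z : AffAlg K).right • hadamard (fun m => (m : K)) a)
        + (w : AffAlg K).right • hadamard (fun m => (m : K))
          (hadamard φ (entry 0 0 (z : AffAlg K).left) * a
            + (z : AffAlg K).right • hadamard (fun m => (m : K)) a))
    rw [aff_left_lie, aff_right_lie, zero_smul, add_zero, map_sub, map_add, map_smul, map_smul,
      entry_lie_zero_zero, entry_affBorel, entry_affBorel, entry_loopHadamard,
      entry_loopHadamard, mul_zero, zero_mul, sub_zero, zero_add, map_sub, map_smul, map_smul,
      hadamard_comm φ, hadamard_comm φ]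
    simp only [map_add, map_smul, hadamard_cast_mul]
    simp only [Algebra.smul_def]
    ring

instance (φ : ℤ → K) : LieRingModule (affBorel K) (TMod φ) :=
  LieRingModule.compLieHom (TMod φ) (tRep φ)

instance (φ : ℤ → K) : LieModule K (affBorel K) (TMod φ) :=
  LieModule.compLieHom (TMod φ) (tRep φ)

theorem tMod_lie (φ : ℤ → K) (z : affBorel K) (a : LaurentPolynomial K) :
    ⁅z, (show TMod φ from a)⁆ = (show TMod φ from
      hadamard φ (entry 0 0 (z : AffAlg K).left) * a
        + (z : AffAlg K).right • hadamard (fun m => (m : K)) a) := rfl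

/-- `H(φ)`: the submodule generated by `1`. As `ĝ₊` acts by zero, this is the `t`-submodule
generated by `1`, extended to `t + ĝ₊` by `ĝ₊ · H(φ) = 0`. -/
def HMod (φ : ℤ → K) : LieSubmodule K (affBorel K) (TMod φ) :=
  LieSubmodule.lieSpan K (affBorel K) {(show TMod φ from (1 : LaurentPolynomial K))}

/-- The module induced from `H(φ)`. -/
abbrev AffInd (φ : ℤ → K) : Type u := Ind K (affBorel K) (HMod φ)

/-- `L̃(φ)`: the irreducible quotient of the module induced from `H(φ)`, by its maximal proper
submodule. -/
abbrev AffIrred (φ : ℤ → K) : Type u :=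
  AffInd φ ⧸ maxSub (UniversalEnvelopingAlgebra K (AffAlg K)) (AffInd φ)

/-! ### Cartan subalgebras and weights -/

variable (K) in
/-- `𝔥 = K h`, inside the loop algebra. -/
def loopCartan : Submodule K (LoopAlg K) := Submodule.span K {loop (sh K) 1}

variable (K) in
/-- `h̃ = K h ⊕ K d`, inside the affine Lie algebra. -/
def affCartan : Submodule K (AffAlg K) := Submodule.span K {⟨loop (sh K) 1, 0⟩, ⟨0, 1⟩}

variable (K) in
/-- The root `α` on `𝔥`: `α(h) = 2`. -/
def loopAlpha : Module.Dual K (loopCartan K) :=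
  ((2 : K) • pairing (fun m => if m = 0 then 1 else 0) ∘ₗ entry 0 0) ∘ₗ (loopCartan K).subtype

variable (K) in
/-- The root `α` on `h̃`: `α(h) = 2` and `α(d) = 0`. -/
def alpha : Module.Dual K (affCartan K) :=
  ((2 : K) • pairing (fun m => if m = 0 then 1 else 0) ∘ₗ entry 0 0 ∘ₗ
    LieAlgebra.SemiDirectSum.projl (degHom K)) ∘ₗ (affCartan K).subtype

variable (K) in
/-- The imaginary root `δ` on `h̃`: `δ(h) = 0` and `δ(d) = 1`. -/
def delta : Module.Dual K (affCartan K) :=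
  (LieAlgebra.SemiDirectSum.projr (degHom K)).toLinearMap ∘ₗ (affCartan K).subtype

theorem pairing_one : pairing (fun m => if m = 0 then (1 : K) else 0) 1 = 1 := by
  rw [AddMonoidAlgebra.one_def, pairing_single, if_pos rfl, mul_one]

theorem loopAlpha_h (h : loopCartan K) (hh : (h : LoopAlg K) = loop (sh K) 1) :
    loopAlpha K h = 2 := by
  simp [loopAlpha, hh, sh, pairing_one]

theorem alpha_h (h : affCartan K) (hh : (h : AffAlg K) = ⟨loop (sh K) 1, 0⟩) :
    alpha K h = 2 := by
  simp [alpha, hh, sh, pairing_one]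

theorem alpha_d (h : affCartan K) (hh : (h : AffAlg K) = ⟨0, 1⟩) : alpha K h = 0 := by
  simp [alpha, hh]

theorem delta_h (h : affCartan K) (hh : (h : AffAlg K) = ⟨loop (sh K) 1, 0⟩) :
    delta K h = 0 := by
  simp [delta, hh]

theorem delta_d (h : affCartan K) (hh : (h : AffAlg K) = ⟨0, 1⟩) : delta K h = 1 := by
  simp [delta, hh]

/-- The weight `φ(0) α / 2 - k α` of `𝔥`. -/
def loopWeight (φ : ℤ → K) (k : ℕ) : Module.Dual K (loopCartan K) :=
  (φ 0 / 2) • loopAlpha K - k • loopAlpha K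

/-- The subspace `{v ∈ L(φ)_{φ(0) α / 2 - k α} | η v = ζ ^ n v}`. -/
def semiInvariants {φ : ℤ → K} {r : ℕ} (hr : HasDegree φ r) (ζ : Kˣ) (hζ : ζ ^ r = 1)
    (k : ℕ) (n : ℤ) : Submodule K (LoopIrred φ) :=
  weightSpace K (LoopIrred φ) (loopWeight φ k) ⊓
    Module.End.eigenspace (eta hr ζ hζ) ((ζ ^ n : Kˣ) : K)

end Algebras

end ExpPolyModules

end

open scoped TensorProduct

noncomputable section

namespace ExpPolyModules

universe u v w

attribute [local instance 100] LieRing.ofAssociativeRing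

/-! ### Generators of the loop algebra -/

section Generators

variable (K : Type u) [Field K]

/-! The module `L̃(φ)` is realised inside a loop module. On `L(φ) ⊗ K[T;T⁻¹]`, modelled by `ℤ →₀
LoopIrred φ`, the element `x ⊗ T ^ m` acts on `L(φ)` as usual and raises the degree by `m`, while
`d` reads the degree. Since `H(φ)` is spanned by the `T ^ p` with `r ∣ p`, the rule `T ^ p ↦ v_φ ⊗ T
^ p` extends to a homomorphism `affLift` from the induced module. Its kernel is the largest proper
submodule (`HasDegree.mem_maxSub_affInd`), so `L̃(φ)` embeds.

The image is spanned by the `w ⊗ T ^ (p + s)`, where `r ∣ p` and `w` is a word in the `f ⊗ T ^ m`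
applied to `v_φ`, of total exponent `s`. As `η w = ζ ^ (-s) w` and `ζ ^ r = 1`, the degree `n`
component of the image lies in the `ζ ^ (-n)`-eigenspace of `η`; as `ζ` is primitive, it is the
whole eigenspace (`HasDegree.eta_embed`, `HasDegree.single_mem_range`). Hence the weight space for
`(k, n)` is isomorphic to the space of semi-invariants for `(k, -n)`. The sign is removed by a
non-degenerate contravariant form on `L(φ)`: it is `η`-invariant, so it pairs the `ζ ^ n`- and `ζ ^
(-n)`-eigenspaces within each `h`-weight space (`finrank_semiInvariants_neg`).

The form comes from an explicit model that stands in for the PBW theorem. The loop algebra acts on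
`K[X n : n ∈ ℤ]` by differential operators, with `f ⊗ T ^ m` acting as multiplication by `X m`. The
constant term is then a functional on the universal module that kills every image of `f ⊗ a` and
takes the value `1` on the generator. Under the transposed action this functional is itself a
highest weight vector, so the universal property yields a form. Its radical is the largest proper
submodule (`mem_maxSub_loopInd`).

The form also gives finiteness: `f ⊗ a` acts as zero on `L(φ)` once `∑ a_s φ(s + m) = 0` for all
`m`, and the shifts of an exponential-polynomial function span a finite-dimensional space. The same
finite-dimensionality shows that `φ` is non-zero at some positive and at some negative integer,
which is why the monoid generated by its support is a group `rℤ` with `r > 0`. -/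

/-- `e = E₁₂`. -/
def se : G K := ⟨!![0, 1; 0, 0], by
  change Matrix.trace (!![0, 1; 0, 0] : Matrix (Fin 2) (Fin 2) K) = 0
  simp [Matrix.trace, Fin.sum_univ_two]⟩

/-- `f = E₂₁`. -/
def sf : G K := ⟨!![0, 0; 1, 0], by
  change Matrix.trace (!![0, 0; 1, 0] : Matrix (Fin 2) (Fin 2) K) = 0
  simp [Matrix.trace, Fin.sum_univ_two]⟩

variable {K}

/-- `a ↦ x ⊗ a` as a linear map. -/
def loopL (x : G K) : LaurentPolynomial K →ₗ[K] LoopAlg K where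
  toFun := loop x
  map_add' := loop_add x
  map_smul' c a := (TensorProduct.smul_tmul' c a x).symm

@[simp] theorem loopL_apply (x : G K) (a : LaurentPolynomial K) : loopL x a = loop x a := rfl

theorem loop_smul_left (c : K) (x : G K) (a : LaurentPolynomial K) :
    loop (c • x) a = loop x (c • a) := by
  change a ⊗ₜ[K] (c • x) = (c • a) ⊗ₜ[K] x
  rw [TensorProduct.smul_tmul]

theorem loop_add_left (x y : G K) (a : LaurentPolynomial K) :
    loop (x + y) a = loop x a + loop y a := TensorProduct.tmul_add a x y

theorem sl_eq (x : G K) :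
    x = x.val 0 1 • se K + x.val 0 0 • sh K + x.val 1 0 • sf K := by
  apply Subtype.ext
  ext i j
  fin_cases i <;> fin_cases j <;> simp [se, sh, sf, entry_one_one]

theorem loop_decomp (z : LoopAlg K) :
    z = loop (se K) (entry 0 1 z) + loop (sh K) (entry 0 0 z) + loop (sf K) (entry 1 0 z) := by
  induction z using loop_induction with
  | zero => simp only [← loopL_apply, map_zero, add_zero]
  | add z w hz hw =>
    conv_lhs => rw [hz, hw]
    simp only [← loopL_apply, map_add]; abel
  | loop x a =>
    conv_lhs => rw [sl_eq x]
    simp only [entry_loop, loop_add_left, loop_smul_left]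

theorem entry_se (i j : Fin 2) (a : LaurentPolynomial K) :
    entry i j (loop (se K) a) = if i = 0 ∧ j = 1 then a else 0 := by
  fin_cases i <;> fin_cases j <;> simp [se]

theorem entry_sh_one_zero (a : LaurentPolynomial K) :
    entry 1 0 (loop (sh K) a) = 0 := by simp [sh]

theorem entry_sh_zero_zero (a : LaurentPolynomial K) :
    entry 0 0 (loop (sh K) a) = a := by simp [sh]

theorem lie_se_sf (a b : LaurentPolynomial K) :
    ⁅loop (se K) a, loop (sf K) b⁆ = loop (sh K) (a * b) := by
  rw [lie_loop]; congr 1; apply Subtype.ext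
  ext i j
  fin_cases i <;> fin_cases j <;>
    simp [se, sh, sf, Ring.lie_def]

theorem lie_sh_sf (a b : LaurentPolynomial K) :
    ⁅loop (sh K) a, loop (sf K) b⁆ = (-2 : K) • loop (sf K) (a * b) := by
  rw [lie_loop, ← loopL_apply (sf K), ← map_smul, loopL_apply, ← loop_smul_left]
  congr 1; apply Subtype.ext
  ext i j
  fin_cases i <;> fin_cases j <;>
    simp [sh, sf, Ring.lie_def]
  ring

theorem lie_sh_se (a b : LaurentPolynomial K) :
    ⁅loop (sh K) a, loop (se K) b⁆ = (2 : K) • loop (se K) (a * b) := by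
  rw [lie_loop, ← loopL_apply (se K), ← map_smul, loopL_apply, ← loop_smul_left]
  congr 1; apply Subtype.ext
  ext i j
  fin_cases i <;> fin_cases j <;>
    simp [sh, se, Ring.lie_def]
  ring

theorem lie_loop_self (x : G K) (a b : LaurentPolynomial K) :
    ⁅loop x a, loop x b⁆ = 0 := by
  rw [lie_loop, lie_self]; exact TensorProduct.tmul_zero _ _

theorem entry_lie_zero_one (z w : LoopAlg K) :
    entry 0 1 ⁅z, w⁆ =
      (2 : K) • (entry 0 0 z * entry 0 1 w - entry 0 1 z * entry 0 0 w) := by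
  induction z using loop_induction with
  | zero => simp
  | add z z' hz hz' =>
    simp only [add_lie, map_add, hz, hz', add_mul, ← smul_add]; congr 1; abel
  | loop x a =>
    induction w using loop_induction with
    | zero => simp
    | add w w' hw hw' =>
      simp only [lie_add, map_add, hw, hw', mul_add, ← smul_add]; congr 1; abel
    | loop y b =>
      simp only [lie_loop, entry_loop, LieAlgebra.SpecialLinear.sl_bracket, Matrix.sub_apply,
        Matrix.mul_apply, Fin.sum_univ_two, smul_mul_smul_comm, entry_one_one]
      rw [← sub_smul, smul_smul]
      congr 1; ring

/-! ### Laurent monomials and representations given on generators -/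

/-- The Laurent monomial `T ^ m`. -/
abbrev tt (m : ℤ) : LaurentPolynomial K := AddMonoidAlgebra.single m 1

theorem tt_mul (m n : ℤ) : (tt m : LaurentPolynomial K) * tt n = tt (m + n) := by
  rw [AddMonoidAlgebra.single_mul_single, mul_one]

theorem tt_zero : (tt 0 : LaurentPolynomial K) = 1 := rfl

theorem single_eq_smul_tt (m : ℤ) (c : K) :
    (AddMonoidAlgebra.single m c : LaurentPolynomial K) = c • tt m := by
  rw [AddMonoidAlgebra.smul_single, smul_eq_mul, mul_one]

theorem laurent_induction {P : LaurentPolynomial K → Prop} (a : LaurentPolynomial K)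
    (zero : P 0) (add : ∀ a b, P a → P b → P (a + b)) (smul : ∀ (c : K) m, P (c • tt m)) : P a := by
  induction a using AddMonoidAlgebra.induction_linear with
  | zero => exact zero
  | add a b ha hb => exact add a b ha hb
  | single m c => rw [single_eq_smul_tt]; exact smul c m

/-- The linear extension to Laurent polynomials of a family indexed by the monomials. -/
def laurentExt {V : Type w} [AddCommGroup V] [Module K V] (g : ℤ → V) :
    LaurentPolynomial K →ₗ[K] V :=
  (AddMonoidAlgebra.basis ℤ K).constr K g

@[simp] theorem laurentExt_tt {V : Type w} [AddCommGroup V] [Module K V] (g : ℤ → V) (m : ℤ) :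
    laurentExt (K := K) g (tt m) = g m := by
  have h := Module.Basis.constr_basis (AddMonoidAlgebra.basis ℤ K) K g m
  rwa [AddMonoidAlgebra.basis_apply] at h

variable (K) in
/-- Operators `e m`, `h m`, `f m` on `M` with the commutation relations of the elements
`e ⊗ T ^ m`, `h ⊗ T ^ m`, `f ⊗ T ^ m` of the loop algebra. -/
structure LoopTriple (M : Type w) [AddCommGroup M] [Module K M] where
  e : ℤ → Module.End K M
  h : ℤ → Module.End K M
  f : ℤ → Module.End K M
  e_f : ∀ m n, ⁅e m, f n⁆ = h (m + n)
  h_f : ∀ m n, ⁅h m, f n⁆ = (-2 : K) • f (m + n)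
  h_e : ∀ m n, ⁅h m, e n⁆ = (2 : K) • e (m + n)
  h_h : ∀ m n, ⁅h m, h n⁆ = 0
  e_e : ∀ m n, ⁅e m, e n⁆ = 0
  f_f : ∀ m n, ⁅f m, f n⁆ = 0

/-- Both sides are bilinear in `a` and `b`, so monomials suffice. The scalar `c` lets one lemma
serve all six families of relations, the vanishing brackets being the case `c = 0`. -/
theorem laurentExt_lie {A : Type w} [Ring A] [Algebra K A] {x y z : ℤ → A} {c : K}
    (h : ∀ m n, ⁅x m, y n⁆ = c • z (m + n)) (a b : LaurentPolynomial K) :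
    ⁅laurentExt x a, laurentExt y b⁆ = c • laurentExt z (a * b) := by
  induction a using laurent_induction with
  | zero => simp
  | add a a' ha ha' => simp only [map_add, add_lie, ha, ha', add_mul, smul_add]
  | smul r m =>
    induction b using laurent_induction with
    | zero => simp
    | add b b' hb hb' => simp only [map_add, lie_add, hb, hb', mul_add, smul_add]
    | smul s n =>
      rw [smul_mul_smul_comm, tt_mul, map_smul, map_smul, map_smul, laurentExt_tt,
        laurentExt_tt, laurentExt_tt, Ring.lie_def, smul_mul_smul_comm, smul_mul_smul_comm,
        mul_comm s r, ← smul_sub, ← Ring.lie_def, h, smul_comm c]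

/-- The representation of the loop algebra given by its generators. -/
def LoopTriple.rep {M : Type w} [AddCommGroup M] [Module K M] (t : LoopTriple K M) :
    LoopAlg K →ₗ⁅K⁆ Module.End K M where
  toLinearMap := laurentExt t.e ∘ₗ entry 0 1 + laurentExt t.h ∘ₗ entry 0 0 +
    laurentExt t.f ∘ₗ entry 1 0
  map_lie' {z w} := by
    have ef := laurentExt_lie (c := (1 : K)) (x := t.e) (y := t.f) (fun m n => by rw [t.e_f, one_smul])
    have hf := laurentExt_lie t.h_f
    have he := laurentExt_lie t.h_e
    have hh := laurentExt_lie (c := (0 : K)) (x := t.h) (y := t.h) (z := t.h) (fun m n => by rw [t.h_h, zero_smul])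
    have ee := laurentExt_lie (c := (0 : K)) (x := t.e) (y := t.e) (z := t.e) (fun m n => by rw [t.e_e, zero_smul])
    have ff := laurentExt_lie (c := (0 : K)) (x := t.f) (y := t.f) (z := t.f) (fun m n => by rw [t.f_f, zero_smul])
    have fe : ∀ a b : LaurentPolynomial K, ⁅laurentExt t.f a, laurentExt t.e b⁆ = -laurentExt t.h (b * a) := by
      intro a b; rw [← lie_skew, ef, one_smul]
    have fh : ∀ a b : LaurentPolynomial K, ⁅laurentExt t.f a, laurentExt t.h b⁆ = (2 : K) • laurentExt t.f (b * a) := by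
      intro a b; rw [← lie_skew, hf, neg_smul, neg_neg]
    have eh : ∀ a b : LaurentPolynomial K, ⁅laurentExt t.e a, laurentExt t.h b⁆ =
        -((2 : K) • laurentExt t.e (b * a)) := by
      intro a b; rw [← lie_skew, he]
    change laurentExt t.e (entry 0 1 ⁅z, w⁆) + laurentExt t.h (entry 0 0 ⁅z, w⁆) +
      laurentExt t.f (entry 1 0 ⁅z, w⁆) =
      ⁅laurentExt t.e (entry 0 1 z) + laurentExt t.h (entry 0 0 z) + laurentExt t.f (entry 1 0 z),
        laurentExt t.e (entry 0 1 w) + laurentExt t.h (entry 0 0 w) +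
          laurentExt t.f (entry 1 0 w)⁆
    rw [entry_lie_zero_one, entry_lie_zero_zero, entry_lie_one_zero]
    simp only [add_lie, lie_add, ef, hf, he, hh, ee, ff, fe, fh, eh, map_smul, map_sub, smul_sub,
      mul_comm (entry _ _ w)]
    module

theorem LoopTriple.rep_apply {M : Type w} [AddCommGroup M] [Module K M] (t : LoopTriple K M)
    (z : LoopAlg K) : t.rep z = laurentExt t.e (entry 0 1 z) + laurentExt t.h (entry 0 0 z) +
      laurentExt t.f (entry 1 0 z) := rfl

@[simp] theorem LoopTriple.rep_e {M : Type w} [AddCommGroup M] [Module K M] (t : LoopTriple K M)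
    (a : LaurentPolynomial K) : t.rep (loop (se K) a) = laurentExt t.e a := by
  simp [LoopTriple.rep_apply, se]

@[simp] theorem LoopTriple.rep_h {M : Type w} [AddCommGroup M] [Module K M] (t : LoopTriple K M)
    (a : LaurentPolynomial K) : t.rep (loop (sh K) a) = laurentExt t.h a := by
  simp [LoopTriple.rep_apply, sh]

@[simp] theorem LoopTriple.rep_f {M : Type w} [AddCommGroup M] [Module K M] (t : LoopTriple K M)
    (a : LaurentPolynomial K) : t.rep (loop (sf K) a) = laurentExt t.f a := by
  simp [LoopTriple.rep_apply, sf]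

end Generators

/-! ### Modules over the enveloping algebra -/

section Enveloping

variable (K : Type u) [Field K] (L : Type v) [LieRing L] [LieAlgebra K L]

/-- The action of a Lie algebra on a module over its enveloping algebra. -/
def act (M : Type w) [AddCommGroup M] [Module K M] [Module (UniversalEnvelopingAlgebra K L) M]
    [IsScalarTower K (UniversalEnvelopingAlgebra K L) M] : L →ₗ⁅K⁆ Module.End K M :=
  ((Algebra.lsmul K K M : UniversalEnvelopingAlgebra K L →ₐ[K] Module.End K M) :
    UniversalEnvelopingAlgebra K L →ₗ⁅K⁆ Module.End K M).comp (UniversalEnvelopingAlgebra.ι K)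

variable {K L}

theorem act_apply {M : Type w} [AddCommGroup M] [Module K M]
    [Module (UniversalEnvelopingAlgebra K L) M]
    [IsScalarTower K (UniversalEnvelopingAlgebra K L) M] (x : L) (m : M) :
    act K L M x m = UniversalEnvelopingAlgebra.ι K x • m := rfl

/-- The inclusion of `L` into the subalgebra `S` that it generates lifts to `U(L) → S`. Followed by
`S ⊆ U(L)` this is the identity, by uniqueness in the universal property, so `S` is everything. -/
theorem adjoin_range_ι :
    Algebra.adjoin K (Set.range (UniversalEnvelopingAlgebra.ι K : L → _)) = ⊤ := by
  set S := Algebra.adjoin K (Set.range (UniversalEnvelopingAlgebra.ι K : L → _)) with hS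
  let g : L →ₗ⁅K⁆ S :=
    { toFun := fun x => ⟨UniversalEnvelopingAlgebra.ι K x, Algebra.subset_adjoin ⟨x, rfl⟩⟩
      map_add' := fun x y => Subtype.ext (map_add _ x y)
      map_smul' := fun c x => Subtype.ext (map_smul _ c x)
      map_lie' := fun {x y} => Subtype.ext (LieHom.map_lie _ x y) }
  have h : S.val.comp (UniversalEnvelopingAlgebra.lift K g) = AlgHom.id K _ := by
    apply UniversalEnvelopingAlgebra.hom_ext
    ext x
    change S.val (UniversalEnvelopingAlgebra.lift K g (UniversalEnvelopingAlgebra.ι K x)) = _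
    rw [UniversalEnvelopingAlgebra.lift_ι_apply]
    rfl
  rw [eq_top_iff]
  intro a _
  have := DFunLike.congr_fun h a
  change S.val _ = a at this
  rw [← this]
  exact Subtype.property _

theorem envelope_induction {P : UniversalEnvelopingAlgebra K L → Prop}
    (u : UniversalEnvelopingAlgebra K L)
    (algebraMap : ∀ c : K, P (algebraMap K _ c))
    (add : ∀ a b, P a → P b → P (a + b)) (mul : ∀ a b, P a → P b → P (a * b))
    (ι : ∀ x, P (UniversalEnvelopingAlgebra.ι K x)) : P u := by
  have hu : u ∈ Algebra.adjoin K (Set.range (UniversalEnvelopingAlgebra.ι K : L → _)) := by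
    rw [adjoin_range_ι]; trivial
  induction hu using Algebra.adjoin_induction with
  | mem x hx => obtain ⟨y, rfl⟩ := hx; exact ι y
  | algebraMap c => exact algebraMap c
  | add a b _ _ ha hb => exact add a b ha hb
  | mul a b _ _ ha hb => exact mul a b ha hb

variable {M : Type w} [AddCommGroup M] [Module K M] [Module (UniversalEnvelopingAlgebra K L) M]
  [IsScalarTower K (UniversalEnvelopingAlgebra K L) M]

/-- A subspace that is stable under the Lie algebra is a submodule. -/
def toEnvSubmodule (S : Submodule K M) (hS : ∀ x, ∀ m ∈ S, act K L M x m ∈ S) :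
    Submodule (UniversalEnvelopingAlgebra K L) M :=
  { S with
    smul_mem' := fun u => by
      change ∀ m ∈ S, u • m ∈ S
      induction u using envelope_induction with
      | algebraMap c => intro m hm; rw [algebraMap_smul]; exact S.smul_mem c hm
      | add a b ha hb => intro m hm; rw [add_smul]; exact S.add_mem (ha m hm) (hb m hm)
      | mul a b ha hb => intro m hm; rw [mul_smul]; exact ha _ (hb m hm)
      | ι x => exact hS x }

theorem act_mem {W : Submodule (UniversalEnvelopingAlgebra K L) M} (x : L) {m : M} (hm : m ∈ W) :
    act K L M x m ∈ W := W.smul_mem _ hm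

/-- The `K`-linear map on the quotient by an `R`-submodule. -/
def liftQK {R : Type v} [Ring R] [Algebra K R] {M : Type w} [AddCommGroup M] [Module K M]
    [Module R M] [IsScalarTower K R M] (P : Submodule R M) {V : Type*} [AddCommGroup V]
    [Module K V] (f : M →ₗ[K] V) (hf : ∀ x ∈ P, f x = 0) : (M ⧸ P) →ₗ[K] V :=
  ((P.restrictScalars K).liftQ f fun x hx => hf x hx) ∘ₗ
    (Submodule.Quotient.restrictScalarsEquiv K P).symm.toLinearMap

variable {p : LieSubalgebra K L} {N : Type w} [AddCommGroup N] [Module K N] [LieRingModule p N]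

/-- The element `1 ⊗ n` of the induced module. -/
def indMk : N →ₗ[K] Ind K p N :=
  ((indRelations K p N).mkQ.restrictScalars K) ∘ₗ
    (TensorProduct.mk K (UniversalEnvelopingAlgebra K L) N 1)

theorem smul_indMk (u : UniversalEnvelopingAlgebra K L) (n : N) :
    u • (indMk n : Ind K p N) = Submodule.Quotient.mk (u ⊗ₜ[K] n) := by
  change u • Submodule.Quotient.mk (1 ⊗ₜ[K] n) = _
  rw [← Submodule.Quotient.mk_smul, TensorProduct.smul_tmul', smul_eq_mul, mul_one]

theorem act_indMk (x : p) (n : N) :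
    act K L (Ind K p N) x (indMk n) = indMk ⁅x, n⁆ := by
  rw [act_apply, smul_indMk]
  refine (Submodule.Quotient.eq _).mpr (Submodule.subset_span ⟨1, x, n, ?_⟩)
  rw [one_mul, TensorProduct.mk_apply]

theorem ind_span (S : Submodule (UniversalEnvelopingAlgebra K L) (Ind K p N))
    (h : ∀ n : N, indMk n ∈ S) : S = ⊤ := by
  rw [eq_top_iff]
  rintro z -
  obtain ⟨z, rfl⟩ := Submodule.Quotient.mk_surjective _ z
  induction z using TensorProduct.induction_on with
  | zero => exact S.zero_mem
  | add z w hz hw => exact S.add_mem hz hw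
  | tmul u n => rw [← smul_indMk]; exact S.smul_mem u (h n)

/-! ### The universal property of the induced module -/

section Lift

variable {Y : Type*} [AddCommGroup Y] [Module K Y] (ρ : L →ₗ⁅K⁆ Module.End K Y)
  (g : N →ₗ[K] Y)

/-- The map `u ⊗ n ↦ u (g n)`. -/
def preIndLift : UniversalEnvelopingAlgebra K L ⊗[K] N →ₗ[K] Y :=
  TensorProduct.lift (LinearMap.compl₂ (UniversalEnvelopingAlgebra.lift K ρ).toLinearMap g)

theorem preIndLift_tmul (u : UniversalEnvelopingAlgebra K L) (n : N) :
    preIndLift ρ g (u ⊗ₜ[K] n) = UniversalEnvelopingAlgebra.lift K ρ u (g n) := rfl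

theorem preIndLift_smul (u : UniversalEnvelopingAlgebra K L)
    (z : UniversalEnvelopingAlgebra K L ⊗[K] N) :
    preIndLift ρ g (u • z) = UniversalEnvelopingAlgebra.lift K ρ u (preIndLift ρ g z) := by
  induction z using TensorProduct.induction_on with
  | zero => simp
  | add z w hz hw => rw [smul_add, map_add, hz, hw, map_add, map_add]
  | tmul a n =>
    rw [TensorProduct.smul_tmul', preIndLift_tmul, preIndLift_tmul, smul_eq_mul, map_mul]
    rfl

theorem preIndLift_eq_zero (hg : ∀ (x : p) (n : N), g ⁅x, n⁆ = ρ x (g n))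
    (z : UniversalEnvelopingAlgebra K L ⊗[K] N)
    (hz : z ∈ indRelations K p N) : preIndLift ρ g z = 0 := by
  refine Submodule.span_induction (p := fun z _ => preIndLift ρ g z = 0) ?_ ?_ ?_ ?_ hz
  · rintro _ ⟨a, x, n, rfl⟩
    rw [map_sub, preIndLift_tmul, preIndLift_tmul, map_mul, hg,
      UniversalEnvelopingAlgebra.lift_ι_apply, Module.End.mul_apply, sub_self]
  · exact map_zero _
  · intro x y _ _ hx hy; rw [map_add, hx, hy, add_zero]
  · intro a x _ hx; rw [preIndLift_smul, hx, map_zero]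

variable (hg : ∀ (x : p) (n : N), g ⁅x, n⁆ = ρ x (g n))

/-- The universal property of the induced module. -/
def indLift : Ind K p N →ₗ[K] Y :=
  liftQK (indRelations K p N) (preIndLift ρ g) (preIndLift_eq_zero ρ g hg)

theorem indLift_indMk (n : N) : indLift ρ g hg (indMk n) = g n := by
  change preIndLift ρ g (1 ⊗ₜ[K] n) = _
  rw [preIndLift_tmul, map_one, Module.End.one_apply]

theorem indLift_smul (u : UniversalEnvelopingAlgebra K L) (z : Ind K p N) :
    indLift ρ g hg (u • z) = UniversalEnvelopingAlgebra.lift K ρ u (indLift ρ g hg z) := by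
  obtain ⟨z, rfl⟩ := Submodule.Quotient.mk_surjective _ z
  exact preIndLift_smul ρ g u z

theorem indLift_act (x : L) (z : Ind K p N) :
    indLift ρ g hg (act K L _ x z) = ρ x (indLift ρ g hg z) := by
  rw [act_apply, indLift_smul, UniversalEnvelopingAlgebra.lift_ι_apply]

end Lift

end Enveloping

/-! ### A polynomial model of the universal highest weight module -/

section PolynomialModel

open MvPolynomial

variable {K : Type u} [Field K]

/-- Justifies sums over all `n : ℤ` below: only the variables occurring in `p` contribute, and a
`finsum` of infinite support would silently be zero. -/
theorem pderiv_support_finite (p : MvPolynomial ℤ K) :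
    (Function.support fun n => pderiv n p).Finite := by
  refine p.vars.finite_toSet.subset fun n hn => ?_
  by_contra h
  exact hn (pderiv_eq_zero_of_notMem_vars h)

variable (K) in
/-- The derivation `X n ↦ X (n + m)`. -/
def shiftDer (m : ℤ) : Derivation K (MvPolynomial ℤ K) (MvPolynomial ℤ K) :=
  mkDerivation K fun n => X (n + m)

@[simp] theorem shiftDer_X (m n : ℤ) : shiftDer K m (X n) = X (n + m) := mkDerivation_X _ _ _

/-- The derivation `X n ↦ φ (m + n)`. -/
def constDer (φ : ℤ → K) (m : ℤ) : Derivation K (MvPolynomial ℤ K) (MvPolynomial ℤ K) :=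
  mkDerivation K fun n => C (φ (m + n))

@[simp] theorem constDer_X (φ : ℤ → K) (m n : ℤ) : constDer φ m (X n) = C (φ (m + n)) :=
  mkDerivation_X _ _ _

/-- A derivation is determined by its values on the variables; this coordinate form is what meets
the second order operator. -/
theorem finsum_X_mul_pderiv (m : ℤ) (p : MvPolynomial ℤ K) :
    ∑ᶠ n, X (n + m) * pderiv n p = shiftDer K m p := by
  have fin : ∀ q : MvPolynomial ℤ K,
      (Function.support fun n => X (n + m) * pderiv n q).Finite := fun q =>
    (pderiv_support_finite q).subset fun n hn h => hn (by
      change pderiv n q = 0 at h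
      change X (n + m) * pderiv n q = 0
      rw [h, mul_zero])
  induction p using MvPolynomial.induction_on with
  | C a => simp
  | add p q hp hq =>
    rw [map_add, ← hp, ← hq, ← finsum_add_distrib (fin p) (fin q)]
    simp only [map_add, mul_add]
  | mul_X p k hp =>
    rw [Derivation.leibniz, ← hp, shiftDer_X, smul_eq_mul, smul_eq_mul,
      mul_finsum]
    have h1 : p * X (k + m) = ∑ᶠ n : ℤ, X (n + m) * (p * pderiv n (X k)) := by
      rw [finsum_eq_single _ k, pderiv_X_self]
      · ring
      · intro n hn; rw [pderiv_X_of_ne hn.symm]; ring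
    rw [h1, ← finsum_add_distrib]
    · refine finsum_congr fun n => ?_
      rw [Derivation.leibniz, smul_eq_mul, smul_eq_mul]; ring
    · refine (Set.finite_singleton k).subset fun n hn => ?_
      by_contra h
      exact hn (by
        change X (n + m) * (p * pderiv n (X k)) = 0
        rw [pderiv_X_of_ne (Ne.symm h)]; ring)
    · refine (fin p).subset fun n hn h => hn ?_
      change X (n + m) * pderiv n p = 0 at h
      change X k * (X (n + m) * pderiv n p) = 0
      rw [h, mul_zero]

theorem shiftDer_pderiv_support (m : ℤ) (p : MvPolynomial ℤ K) :
    (Function.support fun n => shiftDer K (m + n) (pderiv n p)).Finite :=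
  (pderiv_support_finite p).subset fun n hn h => hn (by
    change pderiv n p = 0 at h
    change shiftDer K (m + n) (pderiv n p) = 0
    rw [h, map_zero])

variable (K) in
/-- The second order operator `∑ X (m + n + p) ∂ n ∂ p`. -/
def secondOrder (m : ℤ) : Module.End K (MvPolynomial ℤ K) where
  -- The inner sum of `X (m + n + p) ∂ p` over `p` is the derivation `shiftDer K (m + n)`, so only
  -- the sum over `n` remains.
  toFun p := ∑ᶠ n, shiftDer K (m + n) (pderiv n p)
  map_add' p q := by
    rw [← finsum_add_distrib (shiftDer_pderiv_support m p) (shiftDer_pderiv_support m q)]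
    simp only [map_add]
  map_smul' c p := by
    rw [RingHom.id_apply, smul_finsum' _ (shiftDer_pderiv_support m p)]
    simp only [Derivation.map_smul]

theorem secondOrder_one (m : ℤ) : secondOrder K m 1 = 0 := by
  change ∑ᶠ n, shiftDer K (m + n) (pderiv n 1) = 0
  simp

/-- Either of the two derivatives may hit `X k`, and by symmetry each choice leaves the same first
order operator: hence the factor `2`. This commutator is what produces the term `-2 shiftDer` of
`polyH` in the relation `[e, f] = h`. -/
theorem secondOrder_X_mul (m k : ℤ) (p : MvPolynomial ℤ K) :
    secondOrder K m (X k * p) = X k * secondOrder K m p + (2 : K) • shiftDer K (m + k) p := by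
  change ∑ᶠ n, shiftDer K (m + n) (pderiv n (X k * p)) =
    X k * ∑ᶠ n, shiftDer K (m + n) (pderiv n p) + _
  have h1 : shiftDer K (m + k) p = ∑ᶠ n : ℤ, shiftDer K (m + n) (p * pderiv n (X k)) := by
    rw [finsum_eq_single _ k, pderiv_X_self, mul_one]
    intro n hn; rw [pderiv_X_of_ne hn.symm, mul_zero, map_zero]
  have f1 : (Function.support fun n : ℤ => shiftDer K (m + n) (p * pderiv n (X k))).Finite := by
    refine (Set.finite_singleton k).subset fun n hn => ?_
    by_contra h
    exact hn (by
      change shiftDer K (m + n) (p * pderiv n (X k)) = 0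
      rw [pderiv_X_of_ne (Ne.symm h), mul_zero, map_zero])
  have f2 : (Function.support fun n : ℤ => X (n + (m + k)) * pderiv n p).Finite :=
    (pderiv_support_finite p).subset fun n hn h => hn (by
      change pderiv n p = 0 at h
      change _ * pderiv n p = 0
      rw [h, mul_zero])
  have f3 : (Function.support fun n : ℤ =>
      X k * shiftDer K (m + n) (pderiv n p)).Finite :=
    (pderiv_support_finite p).subset fun n hn h => hn (by
      change pderiv n p = 0 at h
      change X k * shiftDer K (m + n) (pderiv n p) = 0
      rw [h, map_zero, mul_zero])
  rw [mul_finsum, two_smul]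
  -- The first copy is the case where `∂ n` hits `X k`, the second the case where `shiftDer` does;
  -- they are expanded differently so that the sums match term by term.
  nth_rw 1 [h1]
  rw [← finsum_X_mul_pderiv (m + k) p, ← finsum_add_distrib f1 f2, ← finsum_add_distrib f3]
  · refine finsum_congr fun n => ?_
    rw [Derivation.leibniz, map_add, smul_eq_mul, smul_eq_mul, Derivation.leibniz, shiftDer_X,
      smul_eq_mul, smul_eq_mul, show k + (m + n) = n + (m + k) by ring]
    ring
  · refine (f1.union f2).subset fun n hn => ?_
    by_contra h
    rw [Set.mem_union, not_or, Function.notMem_support, Function.notMem_support] at h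
    exact hn (by
      change shiftDer K (m + n) (p * pderiv n (X k)) + X (n + (m + k)) * pderiv n p = 0
      rw [h.1, h.2, add_zero])

/-- The action of `h ⊗ T ^ m` on polynomials. -/
def polyH (φ : ℤ → K) (m : ℤ) : Module.End K (MvPolynomial ℤ K) :=
  φ m • LinearMap.id - (2 : K) • (shiftDer K m).toLinearMap

/-- The action of `e ⊗ T ^ m` on polynomials. -/
def polyE (φ : ℤ → K) (m : ℤ) : Module.End K (MvPolynomial ℤ K) :=
  (constDer φ m).toLinearMap - secondOrder K m

variable (K) in
/-- The action of `f ⊗ T ^ m` on polynomials. -/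
def polyF (m : ℤ) : Module.End K (MvPolynomial ℤ K) := LinearMap.mulLeft K (X m)

theorem polyH_apply (φ : ℤ → K) (m : ℤ) (p : MvPolynomial ℤ K) :
    polyH φ m p = φ m • p - (2 : K) • shiftDer K m p := rfl

theorem polyE_apply (φ : ℤ → K) (m : ℤ) (p : MvPolynomial ℤ K) :
    polyE φ m p = constDer φ m p - secondOrder K m p := rfl

theorem polyH_one (φ : ℤ → K) (m : ℤ) : polyH φ m 1 = φ m • 1 := by
  rw [polyH_apply]; simp

theorem polyE_one (φ : ℤ → K) (m : ℤ) : polyE φ m 1 = 0 := by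
  rw [polyE_apply, secondOrder_one]; simp

theorem polyH_polyF (φ : ℤ → K) (m n : ℤ) :
    ⁅polyH φ m, polyF K n⁆ = (-2 : K) • polyF K (m + n) := by
  refine LinearMap.ext fun p => ?_
  change polyH φ m (X n * p) - X n * polyH φ m p = (-2 : K) • (X (m + n) * p)
  rw [polyH_apply, polyH_apply, Derivation.leibniz, shiftDer_X, smul_eq_mul, smul_eq_mul,
    add_comm n m]
  simp only [smul_eq_C_mul, map_neg]
  ring

theorem polyE_polyF (φ : ℤ → K) (m n : ℤ) : ⁅polyE φ m, polyF K n⁆ = polyH φ (m + n) := by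
  refine LinearMap.ext fun p => ?_
  change polyE φ m (X n * p) - X n * polyE φ m p = polyH φ (m + n) p
  rw [polyH_apply, polyE_apply, polyE_apply, Derivation.leibniz, constDer_X, smul_eq_mul,
    smul_eq_mul, secondOrder_X_mul]
  simp only [smul_eq_C_mul]
  ring

/-- Every polynomial is built from constants by multiplying by variables and adding. The relations
not involving `f` thereby reduce, through the Jacobi identity, to those with `f`, and no product of
two second order operators is ever expanded. -/
theorem lie_polyF_eq_zero (T : Module.End K (MvPolynomial ℤ K)) (h1 : T 1 = 0)
    (h : ∀ n, ⁅T, polyF K n⁆ = 0) : T = 0 := by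
  refine LinearMap.ext fun p => ?_
  rw [LinearMap.zero_apply]
  induction p using MvPolynomial.induction_on with
  | C a =>
    rw [show (C a : MvPolynomial ℤ K) = a • 1 by rw [smul_eq_C_mul, mul_one], map_smul, h1,
      smul_zero]
  | add p q hp hq => rw [map_add, hp, hq, add_zero]
  | mul_X p k hp =>
    have := LinearMap.congr_fun (h k) p
    change T (X k * p) - X k * T p = 0 at this
    rwa [hp, mul_zero, sub_zero, mul_comm] at this

theorem lie_lie_swap {A : Type v} [Ring A] (x y z : A) :
    ⁅⁅x, y⁆, z⁆ = ⁅x, ⁅y, z⁆⁆ - ⁅y, ⁅x, z⁆⁆ := by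
  simp only [Ring.lie_def]; noncomm_ring

theorem lie_smul_assoc {M : Type v} [AddCommGroup M] [Module K M] (c : K)
    (x y : Module.End K M) :
    ⁅x, c • y⁆ = c • ⁅x, y⁆ := by
  simp only [Ring.lie_def, mul_smul_comm, smul_mul_assoc, smul_sub]

theorem smul_lie_assoc {M : Type v} [AddCommGroup M] [Module K M] (c : K)
    (x y : Module.End K M) :
    ⁅c • x, y⁆ = c • ⁅x, y⁆ := by
  simp only [Ring.lie_def, mul_smul_comm, smul_mul_assoc, smul_sub]

theorem polyH_polyH (φ : ℤ → K) (m n : ℤ) : ⁅polyH φ m, polyH φ n⁆ = 0 := by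
  refine lie_polyF_eq_zero _ ?_ fun k => ?_
  · change polyH φ m (polyH φ n 1) - polyH φ n (polyH φ m 1) = 0
    simp only [polyH_one, map_smul, smul_comm (φ m) (φ n), sub_self]
  · rw [lie_lie_swap, polyH_polyF, polyH_polyF, lie_smul_assoc, lie_smul_assoc, polyH_polyF,
      polyH_polyF, add_left_comm, sub_self]

theorem polyH_polyE (φ : ℤ → K) (m n : ℤ) :
    ⁅polyH φ m, polyE φ n⁆ = (2 : K) • polyE φ (m + n) := by
  refine sub_eq_zero.mp (lie_polyF_eq_zero _ ?_ fun k => ?_)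
  · change polyH φ m (polyE φ n 1) - polyE φ n (polyH φ m 1) - (2 : K) • polyE φ (m + n) 1 = 0
    simp only [polyH_one, polyE_one, map_smul, map_zero, smul_zero, sub_self]
  · rw [sub_lie, lie_lie_swap, polyE_polyF, polyH_polyF, lie_smul_assoc, polyH_polyH,
      polyE_polyF, smul_lie_assoc, polyE_polyF, show n + (m + k) = m + n + k by ring]
    module

theorem polyE_polyE (φ : ℤ → K) (m n : ℤ) : ⁅polyE φ m, polyE φ n⁆ = 0 := by
  refine lie_polyF_eq_zero _ ?_ fun k => ?_
  · change polyE φ m (polyE φ n 1) - polyE φ n (polyE φ m 1) = 0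
    simp only [polyE_one, map_zero, sub_self]
  · rw [lie_lie_swap, polyE_polyF, polyE_polyF, ← lie_skew, polyH_polyE, ← lie_skew (polyE φ n),
      polyH_polyE, show n + k + m = m + k + n by ring]
    abel

/-- The polynomial model as a triple of families of operators. -/
def polyTriple (φ : ℤ → K) : LoopTriple K (MvPolynomial ℤ K) where
  e := polyE φ
  h := polyH φ
  f := polyF K
  e_f := polyE_polyF φ
  h_f := polyH_polyF φ
  h_e := polyH_polyE φ
  h_h := polyH_polyH φ
  e_e := polyE_polyE φ
  f_f m n := LinearMap.ext fun p => by
    change X m * (X n * p) - X n * (X m * p) = 0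
    ring

theorem laurentExt_apply_eq {V W : Type*} [AddCommGroup V] [Module K V] [AddCommGroup W]
    [Module K W] (g : ℤ → V →ₗ[K] W) (v : V) (k : LaurentPolynomial K →ₗ[K] W)
    (h : ∀ m, g m v = k (tt m)) (a : LaurentPolynomial K) : laurentExt g a v = k a := by
  induction a using laurent_induction with
  | zero => simp
  | add a b ha hb => simp only [map_add, LinearMap.add_apply, ha, hb]
  | smul c m => simp only [map_smul, LinearMap.smul_apply, laurentExt_tt, h]

theorem pairing_tt (φ : ℤ → K) (m : ℤ) : pairing φ (tt m) = φ m := by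
  rw [pairing_single, one_mul]

end PolynomialModel

/-! ### The highest weight functional on the induced module -/

section Functional

variable {K : Type u} [Field K] (φ : ℤ → K)

/-- The highest weight vector of the induced module. -/
def indVec : LoopInd φ := indMk (oneDimVec φ)

section Lift

variable {φ} {Y : Type*} [AddCommGroup Y] [Module K Y] (t : LoopTriple K Y) (y : Y)

/-- An element of `ĥ + ĝ₊` has no `f`-component and its `e`-component kills `y`, so only the
`h`-component acts, through `pairing φ`. -/
theorem hwLift_compat (he : ∀ m, t.e m y = 0) (hh : ∀ m, t.h m y = φ m • y) (x : loopBorel K)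
    (n : OneDim φ) :
    (show OneDim φ →ₗ[K] Y from LinearMap.toSpanSingleton K Y y) ⁅x, n⁆ =
      t.rep x ((show OneDim φ →ₗ[K] Y from LinearMap.toSpanSingleton K Y y) n) := by
  rw [oneDim_lie, map_smul, LoopTriple.rep_apply, entry_loopBorel, map_zero, add_zero,
    LinearMap.add_apply]
  obtain ⟨c, hc⟩ : ∃ c : K,
    (show OneDim φ →ₗ[K] Y from LinearMap.toSpanSingleton K Y y) n = c • y := ⟨n, rfl⟩
  rw [hc, laurentExt_apply_eq _ _ 0, laurentExt_apply_eq _ _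
    (LinearMap.smulRight (pairing φ) (c • y))]
  · simp
  · intro m
    rw [map_smul, hh, LinearMap.smulRight_apply, pairing_tt, smul_comm]
  · intro m
    rw [map_smul, he, smul_zero, LinearMap.zero_apply]

/-- The homomorphism from the induced module given by a highest weight vector. -/
def hwLift (he : ∀ m, t.e m y = 0) (hh : ∀ m, t.h m y = φ m • y) : LoopInd φ →ₗ[K] Y :=
  indLift t.rep (show OneDim φ →ₗ[K] Y from LinearMap.toSpanSingleton K Y y)
    (hwLift_compat t y he hh)

theorem hwLift_vec (he : ∀ m, t.e m y = 0) (hh : ∀ m, t.h m y = φ m • y) :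
    hwLift t y he hh (indVec φ) = y := by
  rw [hwLift, indVec, indLift_indMk]
  exact one_smul K y

theorem hwLift_act (he : ∀ m, t.e m y = 0) (hh : ∀ m, t.h m y = φ m • y) (z : LoopAlg K)
    (x : LoopInd φ) : hwLift t y he hh (act K _ _ z x) = t.rep z (hwLift t y he hh x) :=
  indLift_act _ _ (hwLift_compat t y he hh) z x

end Lift

theorem polyTriple_e_one (m : ℤ) : (polyTriple φ).e m 1 = 0 := polyE_one φ m

theorem polyTriple_h_one (m : ℤ) : (polyTriple φ).h m 1 = φ m • 1 := polyH_one φ m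

/-- The homomorphism from the induced module to the polynomial model. -/
def toPoly : LoopInd φ →ₗ[K] MvPolynomial ℤ K :=
  hwLift (polyTriple φ) 1 (polyTriple_e_one φ) (polyTriple_h_one φ)

theorem toPoly_act (z : LoopAlg K) (x : LoopInd φ) :
    toPoly φ (act K _ _ z x) = (polyTriple φ).rep z (toPoly φ x) :=
  hwLift_act ..

/-- The functional on the induced module that is `1` on the highest weight vector and `0` on the
other weight spaces. -/
def hwf : Module.Dual K (LoopInd φ) := MvPolynomial.lcoeff K 0 ∘ₗ toPoly φ

theorem hwf_apply (x : LoopInd φ) : hwf φ x = MvPolynomial.coeff 0 (toPoly φ x) := rfl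

/-- In particular the generator of the induced module is non-zero: this is the part of PBW that the
argument needs. -/
theorem hwf_vec : hwf φ (indVec φ) = 1 := by
  rw [hwf_apply, toPoly, hwLift_vec, MvPolynomial.coeff_zero_one]

/-- In the model `f ⊗ T ^ m` multiplies by a variable, which leaves no constant term. -/
theorem hwf_f (a : LaurentPolynomial K) (x : LoopInd φ) :
    hwf φ (act K _ _ (loop (sf K) a) x) = 0 := by
  rw [hwf_apply, toPoly_act, LoopTriple.rep_f]
  generalize toPoly φ x = p
  induction a using laurent_induction with
  | zero => simp
  | add a b ha hb => simp only [map_add, LinearMap.add_apply, MvPolynomial.coeff_add, ha, hb,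
      add_zero]
  | smul c m =>
    rw [map_smul, laurentExt_tt]
    change MvPolynomial.coeff 0 (c • (MvPolynomial.X m * p)) = 0
    rw [MvPolynomial.coeff_smul, ← MvPolynomial.constantCoeff_eq]
    simp

theorem constantCoeff_shiftDer (m : ℤ) (p : MvPolynomial ℤ K) :
    MvPolynomial.constantCoeff (shiftDer K m p) = 0 := by
  induction p using MvPolynomial.induction_on with
  | C a => simp
  | add p q hp hq => rw [map_add, map_add, hp, hq, add_zero]
  | mul_X p k hp =>
    rw [Derivation.leibniz, map_add, smul_eq_mul, smul_eq_mul, map_mul, map_mul, hp, shiftDer_X]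
    simp

/-- The first order part of `polyH` has values in the ideal generated by the variables, so on
constant terms only the scalar `φ m` survives. -/
theorem hwf_h (a : LaurentPolynomial K) (x : LoopInd φ) :
    hwf φ (act K _ _ (loop (sh K) a) x) = pairing φ a * hwf φ x := by
  rw [hwf_apply, hwf_apply, toPoly_act, LoopTriple.rep_h]
  generalize toPoly φ x = p
  induction a using laurent_induction with
  | zero => simp
  | add a b ha hb => simp only [map_add, LinearMap.add_apply, MvPolynomial.coeff_add, ha, hb,
      add_mul]
  | smul c m =>
    rw [map_smul, laurentExt_tt, map_smul, pairing_tt]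
    change MvPolynomial.coeff 0 (c • (φ m • p - (2 : K) • shiftDer K m p)) = _
    rw [MvPolynomial.coeff_smul, MvPolynomial.coeff_sub, MvPolynomial.coeff_smul,
      MvPolynomial.coeff_smul, ← MvPolynomial.constantCoeff_eq, constantCoeff_shiftDer]
    simp [mul_assoc]

theorem act_h_vec (a : LaurentPolynomial K) :
    act K _ (LoopInd φ) (loop (sh K) a) (indVec φ) = pairing φ a • indVec φ := by
  have := act_indMk (K := K) (p := loopBorel K) (N := OneDim φ)
    ⟨loop (sh K) a, entry_sh_one_zero a⟩ (oneDimVec φ)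
  rw [oneDim_lie, map_smul, entry_sh_zero_zero] at this
  exact this

theorem act_e_vec (a : LaurentPolynomial K) :
    act K _ (LoopInd φ) (loop (se K) a) (indVec φ) = 0 := by
  have h0 : entry 1 0 (loop (se K) a) = 0 := by rw [entry_se]; rfl
  have := act_indMk (K := K) (p := loopBorel K) (N := OneDim φ) ⟨loop (se K) a, h0⟩ (oneDimVec φ)
  rw [oneDim_lie, map_smul, entry_se, if_neg (by decide), map_zero, zero_smul] at this
  exact this

end Functional

/-! ### Spanning sets of representations of the loop algebra -/

section Words

variable {K : Type u} [Field K] {M : Type w} [AddCommGroup M] [Module K M]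
  (ρ : LoopAlg K →ₗ⁅K⁆ Module.End K M)

theorem rep_swap (z w : LoopAlg K) (x : M) :
    ρ z (ρ w x) = ρ w (ρ z x) + ρ ⁅z, w⁆ x := by
  rw [LieHom.map_lie]
  change _ = _ + (ρ z (ρ w x) - ρ w (ρ z x))
  abel

theorem rep_h_f (a b : LaurentPolynomial K) (x : M) :
    ρ (loop (sh K) a) (ρ (loop (sf K) b) x) =
      ρ (loop (sf K) b) (ρ (loop (sh K) a) x) - (2 : K) • ρ (loop (sf K) (a * b)) x := by
  rw [rep_swap, lie_sh_sf, map_smul, neg_smul, LinearMap.neg_apply, LinearMap.smul_apply,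
    sub_eq_add_neg]

theorem rep_e_f (a b : LaurentPolynomial K) (x : M) :
    ρ (loop (se K) a) (ρ (loop (sf K) b) x) =
      ρ (loop (sf K) b) (ρ (loop (se K) a) x) + ρ (loop (sh K) (a * b)) x := by
  rw [rep_swap, lie_se_sf]

theorem rep_f_f (a b : LaurentPolynomial K) (x : M) :
    ρ (loop (sf K) a) (ρ (loop (sf K) b) x) = ρ (loop (sf K) b) (ρ (loop (sf K) a) x) := by
  rw [rep_swap, lie_loop_self, map_zero, LinearMap.zero_apply, add_zero]

theorem rep_mem_of_generators {S : Submodule K M}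
    (he : ∀ m, ∀ x ∈ S, ρ (loop (se K) (tt m)) x ∈ S)
    (hh : ∀ m, ∀ x ∈ S, ρ (loop (sh K) (tt m)) x ∈ S)
    (hf : ∀ m, ∀ x ∈ S, ρ (loop (sf K) (tt m)) x ∈ S) (z : LoopAlg K) (x : M) (hx : x ∈ S) :
    ρ z x ∈ S := by
  have key : ∀ y : G K, (∀ m, ρ (loop y (tt m)) x ∈ S) → ∀ a, ρ (loop y a) x ∈ S := by
    intro y hy a
    rw [← loopL_apply]
    induction a using laurent_induction with
    | zero => rw [map_zero, map_zero]; exact S.zero_mem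
    | add a b ha hb => rw [map_add, map_add]; exact S.add_mem ha hb
    | smul c m => rw [map_smul, map_smul]; exact S.smul_mem c (hy m)
  rw [loop_decomp z, map_add, map_add]
  exact S.add_mem (S.add_mem (key _ (fun m => he m x hx) _) (key _ (fun m => hh m x hx) _))
    (key _ (fun m => hf m x hx) _)

/-- The vector `f ⊗ T ^ m₁ ⋯ f ⊗ T ^ mₖ · x`. -/
def word (l : List ℤ) (x : M) : M := l.foldr (fun m y => ρ (loop (sf K) (tt m)) y) x

@[simp] theorem word_nil (x : M) : word ρ [] x = x := rfl

@[simp] theorem word_cons (m : ℤ) (l : List ℤ) (x : M) :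
    word ρ (m :: l) x = ρ (loop (sf K) (tt m)) (word ρ l x) := rfl

theorem word_h (l : List ℤ) (x : M) (μ : K) (hx : ρ (loop (sh K) 1) x = μ • x) :
    ρ (loop (sh K) 1) (word ρ l x) = (μ - 2 * l.length) • word ρ l x := by
  induction l with
  | nil => simpa using hx
  | cons m l ih =>
    rw [word_cons, rep_h_f, ih, map_smul, one_mul, ← sub_smul, List.length_cons]
    congr 1; push_cast; ring

/-- The span of the vectors obtained from a subspace by applying `f ⊗ T ^ m` repeatedly. -/
def wordSpan (N : Submodule K M) : Submodule K M :=
  Submodule.span K {x | ∃ l, ∃ n ∈ N, x = word ρ l n}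

theorem word_mem_wordSpan {N : Submodule K M} (l : List ℤ) {n : M} (hn : n ∈ N) :
    word ρ l n ∈ wordSpan ρ N := Submodule.subset_span ⟨l, n, hn, rfl⟩

theorem wordSpan_f {N : Submodule K M} (m : ℤ) (x : M) (hx : x ∈ wordSpan ρ N) :
    ρ (loop (sf K) (tt m)) x ∈ wordSpan ρ N := by
  induction hx using Submodule.span_induction with
  | mem x hx =>
    obtain ⟨l, n, hn, rfl⟩ := hx
    exact word_mem_wordSpan ρ (m :: l) hn
  | zero => rw [map_zero]; exact zero_mem _
  | add x y _ _ hx hy => rw [map_add]; exact add_mem hx hy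
  | smul c x _ hx => rw [map_smul]; exact Submodule.smul_mem _ _ hx

theorem wordSpan_h {N : Submodule K M} (hh : ∀ m, ∀ x ∈ N, ρ (loop (sh K) (tt m)) x ∈ N)
    (m : ℤ) (x : M) (hx : x ∈ wordSpan ρ N) :
    ρ (loop (sh K) (tt m)) x ∈ wordSpan ρ N := by
  induction hx using Submodule.span_induction with
  | mem x hx =>
    obtain ⟨l, n, hn, rfl⟩ := hx
    induction l with
    | nil => exact word_mem_wordSpan ρ [] (hh m n hn)
    | cons k l ih =>
      rw [word_cons, rep_h_f, tt_mul]
      exact sub_mem (wordSpan_f ρ k _ ih)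
        (Submodule.smul_mem _ _ (word_mem_wordSpan ρ (_ :: l) hn))
  | zero => rw [map_zero]; exact zero_mem _
  | add x y _ _ hx hy => rw [map_add]; exact add_mem hx hy
  | smul c x _ hx => rw [map_smul]; exact Submodule.smul_mem _ _ hx

theorem wordSpan_e {N : Submodule K M} (hh : ∀ m, ∀ x ∈ N, ρ (loop (sh K) (tt m)) x ∈ N)
    (he : ∀ m, ∀ x ∈ N, ρ (loop (se K) (tt m)) x = 0) (m : ℤ) (x : M) (hx : x ∈ wordSpan ρ N) :
    ρ (loop (se K) (tt m)) x ∈ wordSpan ρ N := by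
  induction hx using Submodule.span_induction with
  | mem x hx =>
    obtain ⟨l, n, hn, rfl⟩ := hx
    induction l with
    | nil => rw [word_nil, he m n hn]; exact zero_mem _
    | cons k l ih =>
      rw [word_cons, rep_e_f, tt_mul]
      exact add_mem (wordSpan_f ρ k _ ih) (wordSpan_h ρ hh _ _ (word_mem_wordSpan ρ l hn))
  | zero => rw [map_zero]; exact zero_mem _
  | add x y _ _ hx hy => rw [map_add]; exact add_mem hx hy
  | smul c x _ hx => rw [map_smul]; exact Submodule.smul_mem _ _ hx

/-- The spanning half of PBW, by straightening: moving `h` to the right past `f` produces another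
`f`, moving `e` past `f` produces an `h`, and on reaching `N` the first preserves it and the second
kills it. -/
theorem wordSpan_rep {N : Submodule K M} (hh : ∀ m, ∀ x ∈ N, ρ (loop (sh K) (tt m)) x ∈ N)
    (he : ∀ m, ∀ x ∈ N, ρ (loop (se K) (tt m)) x = 0) (z : LoopAlg K) (x : M)
    (hx : x ∈ wordSpan ρ N) : ρ z x ∈ wordSpan ρ N :=
  rep_mem_of_generators ρ (wordSpan_e ρ hh he) (wordSpan_h ρ hh) (wordSpan_f ρ) z x hx

/-- The transposed operators on the dual space. -/
def dualTriple : LoopTriple K (Module.Dual K M) where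
  -- Transposition reverses products; exchanging `e` and `f` while fixing `h` and `T` is an
  -- anti-involution and undoes the reversal.
  e m := Module.Dual.transpose (R := K) (ρ (loop (sf K) (tt m)))
  h m := Module.Dual.transpose (R := K) (ρ (loop (sh K) (tt m)))
  f m := Module.Dual.transpose (R := K) (ρ (loop (se K) (tt m)))
  e_f m n := LinearMap.ext fun ξ => LinearMap.ext fun x => by
    change ξ (ρ _ (ρ _ x)) - ξ (ρ _ (ρ _ x)) = ξ (ρ _ x)
    rw [← map_sub, rep_e_f, add_sub_cancel_left, tt_mul, add_comm]
  h_f m n := LinearMap.ext fun ξ => LinearMap.ext fun x => by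
    change ξ (ρ _ (ρ _ x)) - ξ (ρ _ (ρ _ x)) = (-2 : K) • ξ (ρ _ x)
    rw [← map_sub, rep_swap ρ (loop (sh K) _), lie_sh_se, sub_add_cancel_left, tt_mul, map_smul,
      map_neg, LinearMap.smul_apply, map_smul, neg_smul]
  h_e m n := LinearMap.ext fun ξ => LinearMap.ext fun x => by
    change ξ (ρ _ (ρ _ x)) - ξ (ρ _ (ρ _ x)) = (2 : K) • ξ (ρ _ x)
    rw [← map_sub, rep_h_f, tt_mul, sub_sub_cancel, map_smul]
  h_h m n := LinearMap.ext fun ξ => LinearMap.ext fun x => by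
    change ξ (ρ _ (ρ _ x)) - ξ (ρ _ (ρ _ x)) = 0
    rw [rep_swap, lie_loop_self, map_zero, LinearMap.zero_apply, add_zero, sub_self]
  e_e m n := LinearMap.ext fun ξ => LinearMap.ext fun x => by
    change ξ (ρ _ (ρ _ x)) - ξ (ρ _ (ρ _ x)) = 0
    rw [rep_swap, lie_loop_self, map_zero, LinearMap.zero_apply, add_zero, sub_self]
  f_f m n := LinearMap.ext fun ξ => LinearMap.ext fun x => by
    change ξ (ρ _ (ρ _ x)) - ξ (ρ _ (ρ _ x)) = 0
    rw [rep_swap, lie_loop_self, map_zero, LinearMap.zero_apply, add_zero, sub_self]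

end Words

/-! ### Eigenvectors -/

section Eigen

variable {K : Type u} [Field K] {M : Type w} [AddCommGroup M] [Module K M]

theorem aeval_mem {T : Module.End K M} {W : Submodule K M} (hT : ∀ x ∈ W, T x ∈ W)
    (q : Polynomial K) (x : M) (hx : x ∈ W) : Polynomial.aeval T q x ∈ W := by
  induction q using Polynomial.induction_on' generalizing x with
  | add p q hp hq => rw [map_add]; exact W.add_mem (hp x hx) (hq x hx)
  | monomial n a =>
    rw [Polynomial.aeval_monomial]
    refine W.smul_mem a ?_
    induction n generalizing x with
    | zero => exact hx
    | succ n ih => rw [pow_succ]; exact ih _ (hT x hx)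

/-- For a functional `ξ` that is an eigenvector of the transpose of `T`. It keeps track of `ξ` while
`exists_aeval_mem` pushes a vector into an eigenspace. -/
theorem apply_aeval {V : Type*} [AddCommGroup V] [Module K V] {T : Module.End K M}
    {ξ : M →ₗ[K] V} {μ : K} (h : ∀ x, ξ (T x) = μ • ξ x) (q : Polynomial K) (x : M) :
    ξ (Polynomial.aeval T q x) = q.eval μ • ξ x := by
  induction q using Polynomial.induction_on' with
  | add p q hp hq => rw [map_add, LinearMap.add_apply, map_add, hp, hq, Polynomial.eval_add,
      add_smul]
  | monomial n a =>
    rw [Polynomial.aeval_monomial, Polynomial.eval_monomial, mul_smul]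
    change ξ (a • (T ^ n) x) = _
    rw [map_smul]
    congr 1
    induction n generalizing x with
    | zero => simp
    | succ n ih => rw [pow_succ, pow_succ, Module.End.mul_apply, ih, h, smul_smul]

/-- If a space is spanned by a `μ`-eigenspace `N` of `T` and eigenvectors of `T` with other
eigenvalues, then some polynomial in `T` that is non-zero at `μ` maps a given vector to `N`. -/
theorem exists_aeval_mem {T : Module.End K M} {N : Submodule K M} {μ : K}
    (hN : ∀ x ∈ N, T x = μ • x) {s : Set M}
    (hs : ∀ x ∈ s, x ∈ N ∨ ∃ ν, ν ≠ μ ∧ T x = ν • x) (hspan : Submodule.span K s = ⊤) (x : M) :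
    ∃ q : Polynomial K, q.eval μ ≠ 0 ∧ Polynomial.aeval T q x ∈ N := by
  have hN' : ∀ x ∈ N, T x ∈ N := fun x hx => by rw [hN x hx]; exact N.smul_mem _ hx
  have hx : x ∈ Submodule.span K s := by rw [hspan]; trivial
  induction hx using Submodule.span_induction with
  | mem x hx =>
    rcases hs x hx with h | ⟨ν, hν, h⟩
    · exact ⟨1, by simp, by simpa using h⟩
    · refine ⟨Polynomial.X - Polynomial.C ν, by simpa [sub_eq_zero] using hν.symm, ?_⟩
      have : Polynomial.aeval T (Polynomial.X - Polynomial.C ν) x = 0 := by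
        rw [map_sub, Polynomial.aeval_X, Polynomial.aeval_C, LinearMap.sub_apply, h,
          Module.algebraMap_end_apply, sub_self]
      rw [this]; exact N.zero_mem
  | zero => exact ⟨1, by simp, by simp⟩
  | add x y _ _ hx hy =>
    obtain ⟨p, hp, hpx⟩ := hx
    obtain ⟨q, hq, hqy⟩ := hy
    refine ⟨p * q, by rw [Polynomial.eval_mul]; exact mul_ne_zero hp hq, ?_⟩
    rw [map_add]
    refine N.add_mem ?_ ?_
    · rw [mul_comm, map_mul]; exact aeval_mem hN' q _ hpx
    · rw [map_mul]; exact aeval_mem hN' p _ hqy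
  | smul c x _ hx =>
    obtain ⟨p, hp, hpx⟩ := hx
    exact ⟨p, hp, by rw [map_smul]; exact N.smul_mem c hpx⟩

/-- If eigenvectors of `T` span, then each eigenspace is spanned by those among them that belong
to it. -/
theorem mem_span_of_eigen {T : Module.End K M} {I : Type*} (b : I → M) (ν : I → K)
    (hb : ∀ i, T (b i) = ν i • b i) (hspan : Submodule.span K (Set.range b) = ⊤) {μ : K} {x : M}
    (hx : T x = μ • x) : x ∈ Submodule.span K {y | ∃ i, ν i = μ ∧ y = b i} := by
  have htop : x ∈ Submodule.span K {y | ∃ i, ν i = μ ∧ y = b i} ⊔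
      Submodule.span K {y | ∃ i, ν i ≠ μ ∧ y = b i} := by
    rw [← Submodule.span_union]
    have : x ∈ Submodule.span K (Set.range b) := by rw [hspan]; trivial
    refine Submodule.span_mono ?_ this
    rintro _ ⟨i, rfl⟩
    by_cases h : ν i = μ
    · exact Or.inl ⟨i, h, rfl⟩
    · exact Or.inr ⟨i, h, rfl⟩
  obtain ⟨y, hy, z, hz, rfl⟩ := Submodule.mem_sup.mp htop
  have hy' : y ∈ T.eigenspace μ := by
    refine Submodule.span_le.mpr ?_ hy
    rintro _ ⟨i, hi, rfl⟩
    exact Module.End.mem_eigenspace_iff.mpr (by rw [hb, hi])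
  have hz1 : z ∈ T.eigenspace μ := by
    have : y + z ∈ T.eigenspace μ := Module.End.mem_eigenspace_iff.mpr hx
    simpa using sub_mem this hy'
  have hz2 : z ∈ ⨆ (c) (_ : c ≠ μ), T.eigenspace c := by
    refine Submodule.span_le.mpr ?_ hz
    rintro _ ⟨i, hi, rfl⟩
    exact Submodule.mem_iSup_of_mem (ν i) (Submodule.mem_iSup_of_mem hi
      (Module.End.mem_eigenspace_iff.mpr (hb i)))
  -- The part of `x` built from the other eigenvalues is itself a `μ`-eigenvector, so independence
  -- of eigenspaces kills it.
  have hz0 : z = 0 := by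
    have := (T.eigenspaces_iSupIndep μ).le_bot ⟨hz1, hz2⟩
    simpa using this
  rw [hz0, add_zero]; exact hy

end Eigen

/-! ### The contravariant form -/

section Form

variable {K : Type u} [Field K]

theorem word_smul {M : Type w} [AddCommGroup M] [Module K M]
    (ρ : LoopAlg K →ₗ⁅K⁆ Module.End K M) (l : List ℤ) (c : K) (x : M) :
    word ρ l (c • x) = c • word ρ l x := by
  induction l with
  | nil => rfl
  | cons m l ih => rw [word_cons, ih, map_smul, word_cons]

theorem wordSpan_singleton {M : Type w} [AddCommGroup M] [Module K M]
    (ρ : LoopAlg K →ₗ⁅K⁆ Module.End K M) (v : M) :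
    wordSpan ρ (K ∙ v) = Submodule.span K (Set.range fun l => word ρ l v) := by
  apply le_antisymm
  · refine Submodule.span_le.mpr ?_
    rintro _ ⟨l, n, hn, rfl⟩
    obtain ⟨c, rfl⟩ := Submodule.mem_span_singleton.mp hn
    rw [word_smul]
    exact Submodule.smul_mem _ _ (Submodule.subset_span ⟨l, rfl⟩)
  · refine Submodule.span_mono ?_
    rintro _ ⟨l, rfl⟩
    exact ⟨l, v, Submodule.mem_span_singleton_self v, rfl⟩

variable (φ : ℤ → K)

/-- The action of the loop algebra on the induced module. -/
abbrev iact : LoopAlg K →ₗ⁅K⁆ Module.End K (LoopInd φ) := act K (LoopAlg K) (LoopInd φ)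

/-- The action of the loop algebra on its irreducible quotient. -/
abbrev lact : LoopAlg K →ₗ⁅K⁆ Module.End K (LoopIrred φ) := act K (LoopAlg K) (LoopIrred φ)

theorem indMk_mem (n : OneDim φ) : (indMk n : LoopInd φ) ∈ K ∙ indVec φ := by
  refine Submodule.mem_span_singleton.mpr ⟨(show K from n), ?_⟩
  rw [indVec, ← map_smul]
  congr 1
  exact mul_one (show K from n)

/-- The line through the highest weight vector satisfies the hypotheses of the straightening
argument, so the span of the words is a submodule containing the generator. -/
theorem span_word_indVec :
    Submodule.span K (Set.range fun l => word (iact φ) l (indVec φ)) = ⊤ := by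
  have hh : ∀ m, ∀ x ∈ K ∙ indVec φ, iact φ (loop (sh K) (tt m)) x ∈ K ∙ indVec φ := by
    intro m x hx
    obtain ⟨c, rfl⟩ := Submodule.mem_span_singleton.mp hx
    rw [map_smul, act_h_vec]
    exact Submodule.smul_mem _ _ (Submodule.smul_mem _ _ (Submodule.mem_span_singleton_self _))
  have he : ∀ m, ∀ x ∈ K ∙ indVec φ, iact φ (loop (se K) (tt m)) x = 0 := by
    intro m x hx
    obtain ⟨c, rfl⟩ := Submodule.mem_span_singleton.mp hx
    rw [map_smul, act_e_vec, smul_zero]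
  rw [← wordSpan_singleton, eq_top_iff]
  rintro x -
  have : toEnvSubmodule _ (wordSpan_rep (iact φ) hh he) = ⊤ :=
    ind_span _ fun n => word_mem_wordSpan (iact φ) [] (indMk_mem φ n)
  have hx : x ∈ toEnvSubmodule _ (wordSpan_rep (iact φ) hh he) := by rw [this]; trivial
  exact hx

theorem dualTriple_rep_f {M : Type w} [AddCommGroup M] [Module K M]
    (ρ : LoopAlg K →ₗ⁅K⁆ Module.End K M) (a : LaurentPolynomial K) (ξ : Module.Dual K M) (x : M) :
    (dualTriple ρ).rep (loop (sf K) a) ξ x = ξ (ρ (loop (se K) a) x) := by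
  rw [LoopTriple.rep_f, ← loopL_apply]
  induction a using laurent_induction with
  | zero => simp only [map_zero, LinearMap.zero_apply]
  | add a b ha hb => simp only [map_add, LinearMap.add_apply, ha, hb]
  | smul c m => rw [map_smul, map_smul, map_smul, laurentExt_tt]; exact (map_smul ξ c _).symm

theorem dualTriple_rep_e {M : Type w} [AddCommGroup M] [Module K M]
    (ρ : LoopAlg K →ₗ⁅K⁆ Module.End K M) (a : LaurentPolynomial K) (ξ : Module.Dual K M) (x : M) :
    (dualTriple ρ).rep (loop (se K) a) ξ x = ξ (ρ (loop (sf K) a) x) := by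
  rw [LoopTriple.rep_e, ← loopL_apply]
  induction a using laurent_induction with
  | zero => simp only [map_zero, LinearMap.zero_apply]
  | add a b ha hb => simp only [map_add, LinearMap.add_apply, ha, hb]
  | smul c m => rw [map_smul, map_smul, map_smul, laurentExt_tt]; exact (map_smul ξ c _).symm

theorem dualTriple_rep_h {M : Type w} [AddCommGroup M] [Module K M]
    (ρ : LoopAlg K →ₗ⁅K⁆ Module.End K M) (a : LaurentPolynomial K) (ξ : Module.Dual K M) (x : M) :
    (dualTriple ρ).rep (loop (sh K) a) ξ x = ξ (ρ (loop (sh K) a) x) := by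
  rw [LoopTriple.rep_h, ← loopL_apply]
  induction a using laurent_induction with
  | zero => simp only [map_zero, LinearMap.zero_apply]
  | add a b ha hb => simp only [map_add, LinearMap.add_apply, ha, hb]
  | smul c m => rw [map_smul, map_smul, map_smul, laurentExt_tt]; exact (map_smul ξ c _).symm

/-- In the transposed action `e` is precomposition with `f`, which `hwf φ` kills. Together with the
next lemma this makes `hwf φ` a highest weight vector of weight `φ` in the dual, so that the
universal property produces the form. -/
theorem dualTriple_e_hwf (m : ℤ) : (dualTriple (iact φ)).e m (hwf φ) = 0 :=
  LinearMap.ext fun x => hwf_f φ (tt m) x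

theorem dualTriple_h_hwf (m : ℤ) : (dualTriple (iact φ)).h m (hwf φ) = φ m • hwf φ :=
  LinearMap.ext fun x => (hwf_h φ (tt m) x).trans (by rw [pairing_tt]; rfl)

/-- The contravariant form on the induced module. -/
def indForm : LoopInd φ →ₗ[K] Module.Dual K (LoopInd φ) :=
  hwLift (dualTriple (iact φ)) (hwf φ) (dualTriple_e_hwf φ) (dualTriple_h_hwf φ)

theorem indForm_vec : indForm φ (indVec φ) = hwf φ := hwLift_vec ..

theorem indForm_act (z : LoopAlg K) (x : LoopInd φ) :
    indForm φ (iact φ z x) = (dualTriple (iact φ)).rep z (indForm φ x) := hwLift_act ..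

theorem indForm_f (a : LaurentPolynomial K) (x y : LoopInd φ) :
    indForm φ (iact φ (loop (sf K) a) x) y = indForm φ x (iact φ (loop (se K) a) y) := by
  rw [indForm_act, dualTriple_rep_f]

theorem indForm_e (a : LaurentPolynomial K) (x y : LoopInd φ) :
    indForm φ (iact φ (loop (se K) a) x) y = indForm φ x (iact φ (loop (sf K) a) y) := by
  rw [indForm_act, dualTriple_rep_e]

theorem indForm_h (a : LaurentPolynomial K) (x y : LoopInd φ) :
    indForm φ (iact φ (loop (sh K) a) x) y = indForm φ x (iact φ (loop (sh K) a) y) := by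
  rw [indForm_act, dualTriple_rep_h]

/-- On a word with at least one letter both sides vanish: the first `f` crosses the form as an `e`,
which kills the highest weight vector. -/
theorem indForm_vec_right (x : LoopInd φ) : indForm φ x (indVec φ) = hwf φ x := by
  have : (indForm φ).flip (indVec φ) = hwf φ := by
    refine LinearMap.ext_on (span_word_indVec φ) ?_
    rintro _ ⟨l, rfl⟩
    cases l with
    | nil => rw [LinearMap.flip_apply]; exact LinearMap.congr_fun (indForm_vec φ) _
    | cons m l =>
      simp only [word_cons]
      rw [LinearMap.flip_apply, indForm_f, act_e_vec, map_zero, hwf_f]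
  exact LinearMap.congr_fun this x

/-- By induction on a word in the first argument: its letters cross to the other side as `e`'s in
either order of the arguments, and the empty word is `indForm_vec_right`. -/
theorem indForm_symm (x y : LoopInd φ) : indForm φ x y = indForm φ y x := by
  have : indForm φ = (indForm φ).flip := by
    refine LinearMap.ext_on (span_word_indVec φ) ?_
    rintro _ ⟨l, rfl⟩
    refine LinearMap.ext fun y => ?_
    change indForm φ (word _ l _) y = indForm φ y (word _ l _)
    induction l generalizing y with
    | nil => rw [word_nil, indForm_vec, indForm_vec_right]
    | cons m l ih => rw [word_cons, indForm_f, ih, indForm_e]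
  exact LinearMap.congr_fun (LinearMap.congr_fun this x) y

variable [CharZero K]

/-- If `hwf φ x ≠ 0`, a polynomial in `h` carries `x` to a non-zero multiple of the highest weight
vector, which generates everything. Characteristic zero separates the eigenvalue `φ 0` from those of
the longer words. -/
theorem hwf_eq_zero_of_mem {W : Submodule (UniversalEnvelopingAlgebra K (LoopAlg K)) (LoopInd φ)}
    (hW : W ≠ ⊤) {x : LoopInd φ} (hx : x ∈ W) : hwf φ x = 0 := by
  by_contra h0
  have hv : ∀ y ∈ K ∙ indVec φ, iact φ (loop (sh K) 1) y = φ 0 • y := by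
    intro y hy
    obtain ⟨c, rfl⟩ := Submodule.mem_span_singleton.mp hy
    rw [map_smul, act_h_vec, ← tt_zero, pairing_tt, smul_comm]
  obtain ⟨q, hq, hqx⟩ := exists_aeval_mem hv (s := Set.range fun l => word (iact φ) l (indVec φ))
    (by
      rintro _ ⟨l, rfl⟩
      cases l with
      | nil => exact Or.inl (Submodule.mem_span_singleton_self _)
      | cons m l =>
        refine Or.inr ⟨_, ?_, word_h (iact φ) (m :: l) _ _
          (hv _ (Submodule.mem_span_singleton_self _))⟩
        rw [List.length_cons, Ne, sub_eq_self]
        exact mul_ne_zero two_ne_zero (Nat.cast_ne_zero.mpr (Nat.succ_ne_zero _)))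
    (span_word_indVec φ) x
  obtain ⟨c, hc⟩ := Submodule.mem_span_singleton.mp hqx
  have hmem : Polynomial.aeval (iact φ (loop (sh K) 1)) q x ∈ W.restrictScalars K :=
    aeval_mem (fun y hy => act_mem _ hy) q x hx
  have hval := apply_aeval (T := iact φ (loop (sh K) 1)) (ξ := hwf φ) (μ := φ 0)
    (fun y => by rw [hwf_h, ← tt_zero, pairing_tt, smul_eq_mul]) q x
  rw [← hc, map_smul, hwf_vec, smul_eq_mul, mul_one, smul_eq_mul] at hval
  have hc0 : c ≠ 0 := by rw [hval]; exact mul_ne_zero hq h0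
  rw [← hc] at hmem
  have hvW : indVec φ ∈ W.restrictScalars K := (Submodule.smul_mem_iff _ hc0).mp hmem
  refine hW (ind_span W fun n => ?_)
  obtain ⟨d, hd⟩ := Submodule.mem_span_singleton.mp (indMk_mem φ n)
  rw [← hd]
  exact (W.restrictScalars K).smul_mem d hvW

/-- The largest proper submodule is the radical of the form. Pairing an element of a proper
submodule with a word amounts to applying `e`'s to it and then `hwf`, which gives zero. Conversely
the radical is a submodule, and it misses the generator because `hwf` does not vanish there. -/
theorem mem_maxSub_loopInd (x : LoopInd φ) :
    x ∈ maxSub (UniversalEnvelopingAlgebra K (LoopAlg K)) (LoopInd φ) ↔ indForm φ x = 0 := by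
  have hker : ∀ z, ∀ y ∈ LinearMap.ker (indForm φ), iact φ z y ∈ LinearMap.ker (indForm φ) := by
    intro z y hy
    rw [LinearMap.mem_ker, indForm_act, LinearMap.mem_ker.mp hy, map_zero]
  constructor
  · suffices h : maxSub (UniversalEnvelopingAlgebra K (LoopAlg K)) (LoopInd φ) ≤
      toEnvSubmodule _ hker from fun hx => h hx
    refine sSup_le fun W hW y hy => ?_
    refine LinearMap.ext_on (span_word_indVec φ) ?_
    rintro _ ⟨l, rfl⟩
    change indForm φ y (word _ l _) = 0
    induction l generalizing y with
    | nil => rw [word_nil, indForm_vec_right, hwf_eq_zero_of_mem φ hW hy]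
    | cons m l ih => rw [word_cons, ← indForm_e]; exact ih _ (act_mem _ hy)
  · intro hx
    refine (le_sSup (a := toEnvSubmodule _ hker) fun htop => ?_) (show x ∈ toEnvSubmodule _ hker
      from hx)
    have : indVec φ ∈ toEnvSubmodule _ hker := by rw [htop]; trivial
    have h0 : indForm φ (indVec φ) = 0 := this
    have := hwf_vec φ
    rw [← indForm_vec, h0] at this
    exact zero_ne_one this

end Form

/-! ### The irreducible highest weight module of the loop algebra -/

section Irreducible

variable {K : Type u} [Field K] (φ : ℤ → K)

/-- The quotient map from the induced module to its irreducible quotient. -/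
def toIrred : LoopInd φ →ₗ[K] LoopIrred φ :=
  (maxSub (UniversalEnvelopingAlgebra K (LoopAlg K)) (LoopInd φ)).mkQ.restrictScalars K

theorem toIrred_vec : toIrred φ (indVec φ) = loopVec φ := rfl

theorem toIrred_act (z : LoopAlg K) (x : LoopInd φ) :
    toIrred φ (iact φ z x) = lact φ z (toIrred φ x) := rfl

theorem toIrred_surjective : Function.Surjective (toIrred φ) := fun y => by
  obtain ⟨x, rfl⟩ := Submodule.Quotient.mk_surjective _ y
  exact ⟨x, rfl⟩

theorem toIrred_word (l : List ℤ) (x : LoopInd φ) :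
    toIrred φ (word (iact φ) l x) = word (lact φ) l (toIrred φ x) := by
  induction l with
  | nil => rfl
  | cons m l ih => rw [word_cons, toIrred_act, ih, word_cons]

/-- The vectors `f ⊗ T ^ m₁ ⋯ f ⊗ T ^ mₖ · v_φ` of `L(φ)`. -/
abbrev lword (l : List ℤ) : LoopIrred φ := word (lact φ) l (loopVec φ)

theorem span_lword : Submodule.span K (Set.range (lword φ)) = ⊤ := by
  have := congrArg (Submodule.map (toIrred φ)) (span_word_indVec φ)
  rw [Submodule.map_top, LinearMap.range_eq_top.mpr (toIrred_surjective φ), Submodule.map_span,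
    ← Set.range_comp] at this
  rw [← this]
  congr 2
  funext l
  exact (toIrred_word φ l (indVec φ)).symm

theorem lact_h_vec (a : LaurentPolynomial K) :
    lact φ (loop (sh K) a) (loopVec φ) = pairing φ a • loopVec φ := by
  rw [← toIrred_vec, ← toIrred_act, act_h_vec, map_smul]

theorem lact_e_vec (a : LaurentPolynomial K) : lact φ (loop (se K) a) (loopVec φ) = 0 := by
  rw [← toIrred_vec, ← toIrred_act, act_e_vec, map_zero]

theorem lact_h_lword (l : List ℤ) :
    lact φ (loop (sh K) 1) (lword φ l) = (φ 0 - 2 * l.length) • lword φ l :=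
  word_h _ _ _ _ (by rw [lact_h_vec, ← tt_zero, pairing_tt])

variable [CharZero K]

/-- The contravariant form on `L(φ)`. -/
def lForm : LoopIrred φ →ₗ[K] Module.Dual K (LoopIrred φ) :=
  -- The form descends in one argument, is flipped, and descends in the other; symmetry makes the
  -- resulting exchange of arguments harmless.
  liftQK _ (liftQK _ (indForm φ) fun x hx => (mem_maxSub_loopInd φ x).mp hx).flip fun x hx => by
    refine LinearMap.ext fun y => ?_
    obtain ⟨y, rfl⟩ := Submodule.Quotient.mk_surjective _ y
    change indForm φ y x = 0
    rw [indForm_symm, (mem_maxSub_loopInd φ x).mp hx, LinearMap.zero_apply]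

theorem lForm_toIrred (x y : LoopInd φ) :
    lForm φ (toIrred φ x) (toIrred φ y) = indForm φ x y := indForm_symm φ y x

theorem lForm_f (a : LaurentPolynomial K) (x y : LoopIrred φ) :
    lForm φ (lact φ (loop (sf K) a) x) y = lForm φ x (lact φ (loop (se K) a) y) := by
  obtain ⟨x, rfl⟩ := toIrred_surjective φ x
  obtain ⟨y, rfl⟩ := toIrred_surjective φ y
  rw [← toIrred_act, ← toIrred_act, lForm_toIrred, lForm_toIrred, indForm_f]

theorem lForm_e (a : LaurentPolynomial K) (x y : LoopIrred φ) :
    lForm φ (lact φ (loop (se K) a) x) y = lForm φ x (lact φ (loop (sf K) a) y) := by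
  obtain ⟨x, rfl⟩ := toIrred_surjective φ x
  obtain ⟨y, rfl⟩ := toIrred_surjective φ y
  rw [← toIrred_act, ← toIrred_act, lForm_toIrred, lForm_toIrred, indForm_e]

theorem lForm_h (a : LaurentPolynomial K) (x y : LoopIrred φ) :
    lForm φ (lact φ (loop (sh K) a) x) y = lForm φ x (lact φ (loop (sh K) a) y) := by
  obtain ⟨x, rfl⟩ := toIrred_surjective φ x
  obtain ⟨y, rfl⟩ := toIrred_surjective φ y
  rw [← toIrred_act, ← toIrred_act, lForm_toIrred, lForm_toIrred, indForm_h]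

theorem lForm_vec_vec : lForm φ (loopVec φ) (loopVec φ) = 1 := by
  rw [← toIrred_vec, lForm_toIrred, indForm_vec, hwf_vec]

theorem lForm_vec_f (a : LaurentPolynomial K) (x : LoopIrred φ) :
    lForm φ (loopVec φ) (lact φ (loop (sf K) a) x) = 0 := by
  rw [← lForm_e, lact_e_vec, map_zero, LinearMap.zero_apply]

theorem lForm_f_vec (a : LaurentPolynomial K) (x : LoopIrred φ) :
    lForm φ (lact φ (loop (sf K) a) x) (loopVec φ) = 0 := by
  rw [lForm_f, lact_e_vec, map_zero]

/-- Non-degeneracy: the quotient was taken by exactly the radical, and words span. -/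
theorem eq_zero_of_lForm {x : LoopIrred φ} (h : ∀ l, lForm φ x (lword φ l) = 0) : x = 0 := by
  have hx : lForm φ x = 0 := by
    refine LinearMap.ext_on (span_lword φ) ?_
    rintro _ ⟨l, rfl⟩
    exact h l
  obtain ⟨x, rfl⟩ := toIrred_surjective φ x
  refine (Submodule.Quotient.mk_eq_zero _).mpr ((mem_maxSub_loopInd φ x).mpr ?_)
  refine LinearMap.ext fun y => ?_
  rw [← lForm_toIrred, hx, LinearMap.zero_apply, LinearMap.zero_apply]

theorem loopVec_ne_zero : loopVec φ ≠ 0 := fun h => by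
  have := lForm_vec_vec φ
  rw [h, map_zero] at this
  exact zero_ne_one this

end Irreducible

/-! ### The automorphism `η` -/

section Eta

variable {K : Type u} [Field K] {φ : ℤ → K} {r : ℕ} (hr : HasDegree φ r) (ζ : Kˣ)
  (hζ : ζ ^ r = 1)

theorem eta_act_tt (x : G K) (m : ℤ) (w : LoopIrred φ) :
    eta hr ζ hζ (lact φ (loop x (tt m)) w) =
      ((ζ ^ (-m) : Kˣ) : K) • lact φ (loop x (tt m)) (eta hr ζ hζ w) := by
  rw [act_apply, eta_lie, rotate_loop, inv_zpow', ← act_apply, mul_one, single_eq_smul_tt,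
    ← loopL_apply, map_smul, map_smul, LinearMap.smul_apply, loopL_apply]

/-- Words diagonalise `η` as well as `h`: each letter `f ⊗ T ^ m` contributes `ζ ^ (-m)` and `v_φ`
is fixed. -/
theorem eta_lword (l : List ℤ) :
    eta hr ζ hζ (lword φ l) = ((ζ ^ (-l.sum) : Kˣ) : K) • lword φ l := by
  induction l with
  | nil => simp [eta_vec]
  | cons m l ih =>
    rw [lword, word_cons, eta_act_tt, ih, map_smul, smul_smul, ← Units.val_mul, ← zpow_add,
      List.sum_cons, neg_add]

/-- `η` rescales the adjoint operators `f ⊗ T ^ m` and `e ⊗ T ^ m` by the same factor `ζ ^ (-m)`, so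
a letter can cross the form without leaving a scalar behind. This reduces the claim to `x = v_φ`. -/
theorem lForm_eta [CharZero K] (x y : LoopIrred φ) :
    lForm φ (eta hr ζ hζ x) (eta hr ζ hζ y) = lForm φ x y := by
  have : (lForm φ).compl₁₂ (eta hr ζ hζ) (eta hr ζ hζ) = lForm φ := by
    refine LinearMap.ext_on (span_lword φ) ?_
    rintro _ ⟨l, rfl⟩
    refine LinearMap.ext fun y => ?_
    rw [LinearMap.compl₁₂_apply]
    induction l generalizing y with
    | nil =>
      rw [lword, word_nil, eta_vec]
      have : lForm φ (loopVec φ) ∘ₗ eta hr ζ hζ = lForm φ (loopVec φ) := by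
        refine LinearMap.ext_on (span_lword φ) ?_
        rintro _ ⟨l, rfl⟩
        rw [LinearMap.comp_apply]
        cases l with
        | nil => rw [lword, word_nil, eta_vec]
        | cons m l => rw [eta_lword, lword, word_cons, map_smul, lForm_vec_f, smul_zero]
      exact LinearMap.congr_fun this y
    | cons m l ih =>
      rw [lword, word_cons, eta_act_tt, lForm_f, ← ih, eta_act_tt, map_smul, LinearMap.smul_apply,
        map_smul, lForm_f]
  exact LinearMap.congr_fun (LinearMap.congr_fun this x) y

end Eta

/-! ### Exponential-polynomial functions -/

section ExpPoly

variable {K : Type u} [Field K]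

/-- The space spanned by the shifts of a function on the integers. -/
def shiftSpan (φ : ℤ → K) : Submodule K (ℤ → K) :=
  Submodule.span K (Set.range fun s : ℤ => fun m => φ (m + s))

theorem shift_mem_shiftSpan (φ : ℤ → K) (s : ℤ) : (fun m => φ (m + s)) ∈ shiftSpan φ :=
  Submodule.subset_span ⟨s, rfl⟩

theorem self_mem_shiftSpan (φ : ℤ → K) : φ ∈ shiftSpan φ := by
  simpa using shift_mem_shiftSpan φ 0

theorem shift_mem (φ : ℤ → K) (s : ℤ) {ψ : ℤ → K} (h : ψ ∈ shiftSpan φ) :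
    (fun m => ψ (m + s)) ∈ shiftSpan φ := by
  have : Submodule.map (LinearMap.funLeft K K fun m => m + s) (shiftSpan φ) ≤ shiftSpan φ := by
    rw [shiftSpan, Submodule.map_span, Submodule.span_le]
    rintro _ ⟨_, ⟨i, rfl⟩, rfl⟩
    refine Submodule.subset_span ⟨s + i, ?_⟩
    funext m
    exact congrArg φ (add_assoc m s i).symm
  exact this (Submodule.mem_map_of_mem h)

/-- By the binomial theorem every shift of `m ^ k * lam ^ m` is a combination of the `m ^ j * lam ^
m` with `j ≤ k`. -/
theorem IsExpPoly.finiteDimensional {φ : ℤ → K} (h : IsExpPoly φ) :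
    FiniteDimensional K (shiftSpan φ) := by
  refine Submodule.span_induction (p := fun φ _ => FiniteDimensional K (shiftSpan φ))
    ?_ ?_ ?_ ?_ h
  · rintro _ ⟨lam, k, rfl⟩
    let S : Set (ℤ → K) :=
      (fun j : ℕ => fun m : ℤ => (m : K) ^ j * ((lam ^ m : Kˣ) : K)) '' (Finset.range (k + 1))
    have : FiniteDimensional K (Submodule.span K S) :=
      FiniteDimensional.span_of_finite K ((Finset.finite_toSet _).image _)
    refine Submodule.finiteDimensional_of_le (S₂ := Submodule.span K S) (Submodule.span_le.mpr ?_)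
    rintro _ ⟨s, rfl⟩
    have hs : (fun m : ℤ => ((m + s : ℤ) : K) ^ k * ((lam ^ (m + s) : Kˣ) : K)) =
        ∑ j ∈ Finset.range (k + 1), ((s : K) ^ (k - j) * (k.choose j) * ((lam ^ s : Kˣ) : K)) •
          fun m : ℤ => (m : K) ^ j * ((lam ^ m : Kˣ) : K) := by
      funext m
      rw [Finset.sum_apply, Int.cast_add, add_pow, Finset.sum_mul, zpow_add, Units.val_mul]
      refine Finset.sum_congr rfl fun j _ => ?_
      rw [Pi.smul_apply, smul_eq_mul]; ring
    change (fun m : ℤ => ((m + s : ℤ) : K) ^ k * ((lam ^ (m + s) : Kˣ) : K)) ∈ _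
    rw [hs]
    exact Submodule.sum_mem _ fun j hj => Submodule.smul_mem _ _
      (Submodule.subset_span ⟨j, hj, rfl⟩)
  · refine Submodule.finiteDimensional_of_le (S₂ := ⊥) (Submodule.span_le.mpr ?_)
    rintro _ ⟨s, rfl⟩
    exact Submodule.zero_mem _
  · intro φ ψ _ _ hφ hψ
    refine Submodule.finiteDimensional_of_le (S₂ := shiftSpan φ ⊔ shiftSpan ψ)
      (Submodule.span_le.mpr ?_)
    rintro _ ⟨s, rfl⟩
    exact Submodule.add_mem_sup (shift_mem_shiftSpan φ s) (shift_mem_shiftSpan ψ s)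
  · intro c φ _ hφ
    refine Submodule.finiteDimensional_of_le (S₂ := shiftSpan φ) (Submodule.span_le.mpr ?_)
    rintro _ ⟨s, rfl⟩
    exact Submodule.smul_mem _ c (shift_mem_shiftSpan φ s)

/-- Here `σ = ±1` chooses a half-line. Were `φ` zero on it, the functions in the shift span that
vanish there would form a finite-dimensional space `W` containing `φ`. Shifting by `σ` preserves `W`
injectively, hence surjectively. So `φ` is an arbitrarily far shift of an element of `W`, which
makes it zero everywhere. -/
theorem IsExpPoly.exists_ne_zero {φ : ℤ → K} (h : IsExpPoly φ) (h0 : φ ≠ 0) (σ : ℤ)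
    (hσ : σ * σ = 1) : ∃ m, 0 < σ * m ∧ φ m ≠ 0 := by
  by_contra! hneg
  have := h.finiteDimensional
  let W : Submodule K (ℤ → K) := shiftSpan φ ⊓
    { carrier := {ψ | ∀ m, 0 < σ * m → ψ m = 0}
      add_mem' := fun {a b} ha hb m hm => by rw [Pi.add_apply, ha m hm, hb m hm, add_zero]
      zero_mem' := fun _ _ => rfl
      smul_mem' := fun c a ha m hm => by rw [Pi.smul_apply, ha m hm, smul_zero] }
  have : FiniteDimensional K W := Submodule.finiteDimensional_of_le inf_le_left
  let T : W →ₗ[K] W := (LinearMap.funLeft K K fun m => m + σ).restrict fun ψ hψ =>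
    ⟨shift_mem φ σ hψ.1, fun m hm => hψ.2 _ (by rw [mul_add, hσ]; omega)⟩
  have hinj : Function.Injective T := by
    intro ψ ψ' hh
    apply Subtype.ext
    funext m
    have := congrFun (congrArg Subtype.val hh) (m - σ)
    change (ψ : ℤ → K) (m - σ + σ) = (ψ' : ℤ → K) (m - σ + σ) at this
    rwa [sub_add_cancel] at this
  have hsurj := LinearMap.surjective_of_injective hinj
  have hn : ∀ n : ℕ, ∃ ψ : W, ∀ m, φ m = (ψ : ℤ → K) (m + n * σ) := by
    intro n
    induction n with
    | zero => exact ⟨⟨φ, self_mem_shiftSpan φ, hneg⟩, fun m => by simp⟩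
    | succ n ih =>
      obtain ⟨ψ, hψ⟩ := ih
      obtain ⟨ψ', rfl⟩ := hsurj ψ
      refine ⟨ψ', fun m => ?_⟩
      rw [hψ]
      exact congrArg (ψ' : ℤ → K) (show m + n * σ + σ = m + (n + 1 : ℕ) * σ by push_cast; ring)
  refine h0 (funext fun m => ?_)
  -- This many steps carry `m` strictly into the half-line where `ψ` vanishes.
  obtain ⟨ψ, hψ⟩ := hn ((σ * m).natAbs + 1)
  rw [hψ]
  refine ψ.2.2 _ ?_
  rw [mul_add, mul_left_comm, hσ]
  push_cast
  have := neg_abs_le (σ * m)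
  omega

/-- A submonoid of `ℤ` containing both a positive and a negative integer is a subgroup, hence
cyclic, and it is not zero. -/
theorem IsExpPoly.exists_hasDegree {φ : ℤ → K} (h : IsExpPoly φ) (h0 : φ ≠ 0) :
    ∃ r, HasDegree φ r := by
  obtain ⟨a, ha, ha'⟩ := h.exists_ne_zero h0 1 (by norm_num)
  obtain ⟨b, hb, hb'⟩ := h.exists_ne_zero h0 (-1) (by norm_num)
  have haM : a ∈ AddSubmonoid.closure (Function.support φ) := AddSubmonoid.subset_closure ha'
  have hbM : b ∈ AddSubmonoid.closure (Function.support φ) := AddSubmonoid.subset_closure hb'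
  let H : AddSubgroup ℤ :=
    { AddSubmonoid.closure (Function.support φ) with
      neg_mem' := by
        intro x hx
        change x ∈ AddSubmonoid.closure (Function.support φ) at hx
        change -x ∈ AddSubmonoid.closure (Function.support φ)
        rcases le_total 0 x with hx0 | hx0
        -- For `x ≥ 0` and `b < 0`, `-x = (-b - 1) * x + x * b` uses only non-negative multiples of
        -- `x` and `b`; the other case does the same with `a`.
        · obtain ⟨n, hn⟩ := Int.eq_ofNat_of_zero_le (show 0 ≤ -b - 1 by omega)
          obtain ⟨k, hk⟩ := Int.eq_ofNat_of_zero_le hx0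
          have := add_mem (nsmul_mem hx n) (nsmul_mem hbM k)
          rwa [nsmul_eq_mul, nsmul_eq_mul, show ((n : ℕ) : ℤ) = -b - 1 from hn.symm,
            show ((k : ℕ) : ℤ) = x from hk.symm, show (-b - 1) * x + x * b = -x by ring] at this
        · obtain ⟨n, hn⟩ := Int.eq_ofNat_of_zero_le (show 0 ≤ a - 1 by omega)
          obtain ⟨k, hk⟩ := Int.eq_ofNat_of_zero_le (show 0 ≤ -x by omega)
          have := add_mem (nsmul_mem hx n) (nsmul_mem haM k)
          rwa [nsmul_eq_mul, nsmul_eq_mul, show ((n : ℕ) : ℤ) = a - 1 from hn.symm,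
            show ((k : ℕ) : ℤ) = -x from hk.symm, show (a - 1) * x + -x * a = -x by ring] at this }
  obtain ⟨g, hg⟩ := Int.subgroup_cyclic H
  have hg' : H = AddSubgroup.zmultiples ((g.natAbs : ℕ) : ℤ) := by
    rw [hg, Int.natCast_natAbs, AddSubgroup.zmultiples_eq_closure]
    rcases abs_choice g with h | h
    · rw [h]
    · rw [h, ← AddSubgroup.zmultiples_eq_closure, ← AddSubgroup.zmultiples_eq_closure,
        AddSubgroup.zmultiples_neg]
  refine ⟨g.natAbs, ?_, ?_⟩
  · rw [Int.natAbs_pos]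
    rintro rfl
    have : a ∈ H := haM
    rw [hg', Int.natAbs_zero, Nat.cast_zero, AddSubgroup.zmultiples_zero_eq_bot,
      AddSubgroup.mem_bot] at this
    omega
  · rw [← hg']

/-- The linear map `T ^ s ↦ φ (· + s)`. -/
def shiftMap (φ : ℤ → K) : LaurentPolynomial K →ₗ[K] (ℤ → K) :=
  LinearMap.pi fun m => pairing φ ∘ₗ LinearMap.mulRight K (tt m)

theorem shiftMap_apply (φ : ℤ → K) (a : LaurentPolynomial K) (m : ℤ) :
    shiftMap φ a m = pairing φ (a * tt m) := rfl

theorem range_shiftMap_le (φ : ℤ → K) : LinearMap.range (shiftMap φ) ≤ shiftSpan φ := by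
  rintro _ ⟨a, rfl⟩
  induction a using laurent_induction with
  | zero => rw [map_zero]; exact zero_mem _
  | add a b ha hb => rw [map_add]; exact add_mem ha hb
  | smul r s =>
    rw [map_smul]
    have : shiftMap φ (tt s) = fun m => φ (m + s) := by
      funext m
      rw [shiftMap_apply, tt_mul, pairing_tt, add_comm]
    rw [this]
    exact Submodule.smul_mem _ _ (shift_mem_shiftSpan φ s)

end ExpPoly

/-! ### Finite-dimensionality of the weight spaces of `L(φ)` -/

section Finite

variable {K : Type u} [Field K] [CharZero K] (φ : ℤ → K)

/-- In a pairing of `(f ⊗ a) v_φ` with a word, an `f ⊗ T ^ m` crosses as `e ⊗ T ^ m`, and `[e ⊗ T ^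
m, f ⊗ a]` acts on `v_φ` by the scalar in the hypothesis. So `f ⊗ a` kills `v_φ`, and it commutes
with every letter. -/
theorem lact_f_eq_zero {a : LaurentPolynomial K} (ha : ∀ m, pairing φ (a * tt m) = 0)
    (w : LoopIrred φ) : lact φ (loop (sf K) a) w = 0 := by
  have hv : lact φ (loop (sf K) a) (loopVec φ) = 0 := by
    refine eq_zero_of_lForm φ fun l => ?_
    cases l with
    | nil => rw [lword, word_nil, lForm_f_vec]
    | cons m l =>
      rw [lword, word_cons, ← lForm_e, rep_e_f, lact_e_vec, lact_h_vec, mul_comm, ha, zero_smul,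
        map_zero, zero_add, map_zero, LinearMap.zero_apply]
  have : lact φ (loop (sf K) a) = 0 := by
    refine LinearMap.ext_on (span_lword φ) ?_
    rintro _ ⟨l, rfl⟩
    induction l with
    | nil => exact hv
    | cons m l ih =>
      rw [lword, word_cons, rep_f_f, ih, LinearMap.zero_apply, map_zero, LinearMap.zero_apply]
  rw [this, LinearMap.zero_apply]

omit [CharZero K] in
-- The range of `f` is a quotient of `V ⧸ ker c`, which is isomorphic to the range of `c`.
theorem range_fg_of_ker_le {V A B : Type*} [AddCommGroup V] [Module K V] [AddCommGroup A]
    [Module K A] [AddCommGroup B] [Module K B] (c : V →ₗ[K] A) (f : V →ₗ[K] B)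
    [FiniteDimensional K (LinearMap.range c)] (h : LinearMap.ker c ≤ LinearMap.ker f) :
    (LinearMap.range f).FG := by
  have : FiniteDimensional K (V ⧸ LinearMap.ker c) :=
    c.quotKerEquivRange.symm.finiteDimensional
  have : FiniteDimensional K (V ⧸ LinearMap.ker f) :=
    Module.Finite.of_surjective (Submodule.factor h) (Submodule.factor_surjective h)
  exact Module.Finite.iff_fg.mp f.quotKerEquivRange.finiteDimensional

/-- The operators `f ⊗ a` on `L(φ)`. -/
def fOps : LaurentPolynomial K →ₗ[K] Module.End K (LoopIrred φ) :=
  (lact φ : LoopAlg K →ₗ[K] Module.End K (LoopIrred φ)) ∘ₗ loopL (sf K)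

theorem fOps_range_fg (hφ : IsExpPoly φ) : (LinearMap.range (fOps φ)).FG := by
  have hker : LinearMap.ker (shiftMap φ) ≤ LinearMap.ker (fOps φ) := by
    intro a ha
    refine LinearMap.mem_ker.mpr (LinearMap.ext fun w => ?_)
    exact lact_f_eq_zero φ (fun m => by
      rw [← shiftMap_apply, LinearMap.mem_ker.mp ha, Pi.zero_apply]) w
  have := hφ.finiteDimensional
  have : FiniteDimensional K (LinearMap.range (shiftMap φ)) :=
    Submodule.finiteDimensional_of_le (range_shiftMap_le φ)
  exact range_fg_of_ker_le (shiftMap φ) (fOps φ) hker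

/-- The operators `f ⊗ a` form a finite-dimensional space, so prepending one letter preserves finite
dimension. -/
theorem lword_span_fg (hφ : IsExpPoly φ) (k : ℕ) :
    (Submodule.span K {x | ∃ l : List ℤ, l.length = k ∧ x = lword φ l}).FG := by
  induction k with
  | zero =>
    refine (Submodule.fg_span_singleton (loopVec φ)).of_le (Submodule.span_mono ?_)
    rintro _ ⟨l, hl, rfl⟩
    rw [List.length_eq_zero_iff.mp hl]
    rfl
  | succ k ih =>
    -- As a bilinear map, `LinearMap.id` on `Module.End` is evaluation of an operator at a vector.
    refine ((fOps_range_fg φ hφ).map₂ LinearMap.id ih).of_le (Submodule.span_le.mpr ?_)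
    rintro _ ⟨l, hl, rfl⟩
    obtain ⟨m, l, rfl⟩ := List.exists_cons_of_length_eq_add_one hl
    exact Submodule.apply_mem_map₂ LinearMap.id
      (LinearMap.mem_range_self (fOps φ) (tt m)) (Submodule.subset_span ⟨l, by simpa using hl, rfl⟩)

omit [CharZero K] in
theorem mem_weightSpace_loop {χ : Module.Dual K (loopCartan K)} (x : LoopIrred φ) :
    x ∈ weightSpace K (LoopIrred φ) χ ↔
      lact φ (loop (sh K) 1) x = χ ⟨loop (sh K) 1, Submodule.mem_span_singleton_self _⟩ • x := by
  constructor
  · intro h; exact h ⟨loop (sh K) 1, Submodule.mem_span_singleton_self _⟩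
  · rintro h ⟨z, hz⟩
    obtain ⟨c, rfl⟩ := Submodule.mem_span_singleton.mp hz
    have : (⟨c • loop (sh K) 1, hz⟩ : loopCartan K) =
      c • ⟨loop (sh K) 1, Submodule.mem_span_singleton_self _⟩ := rfl
    rw [this, map_smul, smul_assoc, ← h]
    change lact φ (c • loop (sh K) 1) x = _
    rw [map_smul, LinearMap.smul_apply]

theorem mem_weightSpace_loopWeight {k : ℕ} (x : LoopIrred φ) :
    x ∈ weightSpace K (LoopIrred φ) (loopWeight φ k) ↔
      lact φ (loop (sh K) 1) x = (φ 0 - 2 * k) • x := by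
  rw [mem_weightSpace_loop, loopWeight, LinearMap.sub_apply, LinearMap.smul_apply,
    LinearMap.smul_apply, loopAlpha_h _ rfl, smul_eq_mul, div_mul_cancel₀ _ two_ne_zero,
    nsmul_eq_mul, mul_comm (k : K)]

theorem weightSpace_loop_finite (hφ : IsExpPoly φ) (k : ℕ) :
    FiniteDimensional K (weightSpace K (LoopIrred φ) (loopWeight φ k)) := by
  have := Module.Finite.iff_fg.mpr (lword_span_fg φ hφ k)
  refine Submodule.finiteDimensional_of_le
    (S₂ := Submodule.span K {x | ∃ l : List ℤ, l.length = k ∧ x = lword φ l}) fun x hx => ?_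
  have h := mem_span_of_eigen _ _ (lact_h_lword φ) (span_lword φ)
    ((mem_weightSpace_loopWeight φ x).mp hx)
  refine Submodule.span_mono ?_ h
  rintro _ ⟨l, hl, rfl⟩
  refine ⟨l, ?_, rfl⟩
  rw [sub_right_inj] at hl
  exact_mod_cast mul_left_cancel₀ (two_ne_zero (α := K)) hl

omit [CharZero K] in
/-- The eigenvalues of `h` on `L(φ)`. -/
theorem exists_weight {μ : K} {x : LoopIrred φ} (h : lact φ (loop (sh K) 1) x = μ • x)
    (hx : x ≠ 0) : ∃ k : ℕ, μ = φ 0 - 2 * k := by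
  have h := mem_span_of_eigen _ _ (lact_h_lword φ) (span_lword φ) h
  by_contra! hne
  refine hx ?_
  have : {y | ∃ l : List ℤ, φ 0 - 2 * (l.length : K) = μ ∧ y = lword φ l} = ∅ := by
    refine Set.eq_empty_of_forall_notMem ?_
    rintro _ ⟨l, hl, -⟩
    exact hne _ hl.symm
  rw [this, Submodule.span_empty] at h
  exact (Submodule.mem_bot K).mp h

end Finite

/-! ### Symmetry of the dimensions of semi-invariants -/

section Symmetry

variable {K : Type u} [Field K] [CharZero K] {φ : ℤ → K} {r : ℕ} (hr : HasDegree φ r) (ζ : Kˣ)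
  (hζ : ζ ^ r = 1)

theorem mem_semiInvariants {k : ℕ} {n : ℤ} (x : LoopIrred φ) :
    x ∈ semiInvariants hr ζ hζ k n ↔ lact φ (loop (sh K) 1) x = (φ 0 - 2 * k) • x ∧
      eta hr ζ hζ x = ((ζ ^ n : Kˣ) : K) • x := by
  rw [semiInvariants, Submodule.mem_inf, mem_weightSpace_loopWeight, Module.End.mem_eigenspace_iff]

theorem semiInvariants_finite (hφ : IsExpPoly φ) (k : ℕ) (n : ℤ) :
    FiniteDimensional K (semiInvariants hr ζ hζ k n) :=
  have := weightSpace_loop_finite φ hφ k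
  Submodule.finiteDimensional_of_le inf_le_left

/-- The contravariant form embeds the semi-invariants for `n` into the dual of those for `-n`. Words
span and are joint eigenvectors of `h` and `η`, so a word pairing non-trivially with `x` must have
the same `h`-eigenvalue and the inverse `η`-eigenvalue; non-degeneracy therefore survives the
restriction. -/
theorem finrank_semiInvariants_le (hφ : IsExpPoly φ) (k : ℕ) (n : ℤ) :
    Module.finrank K (semiInvariants hr ζ hζ k n) ≤
      Module.finrank K (semiInvariants hr ζ hζ k (-n)) := by
  have := semiInvariants_finite hr ζ hζ hφ k (-n)
  let g : semiInvariants hr ζ hζ k n →ₗ[K] Module.Dual K (semiInvariants hr ζ hζ k (-n)) :=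
    (lForm φ).compl₁₂ (Submodule.subtype _) (Submodule.subtype _)
  rw [← Subspace.dual_finrank_eq (V := semiInvariants hr ζ hζ k (-n))]
  refine LinearMap.finrank_le_finrank_of_injective (f := g) ((injective_iff_map_eq_zero g).mpr ?_)
  rintro ⟨x, hx⟩ hgx
  obtain ⟨hx1, hx2⟩ := (mem_semiInvariants hr ζ hζ x).mp hx
  refine Subtype.ext (eq_zero_of_lForm φ fun l => ?_)
  change lForm φ x (lword φ l) = 0
  by_contra h0
  have e1 := lForm_h φ 1 x (lword φ l)
  rw [hx1, lact_h_lword, map_smul, map_smul, LinearMap.smul_apply, smul_eq_mul, smul_eq_mul] at e1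
  have e2 := lForm_eta hr ζ hζ x (lword φ l)
  rw [hx2, eta_lword, map_smul, map_smul, LinearMap.smul_apply, smul_eq_mul, smul_eq_mul,
    ← mul_assoc, ← Units.val_mul, mul_eq_right₀ h0, ← Units.val_one, Units.val_inj,
    mul_eq_one_iff_eq_inv, ← zpow_neg] at e2
  have hmem : lword φ l ∈ semiInvariants hr ζ hζ k (-n) := by
    rw [mem_semiInvariants, lact_h_lword, eta_lword, ← mul_right_cancel₀ h0 e1, e2]
    exact ⟨rfl, rfl⟩
  exact h0 (LinearMap.congr_fun hgx ⟨lword φ l, hmem⟩)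

theorem finrank_semiInvariants_neg (hφ : IsExpPoly φ) (k : ℕ) (n : ℤ) :
    Module.finrank K (semiInvariants hr ζ hζ k (-n)) =
      Module.finrank K (semiInvariants hr ζ hζ k n) := by
  apply le_antisymm
  · conv_rhs => rw [← neg_neg n]
    exact finrank_semiInvariants_le hr ζ hζ hφ k (-n)
  · exact finrank_semiInvariants_le hr ζ hζ hφ k n

end Symmetry

/-! ### Loop modules of the affine Lie algebra -/

section LoopModule

variable {K : Type u} [Field K] {M : Type w} [AddCommGroup M] [Module K M]

/-- The operator `T ^ n ⊗ y ↦ T ^ (n + m) ⊗ S y`. -/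
def shiftOp (m : ℤ) : Module.End K M →ₗ[K] Module.End K (ℤ →₀ M) where
  toFun S := Finsupp.lmapDomain M K (fun n => n + m) ∘ₗ Finsupp.mapRange.linearMap S
  map_add' S T := by ext n y : 2; simp [Finsupp.mapDomain_single, Finsupp.mapDomain_add]
  map_smul' c S := by ext n y : 2; simp [Finsupp.mapDomain_single]

@[simp] theorem shiftOp_single (m : ℤ) (S : Module.End K M) (n : ℤ) (y : M) :
    shiftOp m S (Finsupp.single n y) = Finsupp.single (n + m) (S y) := by
  simp [shiftOp, Finsupp.mapDomain_single]

theorem shiftOp_apply (m : ℤ) (S : Module.End K M) (y : ℤ →₀ M) (n : ℤ) :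
    shiftOp m S y (n + m) = S (y n) := by
  change Finsupp.mapDomain (fun n => n + m) (Finsupp.mapRange S (map_zero S) y) (n + m) = _
  rw [Finsupp.mapDomain_apply (add_left_injective m), Finsupp.mapRange_apply]

theorem shiftOp_lie (m n : ℤ) (S T : Module.End K M) :
    ⁅shiftOp m S, shiftOp n T⁆ = shiftOp (m + n) ⁅S, T⁆ := by
  refine Finsupp.lhom_ext fun k y => ?_
  change shiftOp m S (shiftOp n T (Finsupp.single k y)) -
    shiftOp n T (shiftOp m S (Finsupp.single k y)) = _
  rw [shiftOp_single, shiftOp_single, shiftOp_single, shiftOp_single, shiftOp_single,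
    show k + n + m = k + (m + n) by ring, add_assoc k m n, ← Finsupp.single_sub]
  rfl

variable (K M) in
/-- The operator `T ^ n ⊗ y ↦ n T ^ n ⊗ y`. -/
def degOp : Module.End K (ℤ →₀ M) :=
  Finsupp.lsum K fun n : ℤ => (n : K) • Finsupp.lsingle n

@[simp] theorem degOp_single (n : ℤ) (y : M) :
    degOp K M (Finsupp.single n y) = (n : K) • Finsupp.single n y := by
  simp [degOp]

theorem degOp_apply (y : ℤ →₀ M) (n : ℤ) : degOp K M y n = (n : K) • y n := by
  induction y using Finsupp.induction_linear with
  | zero => simp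
  | add y z hy hz => rw [map_add, Finsupp.add_apply, hy, hz, Finsupp.add_apply, smul_add]
  | single k y =>
    rw [degOp_single, Finsupp.smul_apply]
    by_cases h : k = n
    · rw [h]
    · rw [Finsupp.single_eq_of_ne (Ne.symm h), smul_zero, smul_zero]

theorem degOp_shiftOp (m : ℤ) (S : Module.End K M) :
    ⁅degOp K M, shiftOp m S⁆ = (m : K) • shiftOp m S := by
  refine Finsupp.lhom_ext fun k y => ?_
  change degOp K M (shiftOp m S (Finsupp.single k y)) -
    shiftOp m S (degOp K M (Finsupp.single k y)) = (m : K) • shiftOp m S (Finsupp.single k y)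
  rw [degOp_single, map_smul, shiftOp_single, degOp_single, ← sub_smul]
  congr 1; push_cast; ring

variable (ρ : LoopAlg K →ₗ⁅K⁆ Module.End K M)

/-- The operators of the loop algebra on `M ⊗ K[T;T⁻¹]`. -/
def loopTriple : LoopTriple K (ℤ →₀ M) where
  e m := shiftOp m (ρ (loop (se K) (tt m)))
  h m := shiftOp m (ρ (loop (sh K) (tt m)))
  f m := shiftOp m (ρ (loop (sf K) (tt m)))
  e_f m n := by rw [shiftOp_lie, ← LieHom.map_lie, lie_se_sf, tt_mul]
  h_f m n := by rw [shiftOp_lie, ← LieHom.map_lie, lie_sh_sf, tt_mul, map_smul, map_smul]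
  h_e m n := by rw [shiftOp_lie, ← LieHom.map_lie, lie_sh_se, tt_mul, map_smul, map_smul]
  h_h m n := by rw [shiftOp_lie, ← LieHom.map_lie, lie_loop_self, map_zero, map_zero]
  e_e m n := by rw [shiftOp_lie, ← LieHom.map_lie, lie_loop_self, map_zero, map_zero]
  f_f m n := by rw [shiftOp_lie, ← LieHom.map_lie, lie_loop_self, map_zero, map_zero]

theorem degOp_laurentExt {g : ℤ → Module.End K (ℤ →₀ M)}
    (h : ∀ m : ℤ, ⁅degOp K M, g m⁆ = (m : K) • g m) (a : LaurentPolynomial K) :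
    ⁅degOp K M, laurentExt g a⁆ = laurentExt g (hadamard (fun m => (m : K)) a) := by
  induction a using laurent_induction with
  | zero => simp
  | add a b ha hb => simp only [map_add, lie_add, ha, hb]
  | smul c m =>
    rw [map_smul, map_smul, map_smul, lie_smul_assoc, laurentExt_tt, h, hadamard_single, mul_one,
      single_eq_smul_tt, map_smul, laurentExt_tt]

theorem degOp_loopTriple (z : LoopAlg K) :
    ⁅degOp K M, (loopTriple ρ).rep z⁆ =
      (loopTriple ρ).rep (loopHadamard (fun m => (m : K)) z) := by
  rw [LoopTriple.rep_apply, LoopTriple.rep_apply, lie_add, lie_add, degOp_laurentExt,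
    degOp_laurentExt, degOp_laurentExt, entry_loopHadamard, entry_loopHadamard,
    entry_loopHadamard]
  all_goals exact fun m => degOp_shiftOp m _

/-- The representation of the affine Lie algebra on `M ⊗ K[T;T⁻¹]`. -/
def affRep : AffAlg K →ₗ⁅K⁆ Module.End K (ℤ →₀ M) where
  toFun z := (loopTriple ρ).rep z.left + z.right • degOp K M
  map_add' z w := by
    change (loopTriple ρ).rep (z.left + w.left) + (z.right + w.right) • degOp K M = _
    rw [map_add, add_smul]; abel
  map_smul' c z := by
    change (loopTriple ρ).rep (c • z.left) + (c * z.right) • degOp K M = _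
    rw [map_smul, mul_smul, smul_add, RingHom.id_apply]
  map_lie' {z w} := by
    change (loopTriple ρ).rep (⁅z, w⁆ : AffAlg K).left +
      (⁅z, w⁆ : AffAlg K).right • degOp K M = _
    have h1 : ∀ (c : K) (x : LoopAlg K), ⁅(loopTriple ρ).rep x, c • degOp K M⁆ =
        -(c • (loopTriple ρ).rep (loopHadamard (fun m => (m : K)) x)) := by
      intro c x
      rw [lie_smul_assoc, ← lie_skew, degOp_loopTriple, smul_neg]
    rw [aff_left_lie, aff_right_lie, add_lie, lie_add, lie_add, h1, smul_lie_assoc,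
      smul_lie_assoc, lie_smul_assoc, lie_self, degOp_loopTriple, map_sub, map_add, map_smul,
      map_smul, LieHom.map_lie]
    module

theorem affRep_apply (z : AffAlg K) :
    affRep ρ z = (loopTriple ρ).rep z.left + z.right • degOp K M := rfl

variable (K) in
/-- The inclusion of the loop algebra. -/
abbrev affInl : LoopAlg K →ₗ⁅K⁆ AffAlg K := LieAlgebra.SemiDirectSum.inl (degHom K)

variable (K) in
/-- The element `d`. -/
abbrev affD : AffAlg K := ⟨0, 1⟩

theorem affRep_inl (z : LoopAlg K) : affRep ρ (affInl K z) = (loopTriple ρ).rep z := by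
  rw [affRep_apply]
  change (loopTriple ρ).rep z + (0 : K) • degOp K M = _
  rw [zero_smul, add_zero]

theorem affRep_d : affRep ρ (affD K) = degOp K M := by
  rw [affRep_apply, map_zero, zero_add, one_smul]

theorem affRep_e (m : ℤ) :
    affRep ρ (affInl K (loop (se K) (tt m))) = shiftOp m (ρ (loop (se K) (tt m))) := by
  rw [affRep_inl, LoopTriple.rep_e, laurentExt_tt]; rfl

theorem affRep_h (m : ℤ) :
    affRep ρ (affInl K (loop (sh K) (tt m))) = shiftOp m (ρ (loop (sh K) (tt m))) := by
  rw [affRep_inl, LoopTriple.rep_h, laurentExt_tt]; rfl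

theorem affRep_f (m : ℤ) :
    affRep ρ (affInl K (loop (sf K) (tt m))) = shiftOp m (ρ (loop (sf K) (tt m))) := by
  rw [affRep_inl, LoopTriple.rep_f, laurentExt_tt]; rfl

theorem aff_decomp (z : AffAlg K) : z = affInl K z.left + z.right • affD K := by
  have h1 : (z.left : LoopAlg K) = z.left + z.right • 0 := by rw [smul_zero, add_zero]
  have h2 : z.right = 0 + z.right • (1 : K) := by rw [smul_eq_mul, mul_one, zero_add]
  exact LieAlgebra.SemiDirectSum.ext h1 h2

theorem affD_inl (z : LoopAlg K) :
    ⁅affD K, affInl K z⁆ = affInl K (loopHadamard (fun m => (m : K)) z) := by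
  refine LieAlgebra.SemiDirectSum.ext ?_ (aff_right_lie _ _)
  rw [aff_left_lie]
  change ⁅(0 : LoopAlg K), z⁆ + (1 : K) • loopHadamard _ z - (0 : K) • loopHadamard _ 0 = _
  rw [zero_lie, zero_add, one_smul, zero_smul, sub_zero]
  rfl

theorem affD_loop (x : G K) (m : ℤ) :
    ⁅affD K, affInl K (loop x (tt m))⁆ = (m : K) • affInl K (loop x (tt m)) := by
  rw [affD_inl, loopHadamard_loop, hadamard_single, mul_one, single_eq_smul_tt, ← loopL_apply,
    map_smul, map_smul, loopL_apply]

end LoopModule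

/-! ### The map from the induced module of the affine Lie algebra to `L(φ) ⊗ K[T;T⁻¹]` -/

section AffLift

variable {K : Type u} [Field K] (φ : ℤ → K)

/-- A Laurent polynomial as an element of the module `TMod φ`. -/
def tm : LaurentPolynomial K →ₗ[K] TMod φ :=
  show LaurentPolynomial K →ₗ[K] LaurentPolynomial K from LinearMap.id

theorem tm_surjective : Function.Surjective (tm φ) := fun a => ⟨a, rfl⟩

theorem tm_lie (z : affBorel K) (a : LaurentPolynomial K) :
    ⁅z, tm φ a⁆ = tm φ (hadamard φ (entry 0 0 (z : AffAlg K).left) * a) +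
      (z : AffAlg K).right • tm φ (hadamard (fun m => (m : K)) a) := rfl

/-- `h ⊗ a` as an element of the Borel subalgebra. -/
def borelH (a : LaurentPolynomial K) : affBorel K :=
  ⟨affInl K (loop (sh K) a), entry_sh_one_zero a⟩

/-- `e ⊗ a` as an element of the Borel subalgebra. -/
def borelE (a : LaurentPolynomial K) : affBorel K :=
  ⟨affInl K (loop (se K) a), by
    change entry 1 0 (loop (se K) a) = 0
    rw [entry_se]; rfl⟩

variable (K) in
/-- `d` as an element of the Borel subalgebra. -/
def borelD : affBorel K := ⟨affD K, map_zero (entry 1 0)⟩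

theorem borelH_lie (b a : LaurentPolynomial K) :
    ⁅borelH b, tm φ a⁆ = tm φ (hadamard φ b * a) := by
  rw [tm_lie]
  change tm φ (hadamard φ (entry 0 0 (loop (sh K) b)) * a) + (0 : K) • _ = _
  rw [zero_smul, add_zero, entry_sh_zero_zero]

theorem borelH_lie_tt (m n : ℤ) : ⁅borelH (K := K) (tt m), tm φ (tt n)⁆ = φ m • tm φ (tt (m + n)) := by
  rw [borelH_lie, hadamard_single, mul_one, single_eq_smul_tt, smul_mul_assoc, tt_mul, map_smul]

theorem borelE_lie (b a : LaurentPolynomial K) : ⁅borelE b, tm φ a⁆ = 0 := by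
  rw [tm_lie]
  change tm φ (hadamard φ (entry 0 0 (loop (se K) b)) * a) + (0 : K) • _ = _
  rw [zero_smul, add_zero, entry_se, if_neg (by decide), map_zero, zero_mul, map_zero]

theorem borelD_lie_tt (n : ℤ) : ⁅borelD K, tm φ (tt n)⁆ = (n : K) • tm φ (tt n) := by
  rw [tm_lie]
  change tm φ (hadamard φ (entry 0 0 (0 : LoopAlg K)) * tt n) + (1 : K) • _ = _
  rw [one_smul, map_zero, map_zero, zero_mul, map_zero, zero_add, hadamard_single, mul_one,
    single_eq_smul_tt, map_smul]

/-- The linear map `T ^ n ↦ v_φ ⊗ T ^ n`. -/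
def vecMap : TMod φ →ₗ[K] (ℤ →₀ LoopIrred φ) :=
  show LaurentPolynomial K →ₗ[K] (ℤ →₀ LoopIrred φ) from
    laurentExt fun n => Finsupp.single n (loopVec φ)

theorem vecMap_tm (a : LaurentPolynomial K) :
    vecMap φ (tm φ a) = laurentExt (fun n => Finsupp.single n (loopVec φ)) a := rfl

theorem vecMap_tt (n : ℤ) : vecMap φ (tm φ (tt n)) = Finsupp.single n (loopVec φ) := by
  rw [vecMap_tm, laurentExt_tt]

theorem loopTriple_e_vecMap (m : ℤ) (a : LaurentPolynomial K) :
    (loopTriple (lact φ)).e m (vecMap φ (tm φ a)) = 0 := by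
  change shiftOp m _ _ = 0
  induction a using laurent_induction with
  | zero => simp only [map_zero]
  | add a a' ha ha' => simp only [map_add, ha, ha', add_zero]
  | smul c n =>
    rw [map_smul, map_smul, map_smul, vecMap_tt, shiftOp_single, lact_e_vec, Finsupp.single_zero,
      smul_zero]

theorem loopTriple_h_vecMap (m : ℤ) (a : LaurentPolynomial K) :
    (loopTriple (lact φ)).h m (vecMap φ (tm φ a)) = vecMap φ (tm φ (hadamard φ (tt m) * a)) := by
  change shiftOp m _ _ = _
  induction a using laurent_induction with
  | zero => simp only [map_zero, mul_zero]
  | add a a' ha ha' => simp only [map_add, mul_add, ha, ha']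
  | smul c n =>
    rw [map_smul, map_smul, map_smul, vecMap_tt, shiftOp_single, lact_h_vec, pairing_tt,
      mul_smul_comm, hadamard_single, mul_one, single_eq_smul_tt, smul_mul_assoc, tt_mul, map_smul,
      map_smul, map_smul, map_smul, vecMap_tt, add_comm m n, Finsupp.smul_single,
      Finsupp.smul_single, Finsupp.smul_single]

theorem degOp_vecMap (a : LaurentPolynomial K) :
    degOp K _ (vecMap φ (tm φ a)) = vecMap φ (tm φ (hadamard (fun m => (m : K)) a)) := by
  induction a using laurent_induction with
  | zero => simp only [map_zero]
  | add a a' ha ha' => simp only [map_add, ha, ha']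
  | smul c n =>
    rw [map_smul, map_smul, map_smul, map_smul, vecMap_tt, degOp_single, hadamard_single,
      mul_one, single_eq_smul_tt, map_smul, map_smul, map_smul, map_smul, vecMap_tt]

/-- The restriction of `vecMap` to `H(φ)`. -/
def hvecMap : HMod φ →ₗ[K] (ℤ →₀ LoopIrred φ) := vecMap φ ∘ₗ (HMod φ).toSubmodule.subtype

/-- In the loop module `v_φ ⊗ T ^ n` satisfies the rules that define the action on `T ^ n`: `h ⊗ T ^
m` multiplies by `φ m` and shifts, `e ⊗ T ^ m` kills, `d` gives `n`. -/
theorem hvecMap_compat (x : affBorel K) (n : HMod φ) :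
    hvecMap φ ⁅x, n⁆ = affRep (lact φ) x (hvecMap φ n) := by
  obtain ⟨a, ha⟩ := n
  obtain ⟨a, rfl⟩ := tm_surjective φ a
  change vecMap φ ⁅x, tm φ a⁆ = affRep (lact φ) x (vecMap φ (tm φ a))
  rw [tm_lie, affRep_apply, LinearMap.add_apply, LoopTriple.rep_apply, entry_affBorel, map_zero,
    add_zero, LinearMap.add_apply, laurentExt_apply_eq _ _ 0 (fun m => loopTriple_e_vecMap φ m a),
    laurentExt_apply_eq _ _ (vecMap φ ∘ₗ tm φ ∘ₗ LinearMap.mulRight K a ∘ₗ hadamard φ)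
      (fun m => loopTriple_h_vecMap φ m a), LinearMap.smul_apply, degOp_vecMap, map_add, map_smul,
    LinearMap.zero_apply, zero_add]
  rfl

/-- The homomorphism from the induced module to `L(φ) ⊗ K[T;T⁻¹]`. -/
def affLift : AffInd φ →ₗ[K] (ℤ →₀ LoopIrred φ) :=
  indLift (affRep (lact φ)) (hvecMap φ) (hvecMap_compat φ)

/-- The action of the affine Lie algebra on the induced module. -/
abbrev aact : AffAlg K →ₗ⁅K⁆ Module.End K (AffInd φ) := act K (AffAlg K) (AffInd φ)

theorem affLift_act (z : AffAlg K) (x : AffInd φ) :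
    affLift φ (aact φ z x) = affRep (lact φ) z (affLift φ x) := indLift_act ..

theorem affLift_indMk (n : HMod φ) : affLift φ (indMk n) = vecMap φ n := indLift_indMk ..

/-- The action of the loop algebra on the induced module of the affine Lie algebra. -/
abbrev alact : LoopAlg K →ₗ⁅K⁆ Module.End K (AffInd φ) := (aact φ).comp (affInl K)

/-- The exponents `p` with `T ^ p` in `H(φ)`. -/
abbrev HExp : Type := {p : ℤ // tm φ (tt p) ∈ HMod φ}

/-- The element `T ^ p` of `H(φ)`. -/
def hvec (p : HExp φ) : HMod φ := ⟨tm φ (tt p), p.2⟩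

/-- The vector `f ⊗ T ^ m₁ ⋯ f ⊗ T ^ mₖ · T ^ p` of the induced module. -/
def aword (i : List ℤ × HExp φ) : AffInd φ := word (alact φ) i.1 (indMk (hvec φ i.2))

/-- Each letter `f ⊗ T ^ m` extends the word and raises the degree by `m`. This formula describes
the image of `affLift`. -/
theorem affLift_aword (i : List ℤ × HExp φ) :
    affLift φ (aword φ i) = Finsupp.single (i.2 + i.1.sum) (lword φ i.1) := by
  obtain ⟨l, p⟩ := i
  induction l with
  | nil =>
    change affLift φ (indMk (hvec φ p)) = _
    rw [affLift_indMk, List.sum_nil, add_zero]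
    exact vecMap_tt φ p
  | cons m l ih =>
    change affLift φ (aact φ (affInl K (loop (sf K) (tt m))) (aword φ (l, p))) = _
    rw [affLift_act, ih, affRep_f, shiftOp_single, List.sum_cons]
    congr 1; ring

end AffLift

/-! ### The module `H(φ)` -/

section HModule

variable {K : Type u} [Field K] {φ : ℤ → K} {r : ℕ}

theorem HasDegree.mem_closure_iff (hr : HasDegree φ r) (p : ℤ) :
    p ∈ AddSubmonoid.closure (Function.support φ) ↔ (r : ℤ) ∣ p := by
  rw [hr.2]
  change p ∈ AddSubgroup.zmultiples (r : ℤ) ↔ _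
  rw [Int.mem_zmultiples_iff]

theorem one_mem_HMod : tm φ (tt 0) ∈ HMod φ :=
  LieSubmodule.subset_lieSpan (Set.mem_singleton _)

theorem HasDegree.dvd_of_ne_zero (hr : HasDegree φ r) {m : ℤ} (hm : φ m ≠ 0) : (r : ℤ) ∣ m :=
  (hr.mem_closure_iff m).mp (AddSubmonoid.subset_closure hm)

/-- A subspace that is stable under `h ⊗ T ^ m` and contains some `T ^ q` contains all
`T ^ (p + q)` with `p` divisible by the degree. -/
theorem HasDegree.tt_mem (hr : HasDegree φ r) {W : Submodule K (TMod φ)}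
    (hW : ∀ m, ∀ x ∈ W, ⁅borelH (K := K) (tt m), x⁆ ∈ W) {p : ℤ} (hp : (r : ℤ) ∣ p) {q : ℤ}
    (hq : tm φ (tt q) ∈ W) : tm φ (tt (p + q)) ∈ W := by
  rw [← hr.mem_closure_iff] at hp
  induction hp using AddSubmonoid.closure_induction generalizing q with
  | mem m hm =>
    have h1 := hW m _ hq
    rw [borelH_lie_tt] at h1
    -- For `m` in the support of `φ` the factor `φ m` can be divided out.
    exact (Submodule.smul_mem_iff W hm).mp h1
  | zero => rwa [zero_add]
  | add x y _ _ hx hy => rw [add_assoc]; exact hx (hy hq)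

theorem HasDegree.tt_mem_HMod (hr : HasDegree φ r) {p : ℤ} (hp : (r : ℤ) ∣ p) :
    tm φ (tt p) ∈ HMod φ := by
  have := hr.tt_mem (W := (HMod φ).toSubmodule) (fun m x hx => LieSubmodule.lie_mem _ hx) hp
    one_mem_HMod
  rwa [add_zero] at this

/-- The span of the `T ^ p` with `p` divisible by the degree, as a module. -/
def HasDegree.spanMod (hr : HasDegree φ r) : LieSubmodule K (affBorel K) (TMod φ) where
  toSubmodule := Submodule.span K {a | ∃ p : ℤ, (r : ℤ) ∣ p ∧ a = tm φ (tt p)}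
  lie_mem {x a} ha := by
    change a ∈ Submodule.span K _ at ha
    change ⁅x, a⁆ ∈ Submodule.span K _
    induction ha using Submodule.span_induction with
    | zero => rw [lie_zero]; exact zero_mem _
    | add a b _ _ ha hb => rw [lie_add]; exact add_mem ha hb
    | smul c a _ ha => rw [lie_smul]; exact Submodule.smul_mem _ c ha
    | mem a ha =>
      obtain ⟨p, hp, rfl⟩ := ha
      rw [tm_lie]
      refine Submodule.add_mem _ ?_ (Submodule.smul_mem _ _ ?_)
      · generalize entry 0 0 (x : AffAlg K).left = b
        induction b using laurent_induction with
        | zero => rw [map_zero, zero_mul, map_zero]; exact zero_mem _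
        | add a b ha hb => rw [map_add, add_mul, map_add]; exact add_mem ha hb
        | smul c m =>
          rw [map_smul, smul_mul_assoc, hadamard_single, mul_one, single_eq_smul_tt,
            smul_mul_assoc, tt_mul, map_smul, map_smul]
          by_cases hm : φ m = 0
          · rw [hm, zero_smul, smul_zero]; exact zero_mem _
          · exact Submodule.smul_mem _ _ (Submodule.smul_mem _ _ (Submodule.subset_span
              ⟨m + p, dvd_add (hr.dvd_of_ne_zero hm) hp, rfl⟩))
      · rw [hadamard_single, mul_one, single_eq_smul_tt, map_smul]
        exact Submodule.smul_mem _ _ (Submodule.subset_span ⟨p, hp, rfl⟩)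

theorem HasDegree.HMod_le (hr : HasDegree φ r) : HMod φ ≤ hr.spanMod := by
  refine LieSubmodule.lieSpan_le.mpr ?_
  rintro _ rfl
  exact Submodule.subset_span (s := {a | ∃ p : ℤ, (r : ℤ) ∣ p ∧ a = tm φ (tt p)})
    ⟨0, dvd_zero _, rfl⟩

theorem HasDegree.mem_HMod_iff (hr : HasDegree φ r) {p : ℤ} :
    tm φ (tt p) ∈ HMod φ ↔ (r : ℤ) ∣ p := by
  refine ⟨fun h => ?_, hr.tt_mem_HMod⟩
  by_contra hp
  -- The coefficient of `T ^ p`, which vanishes on the spanning monomials since their exponents are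
  -- divisible by `r`.
  let g : TMod φ →ₗ[K] K := show LaurentPolynomial K →ₗ[K] K from
    pairing fun m => if m = p then 1 else 0
  have hg : ∀ q, g (tm φ (tt q)) = if q = p then 1 else 0 := fun q => pairing_tt _ q
  have hle : hr.spanMod.toSubmodule ≤ LinearMap.ker g := by
    refine Submodule.span_le.mpr ?_
    rintro _ ⟨q, hq, rfl⟩
    refine LinearMap.mem_ker.mpr ?_
    rw [hg, if_neg]
    rintro rfl
    exact hp hq
  have h0 := LinearMap.mem_ker.mp (hle (hr.HMod_le h))
  rw [hg, if_pos rfl] at h0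
  exact one_ne_zero h0

theorem HasDegree.span_hvec (hr : HasDegree φ r) :
    Submodule.span K (Set.range (hvec φ)) = ⊤ := by
  rw [eq_top_iff]
  rintro ⟨a, ha⟩ -
  have : a ∈ Submodule.map (HMod φ).toSubmodule.subtype
      (Submodule.span K (Set.range (hvec φ))) := by
    rw [Submodule.map_span]
    refine Submodule.span_mono ?_ (hr.HMod_le ha)
    rintro _ ⟨p, hp, rfl⟩
    exact ⟨hvec φ ⟨p, hr.tt_mem_HMod hp⟩, ⟨_, rfl⟩, rfl⟩
  obtain ⟨b, hb, rfl⟩ := this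
  exact hb

theorem borelE_lie_hmod (a : LaurentPolynomial K) (n : HMod φ) : ⁅borelE a, n⁆ = 0 :=
  Subtype.ext (borelE_lie φ a n.1)

theorem borelD_lie_hvec (p : HExp φ) : ⁅borelD K, hvec φ p⁆ = ((p : ℤ) : K) • hvec φ p :=
  Subtype.ext (borelD_lie_tt φ p)

end HModule

/-! ### The maximal submodule of the induced module of the affine Lie algebra -/

section AffMaxSub

variable {K : Type u} [Field K] {φ : ℤ → K} {r : ℕ}

theorem word_add {M : Type w} [AddCommGroup M] [Module K M]
    (ρ : LoopAlg K →ₗ⁅K⁆ Module.End K M) (l : List ℤ) (x y : M) :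
    word ρ l (x + y) = word ρ l x + word ρ l y := by
  induction l with
  | nil => rfl
  | cons m l ih => rw [word_cons, ih, map_add, word_cons, word_cons]

theorem alact_h_indMk (m : ℤ) (n : HMod φ) :
    alact φ (loop (sh K) (tt m)) (indMk n) = indMk ⁅borelH (K := K) (tt m), n⁆ :=
  act_indMk (borelH (tt m)) n

theorem alact_e_indMk (m : ℤ) (n : HMod φ) :
    alact φ (loop (se K) (tt m)) (indMk n) = 0 := by
  have h : alact φ (loop (se K) (tt m)) (indMk n) = indMk ⁅borelE (K := K) (tt m), n⁆ :=
    act_indMk (borelE (tt m)) n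
  rw [h, borelE_lie_hmod, map_zero]

theorem aact_d_indMk (n : HMod φ) : aact φ (affD K) (indMk n) = indMk ⁅borelD K, n⁆ :=
  act_indMk (borelD K) n

theorem aact_d_f (m : ℤ) (x : AffInd φ) :
    aact φ (affD K) (alact φ (loop (sf K) (tt m)) x) =
      alact φ (loop (sf K) (tt m)) (aact φ (affD K) x) +
        (m : K) • alact φ (loop (sf K) (tt m)) x := by
  have h := LieHom.map_lie (aact φ) (affD K) (affInl K (loop (sf K) (tt m)))
  rw [affD_loop, map_smul] at h
  have h' := LinearMap.congr_fun h x
  change (m : K) • alact φ (loop (sf K) (tt m)) x = aact φ (affD K) (alact φ _ x) -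
    alact φ _ (aact φ (affD K) x) at h'
  rw [h']; abel

theorem word_deg {M : Type w} [AddCommGroup M] [Module K M]
    (ρ : LoopAlg K →ₗ⁅K⁆ Module.End K M) (T : Module.End K M)
    (hT : ∀ (m : ℤ) (x : M), T (ρ (loop (sf K) (tt m)) x) =
      ρ (loop (sf K) (tt m)) (T x) + (m : K) • ρ (loop (sf K) (tt m)) x) (l : List ℤ) (x : M) :
    T (word ρ l x) = word ρ l (T x) + (l.sum : K) • word ρ l x := by
  induction l with
  | nil => simp
  | cons m l ih =>
    rw [word_cons, hT, ih, map_add, map_smul, word_cons, List.sum_cons, Int.cast_add]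
    module

theorem aact_d_word (l : List ℤ) (n : HMod φ) :
    aact φ (affD K) (word (alact φ) l (indMk n)) =
      word (alact φ) l (indMk ⁅borelD K, n⁆) +
        (l.sum : K) • word (alact φ) l (indMk n) := by
  rw [word_deg (alact φ) _ aact_d_f, aact_d_indMk]

/-- Straightening shows stability under the loop algebra; `d` preserves the span too, since it acts
on a word by its total exponent plus its action on `H(φ)`. -/
theorem wordSpan_indMk :
    wordSpan (alact φ) (LinearMap.range (indMk : HMod φ →ₗ[K] AffInd φ)) = ⊤ := by
  set N := LinearMap.range (indMk : HMod φ →ₗ[K] AffInd φ) with hN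
  have hh : ∀ m, ∀ x ∈ N, alact φ (loop (sh K) (tt m)) x ∈ N := by
    rintro m _ ⟨n, rfl⟩
    rw [alact_h_indMk]; exact ⟨_, rfl⟩
  have he : ∀ m, ∀ x ∈ N, alact φ (loop (se K) (tt m)) x = 0 := by
    rintro m _ ⟨n, rfl⟩
    exact alact_e_indMk m n
  have hd : ∀ x ∈ wordSpan (alact φ) N, aact φ (affD K) x ∈ wordSpan (alact φ) N := by
    intro x hx
    induction hx using Submodule.span_induction with
    | zero => rw [map_zero]; exact zero_mem _
    | add x y _ _ hx hy => rw [map_add]; exact add_mem hx hy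
    | smul c x _ hx => rw [map_smul]; exact Submodule.smul_mem _ _ hx
    | mem x hx =>
      obtain ⟨l, _, ⟨n, rfl⟩, rfl⟩ := hx
      rw [aact_d_word]
      exact add_mem (word_mem_wordSpan _ l ⟨_, rfl⟩)
        (Submodule.smul_mem _ _ (word_mem_wordSpan _ l ⟨_, rfl⟩))
  have hz : ∀ z, ∀ x ∈ wordSpan (alact φ) N, aact φ z x ∈ wordSpan (alact φ) N := by
    intro z x hx
    rw [aff_decomp z, map_add, map_smul]
    exact add_mem (wordSpan_rep (alact φ) hh he z.left x hx) (Submodule.smul_mem _ _ (hd x hx))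
  have : toEnvSubmodule _ hz = ⊤ :=
    ind_span _ fun n => word_mem_wordSpan (alact φ) [] ⟨n, rfl⟩
  rw [eq_top_iff]
  rintro x -
  have hx : x ∈ toEnvSubmodule _ hz := by rw [this]; trivial
  exact hx

theorem HasDegree.span_aword (hr : HasDegree φ r) :
    Submodule.span K (Set.range (aword φ)) = ⊤ := by
  rw [eq_top_iff, ← wordSpan_indMk]
  refine Submodule.span_le.mpr ?_
  rintro _ ⟨l, _, ⟨n, rfl⟩, rfl⟩
  have hn : n ∈ Submodule.span K (Set.range (hvec φ)) := by rw [hr.span_hvec]; trivial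
  change word (alact φ) l (indMk n) ∈ Submodule.span K (Set.range (aword φ))
  induction hn using Submodule.span_induction with
  | mem n hn =>
    obtain ⟨p, rfl⟩ := hn
    exact Submodule.subset_span ⟨(l, p), rfl⟩
  | zero =>
    rw [map_zero, ← zero_smul K (0 : AffInd φ), word_smul, zero_smul]
    exact zero_mem _
  | add a b _ _ ha hb => rw [map_add, word_add]; exact add_mem ha hb
  | smul c a _ ha => rw [map_smul, word_smul]; exact Submodule.smul_mem _ _ ha

theorem borelH_zero_lie (n : HMod φ) : ⁅borelH (K := K) (tt 0), n⁆ = φ 0 • n := by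
  obtain ⟨a, ha⟩ := n
  obtain ⟨a, rfl⟩ := tm_surjective φ a
  apply Subtype.ext
  change ⁅borelH (K := K) (tt 0), tm φ a⁆ = φ 0 • tm φ a
  rw [borelH_lie, hadamard_single, mul_one, single_eq_smul_tt, tt_zero, smul_mul_assoc, one_mul,
    map_smul]

theorem alact_h_zero_indMk (n : HMod φ) :
    alact φ (loop (sh K) 1) (indMk n) = φ 0 • (indMk n : AffInd φ) := by
  rw [← tt_zero, alact_h_indMk, borelH_zero_lie, map_smul]

theorem alact_h_aword (i : List ℤ × HExp φ) :
    alact φ (loop (sh K) 1) (aword φ i) = (φ 0 - 2 * i.1.length) • aword φ i :=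
  word_h _ _ _ _ (alact_h_zero_indMk _)

theorem aact_d_aword (i : List ℤ × HExp φ) :
    aact φ (affD K) (aword φ i) = ((i.2 + i.1.sum : ℤ) : K) • aword φ i := by
  rw [aword, aact_d_word, borelD_lie_hvec, map_smul, word_smul, ← add_smul, Int.cast_add]

theorem affLift_alact_e (m : ℤ) (x : AffInd φ) (n : ℤ) :
    affLift φ (alact φ (loop (se K) (tt m)) x) (n + m) =
      lact φ (loop (se K) (tt m)) (affLift φ x n) := by
  change affLift φ (aact φ (affInl K _) x) (n + m) = _
  rw [affLift_act, affRep_e, shiftOp_apply]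

theorem affLift_h (x : AffInd φ) (n : ℤ) :
    affLift φ (alact φ (loop (sh K) 1) x) n = lact φ (loop (sh K) 1) (affLift φ x n) := by
  change affLift φ (aact φ (affInl K _) x) n = _
  rw [affLift_act, ← tt_zero, affRep_h]
  conv_lhs => rw [← add_zero n]
  rw [shiftOp_apply]

theorem affLift_d (x : AffInd φ) (n : ℤ) :
    affLift φ (aact φ (affD K) x) n = (n : K) • affLift φ x n := by
  rw [affLift_act, affRep_d, degOp_apply]

variable [CharZero K]

variable (φ) in
/-- The functional `w ↦ (y_N, v_φ)`, where `y_N` is the coefficient of `T ^ N` in the image of `w`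
in `L(φ) ⊗ K[T;T⁻¹]`. -/
def affHwf (N : ℤ) : Module.Dual K (AffInd φ) :=
  (lForm φ).flip (loopVec φ) ∘ₗ Finsupp.lapply N ∘ₗ affLift φ

theorem affHwf_apply (N : ℤ) (x : AffInd φ) :
    affHwf φ N x = lForm φ (affLift φ x N) (loopVec φ) := rfl

theorem affHwf_h (N : ℤ) (x : AffInd φ) :
    affHwf φ N (alact φ (loop (sh K) 1) x) = φ 0 • affHwf φ N x := by
  rw [affHwf_apply, affHwf_apply, affLift_h, lForm_h, lact_h_vec, map_smul, ← tt_zero, pairing_tt]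

theorem affHwf_d (N : ℤ) (x : AffInd φ) :
    affHwf φ N (aact φ (affD K) x) = (N : K) • affHwf φ N x := by
  rw [affHwf_apply, affHwf_apply, affLift_d, map_smul, LinearMap.smul_apply]

/-- In effect the irreducibility of `H(φ)`: a polynomial in `d` isolates the monomial `T ^ N`, and
the operators `h ⊗ T ^ m` then reach every other monomial of `H(φ)`. -/
theorem HasDegree.eq_top_of_affHwf_indMk (hr : HasDegree φ r)
    {W : Submodule (UniversalEnvelopingAlgebra K (AffAlg K)) (AffInd φ)} {n : HMod φ}
    (hn : indMk n ∈ W) {N : ℤ} (hN : affHwf φ N (indMk n) ≠ 0) : W = ⊤ := by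
  let T : Module.End K (HMod φ) := LieModule.toEnd K (affBorel K) (HMod φ) (borelD K)
  have hT : ∀ a, T a = ⁅borelD K, a⁆ := fun a => rfl
  let W' : Submodule K (HMod φ) := (W.restrictScalars K).comap indMk
  have hW' : ∀ a ∈ W', T a ∈ W' := by
    intro a ha
    change (indMk (T a) : AffInd φ) ∈ W
    rw [hT, ← aact_d_indMk]
    exact act_mem _ ha
  obtain ⟨q, hq, hqn⟩ := exists_aeval_mem (T := T) (μ := (N : K))
    (N := Submodule.span K {a : HMod φ | ∃ p : HExp φ, (p : ℤ) = N ∧ a = hvec φ p})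
    (by
      intro a ha
      induction ha using Submodule.span_induction with
      | mem a ha =>
        obtain ⟨p, hp, rfl⟩ := ha
        rw [hT, borelD_lie_hvec, hp]
      | zero => rw [map_zero, smul_zero]
      | add a b _ _ ha hb => rw [map_add, ha, hb, smul_add]
      | smul c a _ ha => rw [map_smul, ha, smul_comm])
    (s := Set.range (hvec φ))
    (by
      rintro _ ⟨p, rfl⟩
      by_cases h : (p : ℤ) = N
      · exact Or.inl (Submodule.subset_span ⟨p, h, rfl⟩)
      · exact Or.inr ⟨((p : ℤ) : K), fun h' => h (Int.cast_injective h'),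
          borelD_lie_hvec p⟩)
    hr.span_hvec n
  have hmem : Polynomial.aeval T q n ∈ W' := aeval_mem hW' q n hn
  have hval := apply_aeval (T := T) (ξ := affHwf φ N ∘ₗ indMk) (μ := (N : K))
    (fun a => by
      rw [LinearMap.comp_apply, LinearMap.comp_apply, hT, ← aact_d_indMk, affHwf_d]) q n
  have hne : Polynomial.aeval T q n ≠ 0 := by
    intro h0
    rw [h0, map_zero] at hval
    exact smul_ne_zero hq hN hval.symm
  -- Otherwise the `N`-eigenspace of `d` in `H(φ)` would be zero, whereas the projected vector is
  -- not.
  have hNdvd : ∃ p : HExp φ, (p : ℤ) = N := by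
    by_contra! hno
    refine hne ?_
    have : {a : HMod φ | ∃ p : HExp φ, (p : ℤ) = N ∧ a = hvec φ p} = ∅ := by
      refine Set.eq_empty_of_forall_notMem ?_
      rintro _ ⟨p, hp, -⟩
      exact hno p hp
    rw [this, Submodule.span_empty] at hqn
    exact (Submodule.mem_bot K).mp hqn
  obtain ⟨p₀, rfl⟩ := hNdvd
  have hset : {a : HMod φ | ∃ p : HExp φ, (p : ℤ) = (p₀ : ℤ) ∧ a = hvec φ p} = {hvec φ p₀} := by
    ext a
    constructor
    · rintro ⟨p, hp, rfl⟩
      rw [Subtype.ext hp]; rfl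
    · rintro rfl
      exact ⟨p₀, rfl, rfl⟩
  rw [hset] at hqn
  obtain ⟨c, hc⟩ := Submodule.mem_span_singleton.mp hqn
  have hp₀ : hvec φ p₀ ∈ W' := by
    rw [← hc] at hmem hne
    exact (Submodule.smul_mem_iff W' (left_ne_zero_of_smul hne)).mp hmem
  let W'' : Submodule K (TMod φ) := W'.map (HMod φ).toSubmodule.subtype
  have hW'' : ∀ m, ∀ x ∈ W'', ⁅borelH (K := K) (tt m), x⁆ ∈ W'' := by
    rintro m _ ⟨a, ha, rfl⟩
    refine ⟨(⁅borelH (K := K) (tt m), (show HMod φ from a)⁆ : HMod φ), ?_, rfl⟩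
    change (indMk ⁅borelH (K := K) (tt m), (show HMod φ from a)⁆ : AffInd φ) ∈ W
    rw [← alact_h_indMk]
    exact act_mem _ ha
  have hall : ∀ p, hvec φ p ∈ W' := by
    intro p
    -- The difference may be negative; this is allowed because the monoid generated by the support
    -- is all of `rℤ`.
    have hdvd : (r : ℤ) ∣ p - p₀ := dvd_sub (hr.mem_HMod_iff.mp p.2) (hr.mem_HMod_iff.mp p₀.2)
    have hmem := hr.tt_mem hW'' hdvd (q := p₀) ⟨hvec φ p₀, hp₀, rfl⟩
    rw [sub_add_cancel] at hmem
    obtain ⟨a, ha, hap⟩ := hmem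
    have : a = hvec φ p := Subtype.ext hap
    rwa [← this]
  refine ind_span W fun a => ?_
  have ha : a ∈ Submodule.span K (Set.range (hvec φ)) := by rw [hr.span_hvec]; trivial
  have hle : Submodule.span K (Set.range (hvec φ)) ≤ W' := by
    refine Submodule.span_le.mpr ?_
    rintro _ ⟨p, rfl⟩
    exact hall p
  exact hle ha

/-- A polynomial in `h` pushes `x` into the top layer `1 ⊗ H(φ)` without killing the functional, and
there the previous lemma applies. -/
theorem HasDegree.affHwf_eq_zero (hr : HasDegree φ r)
    {W : Submodule (UniversalEnvelopingAlgebra K (AffAlg K)) (AffInd φ)} (hW : W ≠ ⊤)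
    {x : AffInd φ} (hx : x ∈ W) (N : ℤ) : affHwf φ N x = 0 := by
  by_contra h0
  obtain ⟨q, hq, n, hn⟩ := exists_aeval_mem (T := alact φ (loop (sh K) 1)) (μ := φ 0)
    (N := LinearMap.range (indMk : HMod φ →ₗ[K] AffInd φ))
    (by rintro _ ⟨n, rfl⟩; exact alact_h_zero_indMk n)
    (s := Set.range (aword φ))
    (by
      rintro _ ⟨⟨l, p⟩, rfl⟩
      cases l with
      | nil => exact Or.inl ⟨hvec φ p, rfl⟩
      | cons m l =>
        refine Or.inr ⟨_, ?_, alact_h_aword (m :: l, p)⟩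
        rw [List.length_cons, Ne, sub_eq_self]
        exact mul_ne_zero two_ne_zero (Nat.cast_ne_zero.mpr (Nat.succ_ne_zero _)))
    hr.span_aword x
  have hmem : Polynomial.aeval (alact φ (loop (sh K) 1)) q x ∈ W.restrictScalars K :=
    aeval_mem (fun y hy => act_mem _ hy) q x hx
  have hval := apply_aeval (T := alact φ (loop (sh K) 1)) (ξ := affHwf φ N) (affHwf_h N) q x
  rw [← hn] at hmem hval
  refine hW (hr.eq_top_of_affHwf_indMk (n := n) (N := N) hmem ?_)
  rw [hval]
  exact smul_ne_zero hq h0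

/-- Non-degeneracy on `L(φ)` tests each component of `affLift y` against words. The letters cross as
`e`'s acting on `y`, which stays in the proper submodule, and the final pairing with `v_φ` vanishes
by `HasDegree.affHwf_eq_zero`. Conversely the kernel misses the generator `1 ⊗ T ^ 0`. -/
theorem HasDegree.mem_maxSub_affInd (hr : HasDegree φ r) (x : AffInd φ) :
    x ∈ maxSub (UniversalEnvelopingAlgebra K (AffAlg K)) (AffInd φ) ↔ affLift φ x = 0 := by
  have hker : ∀ z, ∀ y ∈ LinearMap.ker (affLift φ), aact φ z y ∈ LinearMap.ker (affLift φ) := by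
    intro z y hy
    rw [LinearMap.mem_ker, affLift_act, LinearMap.mem_ker.mp hy, map_zero]
  constructor
  · suffices h : maxSub (UniversalEnvelopingAlgebra K (AffAlg K)) (AffInd φ) ≤
      toEnvSubmodule _ hker from fun hx => h hx
    refine sSup_le fun W hW y hy => ?_
    refine Finsupp.ext fun N => eq_zero_of_lForm φ fun l => ?_
    induction l generalizing y N with
    | nil => exact hr.affHwf_eq_zero hW hy N
    | cons m l ih =>
      rw [lword, word_cons, ← lForm_e, ← affLift_alact_e]
      exact ih _ (act_mem _ hy) _
  · intro hx
    refine (le_sSup (a := toEnvSubmodule _ hker) fun htop => ?_) (show x ∈ toEnvSubmodule _ hker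
      from hx)
    have : indMk (hvec φ ⟨0, one_mem_HMod⟩) ∈ toEnvSubmodule _ hker := by rw [htop]; trivial
    have h0 : affLift φ (indMk (hvec φ ⟨0, one_mem_HMod⟩)) = 0 := this
    have h1 := affLift_aword φ ([], ⟨0, one_mem_HMod⟩)
    have h2 : aword φ ([], ⟨0, one_mem_HMod⟩) = indMk (hvec φ ⟨0, one_mem_HMod⟩) := rfl
    rw [h2, h0, eq_comm, Finsupp.single_eq_zero] at h1
    exact loopVec_ne_zero φ h1

end AffMaxSub

/-! ### The irreducible quotient and its weight spaces -/

section AffIrreducible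

variable {K : Type u} [Field K] {φ : ℤ → K} {r : ℕ}

variable (φ) in
/-- The quotient map from the induced module to its irreducible quotient. -/
def toAffIrred : AffInd φ →ₗ[K] AffIrred φ :=
  (maxSub (UniversalEnvelopingAlgebra K (AffAlg K)) (AffInd φ)).mkQ.restrictScalars K

theorem toAffIrred_surjective : Function.Surjective (toAffIrred φ) := fun y => by
  obtain ⟨x, rfl⟩ := Submodule.Quotient.mk_surjective _ y
  exact ⟨x, rfl⟩

variable (φ) in
/-- The action of the affine Lie algebra on `L̃(φ)`. -/
abbrev iaact : AffAlg K →ₗ⁅K⁆ Module.End K (AffIrred φ) := act K (AffAlg K) (AffIrred φ)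

variable (K) in
/-- `h` as an element of the affine Lie algebra. -/
abbrev affH : AffAlg K := ⟨loop (sh K) 1, 0⟩

variable (K) in
/-- `h` as an element of the Cartan subalgebra. -/
def cartanH : affCartan K := ⟨affH K, Submodule.subset_span (Set.mem_insert _ _)⟩

variable (K) in
/-- `d` as an element of the Cartan subalgebra. -/
def cartanD : affCartan K :=
  ⟨affD K, Submodule.subset_span (Set.mem_insert_of_mem _ (Set.mem_singleton _))⟩

theorem exists_eq_cartan (z : affCartan K) : ∃ a b : K, z = a • cartanH K + b • cartanD K := by
  obtain ⟨z, hz⟩ := z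
  obtain ⟨a, b, rfl⟩ := Submodule.mem_span_pair.mp hz
  exact ⟨a, b, rfl⟩

theorem cartan_ext {χ ψ : Module.Dual K (affCartan K)} (hh : χ (cartanH K) = ψ (cartanH K))
    (hd : χ (cartanD K) = ψ (cartanD K)) : χ = ψ := by
  refine LinearMap.ext fun z => ?_
  obtain ⟨a, b, rfl⟩ := exists_eq_cartan z
  simp only [map_add, map_smul, hh, hd]

/-! ### Joint eigenspaces of `h` and `d` -/

section Cartan

variable {M : Type w} [AddCommGroup M] [Module K M]
  [Module (UniversalEnvelopingAlgebra K (AffAlg K)) M]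
  [IsScalarTower K (UniversalEnvelopingAlgebra K (AffAlg K)) M]

theorem mem_weightSpace_aff {χ : Module.Dual K (affCartan K)} (x : M) :
    x ∈ weightSpace K M χ ↔ act K _ M (affH K) x = χ (cartanH K) • x ∧
      act K _ M (affD K) x = χ (cartanD K) • x := by
  constructor
  · intro h
    exact ⟨h (cartanH K), h (cartanD K)⟩
  · rintro ⟨h1, h2⟩ z
    obtain ⟨a, b, rfl⟩ := exists_eq_cartan z
    change act K _ M (a • affH K + b • affD K) x = _
    rw [map_add, map_smul, map_smul, LinearMap.add_apply, LinearMap.smul_apply,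
      LinearMap.smul_apply, h1, h2, map_add, map_smul, map_smul, add_smul, smul_assoc, smul_assoc]

variable (K M) in
theorem commute_h_d : Commute (act K _ M (affH K)) (act K _ M (affD K)) := by
  have h0 : ⁅affD K, affH K⁆ = 0 := by
    have := affD_loop (K := K) (sh K) 0
    rwa [Int.cast_zero, zero_smul] at this
  have h := LieHom.map_lie (act K _ M) (affD K) (affH K)
  rw [h0, map_zero, Ring.lie_def, eq_comm, sub_eq_zero] at h
  exact h.symm

/-- A weight is determined by its values on `h` and `d`, which commute, so weight spaces lie in
joint generalised eigenspaces with distinct pairs of eigenvalues. -/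
theorem iSupIndep_weightSpace :
    iSupIndep fun χ : Module.Dual K (affCartan K) => weightSpace K M χ := by
  let T : Bool → Module.End K M := fun b => if b then act K _ M (affH K) else act K _ M (affD K)
  have hcomm : ∀ i j, Commute (T j) (T i) := by
    intro i j
    cases i <;> cases j
    · exact Commute.refl _
    · exact commute_h_d K M
    · exact (commute_h_d K M).symm
    · exact Commute.refl _
  have hind := Module.End.independent_iInf_maxGenEigenspace_of_forall_mapsTo T
    fun i j μ => Module.End.mapsTo_maxGenEigenspace_of_comm (hcomm i j) μ
  let c : Module.Dual K (affCartan K) → Bool → K := fun χ b =>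
    if b then χ (cartanH K) else χ (cartanD K)
  have hc : Function.Injective c := fun χ ψ h =>
    cartan_ext (congrFun h true) (congrFun h false)
  refine (hind.comp hc).mono fun χ x hx => ?_
  obtain ⟨h1, h2⟩ := (mem_weightSpace_aff x).mp hx
  refine (Submodule.mem_iInf _).mpr fun b => Module.End.eigenspace_le_maxGenEigenspace ?_
  cases b
  · exact Module.End.mem_eigenspace_iff.mpr h2
  · exact Module.End.mem_eigenspace_iff.mpr h1

end Cartan

variable (φ) in
/-- The weight `φ(0) α / 2 - k α + n δ`. -/
def affWeight (k : ℕ) (n : ℤ) : Module.Dual K (affCartan K) :=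
  (φ 0 / 2) • alpha K - k • alpha K + n • delta K

theorem affWeight_d (k : ℕ) (n : ℤ) : affWeight φ k n (cartanD K) = n := by
  have h1 : alpha K (cartanD K) = 0 := alpha_d _ rfl
  have h2 : delta K (cartanD K) = 1 := delta_d _ rfl
  simp [affWeight, h1, h2]

theorem affWeight_h [CharZero K] (k : ℕ) (n : ℤ) :
    affWeight φ k n (cartanH K) = φ 0 - 2 * k := by
  have h1 : alpha K (cartanH K) = 2 := alpha_h _ rfl
  have h2 : delta K (cartanH K) = 0 := delta_h _ rfl
  simp [affWeight, h1, h2, mul_comm (k : K)]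

theorem affWeight_injective [CharZero K] {k k' : ℕ} {n n' : ℤ}
    (h : affWeight φ k n = affWeight φ k' n') : k = k' ∧ n = n' := by
  constructor
  · have := LinearMap.congr_fun h (cartanH K)
    rw [affWeight_h, affWeight_h, sub_right_inj] at this
    exact_mod_cast mul_left_cancel₀ (two_ne_zero (α := K)) this
  · have := LinearMap.congr_fun h (cartanD K)
    rw [affWeight_d, affWeight_d] at this
    exact_mod_cast this

variable [CharZero K]

theorem aword_mem_weightSpace (i : List ℤ × HExp φ) :
    toAffIrred φ (aword φ i) ∈
      weightSpace K (AffIrred φ) (affWeight φ i.1.length (i.2 + i.1.sum)) := by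
  refine (mem_weightSpace_aff _).mpr ⟨?_, ?_⟩
  · rw [affWeight_h]
    exact (congrArg (toAffIrred φ) (alact_h_aword i)).trans ((toAffIrred φ).map_smul _ _)
  · rw [affWeight_d]
    exact (congrArg (toAffIrred φ) (aact_d_aword i)).trans ((toAffIrred φ).map_smul _ _)

theorem HasDegree.isWeightModule (hr : HasDegree φ r) :
    IsWeightModule K (affCartan K) (AffIrred φ) := by
  classical
  refine (DirectSum.isInternal_submodule_iff_iSupIndep_and_iSup_eq_top _).mpr
    ⟨iSupIndep_weightSpace, ?_⟩
  rw [eq_top_iff]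
  rintro x -
  obtain ⟨x, rfl⟩ := toAffIrred_surjective x
  have hx : x ∈ Submodule.span K (Set.range (aword φ)) := by rw [hr.span_aword]; trivial
  have hle : Submodule.span K (Set.range (aword φ)) ≤ (⨆ χ : Module.Dual K (affCartan K),
      weightSpace K (AffIrred φ) χ).comap (toAffIrred φ) := by
    refine Submodule.span_le.mpr ?_
    rintro _ ⟨i, rfl⟩
    exact Submodule.mem_iSup_of_mem _ (aword_mem_weightSpace i)
  exact hle hx

/-- The embedding of `L̃(φ)` into `L(φ) ⊗ K[T;T⁻¹]`. -/
def HasDegree.embed (hr : HasDegree φ r) : AffIrred φ →ₗ[K] (ℤ →₀ LoopIrred φ) :=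
  liftQK _ (affLift φ) fun x hx => (hr.mem_maxSub_affInd x).mp hx

theorem HasDegree.embed_toAffIrred (hr : HasDegree φ r) (x : AffInd φ) :
    hr.embed (toAffIrred φ x) = affLift φ x := rfl

theorem HasDegree.embed_injective (hr : HasDegree φ r) : Function.Injective hr.embed := by
  refine (injective_iff_map_eq_zero _).mpr fun x hx => ?_
  obtain ⟨x, rfl⟩ := toAffIrred_surjective x
  exact (Submodule.Quotient.mk_eq_zero _).mpr ((hr.mem_maxSub_affInd x).mpr hx)

theorem HasDegree.embed_h (hr : HasDegree φ r) (x : AffIrred φ) (n : ℤ) :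
    hr.embed (iaact φ (affH K) x) n = lact φ (loop (sh K) 1) (hr.embed x n) := by
  obtain ⟨x, rfl⟩ := toAffIrred_surjective x
  exact affLift_h x n

theorem HasDegree.embed_d (hr : HasDegree φ r) (x : AffIrred φ) (n : ℤ) :
    hr.embed (iaact φ (affD K) x) n = (n : K) • hr.embed x n := by
  obtain ⟨x, rfl⟩ := toAffIrred_surjective x
  exact affLift_d x n

omit [CharZero K] in
theorem eq_smul_iff_of_injective {M : Type*} {N : Type*} [AddCommGroup M] [Module K M]
    [AddCommGroup N] [Module K N] (f : M →ₗ[K] (ℤ →₀ N)) (hf : Function.Injective f) {x y : M}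
    {c : K} : y = c • x ↔ ∀ n, f y n = c • f x n := by
  rw [← hf.eq_iff, Finsupp.ext_iff]
  simp only [map_smul, Finsupp.smul_apply]

theorem HasDegree.mem_weightSpace_iff (hr : HasDegree φ r) {χ : Module.Dual K (affCartan K)}
    (x : AffIrred φ) : x ∈ weightSpace K (AffIrred φ) χ ↔
      ∀ n, lact φ (loop (sh K) 1) (hr.embed x n) = χ (cartanH K) • hr.embed x n ∧
        (n : K) • hr.embed x n = χ (cartanD K) • hr.embed x n := by
  refine (mem_weightSpace_aff x).trans ((and_congr
    (eq_smul_iff_of_injective hr.embed hr.embed_injective)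
    (eq_smul_iff_of_injective hr.embed hr.embed_injective)).trans (forall_and.symm.trans ?_))
  refine forall_congr' fun n => ?_
  rw [hr.embed_h, hr.embed_d]

/-- A non-zero weight vector has some non-zero component in the loop module: its degree gives `n`,
and its `h`-eigenvalue on `L(φ)` gives `k`. -/
theorem HasDegree.exists_affWeight (hr : HasDegree φ r) {χ : Module.Dual K (affCartan K)}
    (h : weightSpace K (AffIrred φ) χ ≠ ⊥) : ∃ k n, χ = affWeight φ k n := by
  obtain ⟨x, hx, hx0⟩ := Submodule.exists_mem_ne_zero_of_ne_bot h
  rw [hr.mem_weightSpace_iff] at hx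
  have : hr.embed x ≠ 0 := fun h0 => hx0 (hr.embed_injective (h0.trans (map_zero _).symm))
  obtain ⟨n, hn⟩ := Finsupp.ne_iff.mp this
  rw [Finsupp.zero_apply] at hn
  obtain ⟨h1, h2⟩ := hx n
  obtain ⟨k, hk⟩ := exists_weight φ h1 hn
  refine ⟨k, n, cartan_ext ?_ ?_⟩
  · rw [hk, affWeight_h]
  · rw [affWeight_d]; exact (smul_left_injective K hn h2).symm

variable {ζ : Kˣ}

/-- A word landing in degree `n` has total exponent `n - p` with `r ∣ p`, and `ζ ^ p = 1`. -/
theorem HasDegree.eta_embed (hr : HasDegree φ r) (hζ : ζ ^ r = 1) (x : AffIrred φ) (n : ℤ) :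
    eta hr ζ hζ (hr.embed x n) = ((ζ ^ (-n) : Kˣ) : K) • hr.embed x n := by
  obtain ⟨x, rfl⟩ := toAffIrred_surjective x
  have hx : x ∈ Submodule.span K (Set.range (aword φ)) := by rw [hr.span_aword]; trivial
  rw [hr.embed_toAffIrred]
  induction hx using Submodule.span_induction with
  | zero => simp only [map_zero, Finsupp.zero_apply, smul_zero]
  | add x y _ _ hx hy => simp only [map_add, Finsupp.add_apply, smul_add, hx, hy]
  | smul c x _ hx => rw [map_smul, Finsupp.smul_apply, map_smul, hx, smul_comm]
  | mem x hx =>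
    obtain ⟨⟨l, p⟩, rfl⟩ := hx
    rw [affLift_aword]
    by_cases h : (p : ℤ) + l.sum = n
    · subst h
      rw [Finsupp.single_eq_same, eta_lword]
      obtain ⟨j, hj⟩ := hr.mem_HMod_iff.mp p.2
      have hp : ζ ^ (-(p : ℤ)) = 1 := by
        rw [zpow_neg, hj, zpow_mul, zpow_natCast, hζ, one_zpow, inv_one]
      rw [neg_add, zpow_add, hp, one_mul]
    · rw [Finsupp.single_eq_of_ne (Ne.symm h), map_zero, smul_zero]

/-- Converse of `HasDegree.eta_embed`, and the place where primitivity matters: a word with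
`η`-eigenvalue `ζ ^ (-n)` has total exponent congruent to `n` modulo `r`, so the missing power of
`T` lies in `H(φ)`. -/
theorem HasDegree.single_mem_range (hr : HasDegree φ r) (hζ : IsPrimitiveRoot ζ r) {n : ℤ}
    {y : LoopIrred φ} (hy : eta hr ζ hζ.pow_eq_one y = ((ζ ^ (-n) : Kˣ) : K) • y) :
    ∃ x, hr.embed x = Finsupp.single n y := by
  have h := mem_span_of_eigen _ _ (eta_lword hr ζ hζ.pow_eq_one) (span_lword φ) hy
  change y ∈ (LinearMap.range hr.embed).comap (Finsupp.lsingle n : LoopIrred φ →ₗ[K] _)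
  refine Submodule.span_le.mpr ?_ h
  rintro _ ⟨l, hl, rfl⟩
  have hdvd : (r : ℤ) ∣ n - l.sum := by
    rw [← hζ.zpow_eq_one_iff_dvd, sub_eq_add_neg, zpow_add, Units.ext hl, ← zpow_add,
      add_neg_cancel, zpow_zero]
  refine ⟨toAffIrred φ (aword φ (l, ⟨n - l.sum, hr.tt_mem_HMod hdvd⟩)), ?_⟩
  rw [hr.embed_toAffIrred, affLift_aword]
  change Finsupp.single (n - l.sum + l.sum) _ = _
  rw [sub_add_cancel]
  rfl

theorem HasDegree.mem_weightSpace_of_embed_eq_single (hr : HasDegree φ r) {k : ℕ} {n : ℤ}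
    {y : LoopIrred φ} (hy : lact φ (loop (sh K) 1) y = (φ 0 - 2 * k) • y) {x : AffIrred φ}
    (hx : hr.embed x = Finsupp.single n y) :
    x ∈ weightSpace K (AffIrred φ) (affWeight φ k n) := by
  refine (hr.mem_weightSpace_iff x).mpr fun m => ?_
  rw [hx, affWeight_h, affWeight_d]
  by_cases hm : m = n
  · rw [hm, Finsupp.single_eq_same]
    exact ⟨hy, rfl⟩
  · rw [Finsupp.single_eq_of_ne hm]
    exact ⟨(LinearMap.map_zero _).trans (smul_zero _).symm,
      (smul_zero _).trans (smul_zero _).symm⟩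

theorem HasDegree.embed_apply_mem_semiInvariants (hr : HasDegree φ r) (hζ : ζ ^ r = 1) {k : ℕ}
    {n : ℤ} {x : AffIrred φ} (hx : x ∈ weightSpace K (AffIrred φ) (affWeight φ k n)) :
    hr.embed x n ∈ semiInvariants hr ζ hζ k (-n) := by
  rw [mem_semiInvariants]
  have h := ((hr.mem_weightSpace_iff x).mp hx n).1
  rw [affWeight_h] at h
  exact ⟨h, hr.eta_embed hζ x n⟩

/-- The `d`-eigenvalue `n` forces every component in another degree to vanish, integers being
distinct in characteristic zero. -/
theorem HasDegree.eq_zero_of_embed_apply_eq_zero (hr : HasDegree φ r) {k : ℕ} {n : ℤ}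
    {x : AffIrred φ} (hx : x ∈ weightSpace K (AffIrred φ) (affWeight φ k n))
    (h0 : hr.embed x n = 0) : x = 0 := by
  refine hr.embed_injective (Eq.trans (Finsupp.ext fun m => ?_) (LinearMap.map_zero _).symm)
  by_cases hm : m = n
  · rw [hm]; exact h0
  · have h := ((hr.mem_weightSpace_iff x).mp hx m).2
    rw [affWeight_d] at h
    by_contra hne
    exact hm (Int.cast_injective (smul_left_injective K hne h))

theorem HasDegree.exists_embed_eq_single (hr : HasDegree φ r) (hζ : IsPrimitiveRoot ζ r) {k : ℕ}
    {n : ℤ} {y : LoopIrred φ} (hy : y ∈ semiInvariants hr ζ hζ.pow_eq_one k (-n)) :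
    ∃ x ∈ weightSpace K (AffIrred φ) (affWeight φ k n), hr.embed x n = y := by
  obtain ⟨h1, h2⟩ := (mem_semiInvariants hr ζ hζ.pow_eq_one y).mp hy
  obtain ⟨x, hx⟩ := hr.single_mem_range hζ h2
  exact ⟨x, hr.mem_weightSpace_of_embed_eq_single h1 hx,
    (DFunLike.congr_fun hx n).trans Finsupp.single_eq_same⟩

omit [CharZero K] in
theorem nonempty_equiv_of_mapsTo {M N : Type*} [AddCommGroup M] [Module K M] [AddCommGroup N]
    [Module K N] (f : M →ₗ[K] N) (p : Submodule K M) (q : Submodule K N)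
    (hmaps : ∀ x ∈ p, f x ∈ q) (hinj : ∀ x ∈ p, f x = 0 → x = 0)
    (hsurj : ∀ y ∈ q, ∃ x ∈ p, f x = y) : Nonempty (p ≃ₗ[K] q) := by
  refine ⟨LinearEquiv.ofBijective (f.restrict hmaps)
    ⟨(injective_iff_map_eq_zero _).mpr ?_, ?_⟩⟩
  · rintro ⟨x, hx⟩ h0
    exact Subtype.ext (hinj x hx (congrArg Subtype.val h0))
  · rintro ⟨y, hy⟩
    obtain ⟨x, hx, rfl⟩ := hsurj y hy
    exact ⟨⟨x, hx⟩, rfl⟩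

/-- The weight spaces of `L̃(φ)` are isomorphic to spaces of semi-invariants of `L(φ)`. -/
theorem HasDegree.nonempty_equiv (hr : HasDegree φ r) (hζ : IsPrimitiveRoot ζ r) (k : ℕ) (n : ℤ) :
    Nonempty (weightSpace K (AffIrred φ) (affWeight φ k n) ≃ₗ[K]
      semiInvariants hr ζ hζ.pow_eq_one k (-n)) :=
  nonempty_equiv_of_mapsTo (Finsupp.lapply n ∘ₗ hr.embed) _ _
    (fun _ hx => hr.embed_apply_mem_semiInvariants hζ.pow_eq_one hx)
    (fun _ hx h0 => hr.eq_zero_of_embed_apply_eq_zero hx h0)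
    (fun _ hy => hr.exists_embed_eq_single hζ hy)

theorem HasDegree.finrank_weightSpace (hr : HasDegree φ r) (hφ : IsExpPoly φ)
    (hζ : IsPrimitiveRoot ζ r) (k : ℕ) (n : ℤ) :
    Module.finrank K (weightSpace K (AffIrred φ) (affWeight φ k n)) =
      Module.finrank K (semiInvariants hr ζ hζ.pow_eq_one k n) := by
  obtain ⟨g⟩ := hr.nonempty_equiv hζ k n
  rw [g.finrank_eq, finrank_semiInvariants_neg hr ζ hζ.pow_eq_one hφ]

theorem HasDegree.finite_weightSpace (hr : HasDegree φ r) (hφ : IsExpPoly φ)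
    (hζ : IsPrimitiveRoot ζ r) (χ : Module.Dual K (affCartan K)) :
    FiniteDimensional K (weightSpace K (AffIrred φ) χ) := by
  by_cases h : weightSpace K (AffIrred φ) χ = ⊥
  · rw [h]; infer_instance
  · obtain ⟨k, n, rfl⟩ := hr.exists_affWeight h
    obtain ⟨g⟩ := hr.nonempty_equiv hζ k n
    have := semiInvariants_finite hr ζ hζ.pow_eq_one hφ k (-n)
    exact g.symm.finiteDimensional

/-- The weights `affWeight φ k n` are pairwise distinct, so at most one term of the double sum
survives at a given `χ`; at any other `χ` the weight space is zero. -/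
theorem HasDegree.character_eq (hr : HasDegree φ r) (hφ : IsExpPoly φ)
    (hζ : IsPrimitiveRoot ζ r) (χ : Module.Dual K (affCartan K)) :
    character K (affCartan K) (AffIrred φ) χ = ∑ᶠ (k : ℕ) (n : ℤ),
      Module.finrank K (semiInvariants hr ζ hζ.pow_eq_one k n) * expZ (affWeight φ k n) χ := by
  by_cases h : ∃ k n, χ = affWeight φ k n
  · obtain ⟨k, n, rfl⟩ := h
    rw [finsum_eq_single _ k, finsum_eq_single _ n, expZ, if_pos rfl, mul_one, character,
      hr.finrank_weightSpace hφ hζ]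
    · intro n' hn'
      rw [expZ, if_neg fun h => hn' (affWeight_injective h).2.symm, mul_zero]
    · intro k' hk'
      refine finsum_eq_zero_of_forall_eq_zero fun n' => ?_
      rw [expZ, if_neg fun h => hk' (affWeight_injective h).1.symm, mul_zero]
  · have h0 : weightSpace K (AffIrred φ) χ = ⊥ := by
      by_contra hne
      exact h (hr.exists_affWeight hne)
    rw [character, h0, finrank_bot, eq_comm]
    refine finsum_eq_zero_of_forall_eq_zero fun k => finsum_eq_zero_of_forall_eq_zero fun n => ?_
    rw [expZ, if_neg fun h' => h ⟨k, n, h'⟩, mul_zero]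

end AffIrreducible

end ExpPolyModules

end

/-! ### The character formula -/

open ExpPolyModules in
theorem mainTheorem7 {K : Type*} [Field K] [IsAlgClosed K] [CharZero K]
    (φ : ℤ → K) (hφ : IsExpPoly φ) (hφ0 : φ ≠ 0) :
    IsWeightModule K (affCartan K) (AffIrred φ) ∧
    (∀ χ : Module.Dual K (affCartan K), FiniteDimensional K (weightSpace K (AffIrred φ) χ)) ∧
    (∀ k : ℕ, FiniteDimensional K (weightSpace K (LoopIrred φ) (loopWeight φ k))) ∧
    ∃ (r : ℕ) (hr : HasDegree φ r), ∀ (ζ : Kˣ) (hζ : IsPrimitiveRoot ζ r),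
      character K (affCartan K) (AffIrred φ) = fun χ =>
        ∑ᶠ (k : ℕ) (n : ℤ),
          Module.finrank K (semiInvariants hr ζ hζ.pow_eq_one k n) *
            expZ ((φ 0 / 2) • alpha K - k • alpha K + n • delta K) χ := by
  obtain ⟨r, hr⟩ := hφ.exists_hasDegree hφ0
  have : NeZero (r : K) := ⟨Nat.cast_ne_zero.mpr hr.1.ne'⟩
  have : NeZero r := ⟨hr.1.ne'⟩
  -- Finiteness of the weight spaces does not mention `ζ`, but its proof compares them with
  -- semi-invariants, so some primitive root must be chosen first.
  obtain ⟨z, hz⟩ := HasEnoughRootsOfUnity.exists_primitiveRoot K r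
  obtain ⟨ζ, hζ⟩ : ∃ ζ : Kˣ, IsPrimitiveRoot ζ r :=
    ⟨(hz.isUnit hr.1.ne').unit, hz.isUnit_unit hr.1.ne'⟩
  exact ⟨hr.isWeightModule, hr.finite_weightSpace hφ hζ, weightSpace_loop_finite φ hφ, r, hr,
    fun ζ hζ => funext fun χ => hr.character_eq hφ hζ χ⟩
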